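/- **Setting.** Let $\mathbb H=\{w\in\mathbb C:|w|<1\}$ be the Poincaré disc with its hyperbolic distance $d_{\mathbb H}$ (that of the Riemannian metric $4|dw|^2/(1-|w|^2)^2$). The polar coordinates $(r,\theta)$ of $w\in\mathbb H$ are its hyperbolic distance $r$ to $0$ and its argument $\theta$. Fix $\alpha,\nu>0$, and for integers $n>\nu$ put $R_n=2\log(n/\nu)$ and let $\mu_n$ be the law on $\mathbb H$ of a point whose polar coordinates are independent, $\theta$ being uniform on $(-\pi,\pi]$ and $r$ having density $\rho_n(r)=\frac{\alpha\sinh(\alpha r)}{\cosh(\alpha R_n)-1}\mathbf 1_{0\le r<R_n}$. The random hyperbolic graph $\mathcal G_{\alpha,\nu}(n)$ has as nodes $n$ independent points $X_1^n,\dots,X_n^n$ of law $\mu_n$, two distinct nodes being adjacent if and only if their hyperbolic distance is at most $R_n$. Let $\deg(X_i^n)$ be the degree of $X_i^n$ and $D_n^{\max}$ the maximum degree. For $E\subset[-\infty,\infty]$, $M_p(E)$ is the space of locally finite point measures on $E$ with the vague topology (the coarsest one making $m\mapsto\int f\,dm$ continuous for all continuous compactly supported $f:E\to\mathbb R$) and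 its Borel $\sigma$-algebra; points outside $E$ are discarded when a sum of Dirac masses is regarded as an element of $M_p(E)$. Convergence in distribution $\xrightarrow{d}$ in $M_p(E)$ or in $\mathbb R$ is weak convergence of laws. Let $\eta_g$ denote a Poisson point process on $E$ whose intensity measure has density $g$ with respect to Lebesgue measure. For $\beta>0$, $\mathrm{Weibull}(\beta)$ is the law with $\mathbb P(Z\le z)=1-e^{-z^\beta}$ for $z\ge0$, $\text{Fréchet}(\beta)$ is the law with $\mathbb P(Z\le z)=e^{-z^{-\beta}}$ for $z>0$, and $\mathrm{Exp}(\lambda)$ is the exponential law of rate $\lambda$. **Theorem.** As $n\to\infty$: * If $\alpha<1/2$, then $$\sum_{i=1}^n\delta_{n^{-(\alpha+1/2)}(\deg(X_i^n)-n)}\xrightarrow{d}\eta_{g_1}\ \text{ in }M_p((-\infty,0]),\qquad g_1(y)=2\pi^2\nu^{2\alpha}|y|,$$ and $\displaystyle \pi\nu^\alpha\,\frac{n-D_n^{\max}}{n^{\alpha+1/2}}\xrightarrow{d}\mathrm{Weibull}(2)$. * If $\alpha=1/2$, let $$V_{1/2}(r)=\frac1\pi\int_0^1\arccos\Big(\max\Big(-1,\frac{\cosh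 r-x^{-2}}{\sinh r}\Big)\Big)dx\qquad(r>0).$$ Then $V_{1/2}$ is a bijection from $(0,\infty)$ onto $(0,1)$ with differentiable inverse, $$\sum_{i=1}^n\delta_{n^{-1}\deg(X_i^n)}\xrightarrow{d}\eta_{g_2}\ \text{ in }M_p((0,1]),\qquad g_2(y)=\nu\,\big|(V_{1/2}^{-1})'(y)\big|\,\sinh\big(V_{1/2}^{-1}(y)/2\big)\quad(0<y<1),$$ and $n^{-1}D_n^{\max}\xrightarrow{d}V_{1/2}\big(2\,\mathrm{arcosh}(Z+1)\big)$, where $Z\sim\mathrm{Exp}(2\nu)$. * If $\alpha>1/2$, let $C_\alpha=\frac{2\alpha}{\pi(\alpha-1/2)}$. Then $$\sum_{i=1}^n\delta_{n^{-1/(2\alpha)}\deg(X_i^n)}\xrightarrow{d}\eta_{g_3}\ \text{ in }M_p((0,\infty]),\qquad g_3(y)=2\alpha(C_\alpha\nu)^{2\alpha}y^{-2\alpha-1},$$ and $\displaystyle \frac{D_n^{\max}}{C_\alpha\nu\,n^{1/(2\alpha)}}\xrightarrow{d}\text{Fréchet}(2\alpha)$. -/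

import Mathlib

open MeasureTheory ProbabilityTheory Filter Topology
open scoped NNReal ENNReal CompactlySupported

noncomputable section

namespace RHG

/-! ### The Poincaré disc -/

/-- The Poincaré disc, i.e. the open unit disc of `ℂ`. -/
abbrev Disc : Type := Complex.UnitDisc

instance : MeasurableSpace Disc := borel Disc

instance : BorelSpace Disc := ⟨rfl⟩

/-- The hyperbolic distance of the Poincaré disc (the distance of the Riemannian metric
`4 |dw|² / (1 - |w|²)²`). -/
def hypDist (z w : Disc) : ℝ :=
  Real.arcosh (1 + 2 * ‖(z : ℂ) - w‖ ^ 2 / ((1 - ‖(z : ℂ)‖ ^ 2) * (1 - ‖(w : ℂ)‖ ^ 2)))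

/-- The point with angle `p.2` at (signed) hyperbolic distance `p.1` of the origin;
its Euclidean modulus is `tanh (r / 2)`. -/
def polar (p : ℝ × ℝ) : Disc :=
  Complex.UnitDisc.mk ((Real.tanh (p.1 / 2) : ℂ) * Complex.exp (p.2 * Complex.I)) (by
    rw [norm_mul, Complex.norm_exp_ofReal_mul_I, mul_one, Complex.norm_real, Real.norm_eq_abs]
    exact Real.abs_tanh_lt_one _)

/-! ### The random hyperbolic graph -/

/-- The radius `R_n = 2 log (n / ν)` of the domain. -/
def diskRadius (ν : ℝ) (n : ℕ) : ℝ := 2 * Real.log (n / ν)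

/-- The density of the radial coordinate of a node. -/
def radialDensity (α ν : ℝ) (n : ℕ) (r : ℝ) : ℝ :=
  if 0 ≤ r ∧ r < diskRadius ν n then
    α * Real.sinh (α * r) / (Real.cosh (α * diskRadius ν n) - 1)
  else 0

/-- The law `μ_n` of a node: the radius has density `radialDensity`, the angle is uniform on
`(-π, π]`, and they are independent. It is a probability measure as soon as `n > ν`
(equivalently `R_n > 0`). -/
def nodeLaw (α ν : ℝ) (n : ℕ) : Measure Disc :=
  ((volume.withDensity fun r => ENNReal.ofReal (radialDensity α ν n r)).prod
    (volume[|Set.Ioc (-Real.pi) Real.pi])).map polar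

/-- The hyperbolic graph on the points `x 0, …, x (n - 1)`: two distinct nodes are adjacent iff
their hyperbolic distance is at most `R_n`. -/
def graph (ν : ℝ) {n : ℕ} (x : Fin n → Disc) : SimpleGraph (Fin n) where
  Adj i j := i ≠ j ∧ hypDist (x i) (x j) ≤ diskRadius ν n
  symm := ⟨fun i j h => ⟨h.1.symm, by
    have h2 := h.2
    unfold hypDist at h2 ⊢
    rwa [norm_sub_rev, mul_comm (1 - ‖(x j : ℂ)‖ ^ 2)]⟩⟩
  loopless := ⟨fun i h => h.1 rfl⟩

open Classical in
/-- The degree of the node `i`. -/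
def deg (ν : ℝ) {n : ℕ} (x : Fin n → Disc) (i : Fin n) : ℕ := (graph ν x).degree i

open Classical in
/-- The maximum degree of the graph. -/
def maxDeg (ν : ℝ) {n : ℕ} (x : Fin n → Disc) : ℕ := (graph ν x).maxDegree

/-! ### Point processes on a subspace of `[-∞, ∞]` -/

/-- `M_p(E)`: the locally finite point measures on a subspace `E` of `[-∞, ∞]`. -/
def PointMeasure (E : Set EReal) : Type :=
  {m : Measure E // IsLocallyFiniteMeasure m ∧
    ∃ (ι : Type) (_ : Countable ι) (x : ι → E), m = Measure.sum fun i => Measure.dirac (x i)}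

/-- The vague topology on `M_p(E)`: the coarsest one for which `m ↦ ∫ f dm` is continuous for
every continuous compactly supported `f`. -/
instance (E : Set EReal) : TopologicalSpace (PointMeasure E) :=
  ⨅ f : C_c(E, ℝ), TopologicalSpace.induced (fun m : PointMeasure E => ∫ y, f y ∂m.1) inferInstance

instance (E : Set EReal) : MeasurableSpace (PointMeasure E) := borel (PointMeasure E)

instance (E : Set EReal) : BorelSpace (PointMeasure E) := ⟨rfl⟩

/-- The point measure `∑ i, δ_{x i}`, seen as an element of `M_p(E)` (only the points lying in `E`
count). -/
def pointsIn (E : Set EReal) {n : ℕ} (x : Fin n → EReal) : PointMeasure E :=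
  ⟨Measure.sum fun i : {i : Fin n // x i ∈ E} => Measure.dirac (⟨x i, i.2⟩ : E), by
    classical
    constructor
    · rw [Measure.sum_fintype]; infer_instance
    · exact ⟨_, inferInstance, _, rfl⟩⟩

/-- The measure on `E` with density `g` with respect to the Lebesgue measure. -/
def intensity (E : Set EReal) (g : ℝ → ℝ) : Measure E :=
  ((volume.withDensity fun y => ENNReal.ofReal (g y)).map Real.toEReal).comap Subtype.val

/-- `η` is a Poisson point process on `E` with intensity measure `m`. -/
structure IsPoissonProcess {Ω : Type*} [MeasurableSpace Ω] {E : Set EReal}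
    (η : Ω → PointMeasure E) (m : Measure E) (P : Measure Ω) : Prop where
  measurable : Measurable η
  law : ∀ B : Set E, MeasurableSet B → m B ≠ ∞ →
    HasLaw (fun ω => (η ω).1 B)
      ((poissonMeasure (m B).toNNReal).map fun k : ℕ => (k : ℝ≥0∞)) P
  law_top : ∀ B : Set E, MeasurableSet B → m B = ∞ → ∀ᵐ ω ∂P, (η ω).1 B = ∞
  indep : ∀ (k : ℕ) (B : Fin k → Set E), (∀ i, MeasurableSet (B i)) →
    Pairwise (fun i j => Disjoint (B i) (B j)) → iIndepFun (fun i ω => (η ω).1 (B i)) P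

/-! ### Limit laws -/

/-- `Z` has the Weibull distribution: `P(Z ≤ z) = 1 - exp (-z ^ β)` for `z ≥ 0`. -/
def IsWeibull {Ω : Type*} [MeasurableSpace Ω] (β : ℝ) (Z : Ω → ℝ) (P : Measure Ω) : Prop :=
  Measurable Z ∧ ∀ z : ℝ, 0 ≤ z → P.real {ω | Z ω ≤ z} = 1 - Real.exp (-z ^ β)

/-- `Z` has the Fréchet distribution: `P(Z ≤ z) = exp (-z ^ (-β))` for `z > 0`
(hence `P(Z ≤ 0) = 0`). -/
def IsFrechet {Ω : Type*} [MeasurableSpace Ω] (β : ℝ) (Z : Ω → ℝ) (P : Measure Ω) : Prop :=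
  Measurable Z ∧ ∀ z : ℝ, 0 < z → P.real {ω | Z ω ≤ z} = Real.exp (-z ^ (-β))

/-- The function `V_{1/2}`, meaningful for `r > 0`. -/
def V (r : ℝ) : ℝ :=
  1 / Real.pi * ∫ x in (0 : ℝ)..1,
    Real.arccos (max (-1) ((Real.cosh r - (x ^ 2)⁻¹) / Real.sinh r))

/-- The inverse of `V_{1/2} : (0, ∞) → (0, 1)`. -/
def Vinv : ℝ → ℝ := Function.invFunOn V (Set.Ioi 0)

/-- The constant `C_α`. -/
def C (α : ℝ) : ℝ := 2 * α / (Real.pi * (α - 1 / 2))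

end RHG

end

/-!
# The largest degrees of random hyperbolic graphs

Given the position of a node, its degree is a binomial variable with mean `n - 1` times the mass of
the ball of radius `R_n` around it, and by rotational symmetry (`nodeLaw_ball`) this mass is a
function `ballMass` of the distance of the node to the origin, which is decreasing
(`antitoneOn_ballMass`). The largest degrees are so large that Chernoff bounds for all nodes at once
(`tendsto_exists_count_ge`, `tendsto_exists_count_le`) make the normalized degrees
indistinguishable in the limit from the normalized means. For `α < 1 / 2`, where the largest degrees
are close to `n`, the same is done with the numbers of non-neighbours. The theorem thereby reduces
to a statement on the independent radial coordinates of the nodes: the hypothesis `CloseToScores`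
collects what is needed of them.

*Independent points.* A vague neighbourhood of a point measure on `(a, b]` contains all point
measures that have the same counts in sufficiently fine cells cut out by finitely many thresholds
(`eventually_mem_of_cell_counts_eq`), and for every open set `G` the limit gives `G` a mass that is
recovered, by Fatou's lemma, from the countably many possible counts
(`tendstoInDistribution_of_cells`). Hence convergence in distribution to a Poisson process follows
from that of the counts (`tendstoInDistribution_pointProcess`). The numbers of independent points
in disjoint sets of masses `lam γ / n + o(1 / n)` converge to independent Poisson variables, by
convergence of the characteristic functions (`poisson_le_liminf_counts`). So it suffices that the
mean number of scores above each level `t` converges to the mass of `(t, b]` under the intensity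
measure (`CloseToScores.tendstoInDistribution`). The probability that no score exceeds `t`, which
converges to `exp (-Λ t)` for `Λ t` this mass, gives the limit of the maximum degree
(`CloseToScores.tendsto_forall_le`).

*Mass of a ball.* Write `K = cosh r - sinh r * cos ψ` (`busemannExp`). By the hyperbolic law of
cosines, a node at distance `r` is linked in the direction at angle `ψ` to the points whose distance
to the origin is at most about `R_n - log K`. The part `directionMass` of the mass in this direction
is thus about `min 1 (K ^ (-α))` (`directionMass_le`, `le_directionMass`). The mean over `ψ`
behaves as follows.
* If `r` tends to `0`, one has `log K ≈ -r * cos ψ`, and `1 - ballMass` is equivalent to `α * r / π`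
  (`tendsto_one_sub_ballMass_div`).
* If `r` is fixed and `α = 1 / 2`, the limit is the mean of `min 1 (K ^ (-1 / 2))`, which is `V r`
  by Tonelli's theorem (`V_eq_integral`, `tendsto_ballMass_of_eq_half`). The integral formula also
  shows that `V` is a decreasing bijection with negative derivative (`exists_hasDerivAt_V`,
  `bijOn_V`).
* If `r` tends to infinity and `α > 1 / 2`, only the angles of order `exp (-r / 2)` count, and
  `ballMass` is equivalent to `C α * exp (-r / 2)` (`tendsto_exp_mul_ballMass`).

The distance of a node to the origin is at most `ρ` with probability
`(cosh (α * ρ) - 1) / (cosh (α * R_n) - 1)`, where the denominator is equivalent to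
`n ^ (2 * α) / (2 * ν ^ (2 * α))`. Solving the asymptotic equation for the mean degree in `ρ` yields
the mean number of nodes whose score exceeds `t` (`tendsto_tail_of_lt_half`,
`tendsto_tail_of_eq_half`, `tendsto_tail_of_half_lt`). These limits are the tails of the three
intensity measures (`intensity_tail_of_lt_half`, `intensity_tail_of_half_lt`, and, by the change of
variables `y = V r`, `intensity_tail_of_eq_half`).
-/

noncomputable section

namespace RHG

/-! ### Weak convergence from the probabilities of countably many cells -/

/-- Fatou's lemma over the cells of a countable partition, applied to those contained in `G`. -/
theorem measure_le_liminf_of_cells {S : Type*} {Ω : ℕ → Type*} [∀ n, MeasurableSpace (Ω n)]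
    {P : ∀ n, Measure (Ω n)} {Ω' : Type*} [MeasurableSpace Ω'] {P' : Measure Ω'}
    {Y : ∀ n, Ω n → S} {Z : Ω' → S} {T : Type*} {lab : S → T} {Q : Set T} (hQ : Q.Countable)
    (hmeas : ∀ n c, MeasurableSet {ω | lab (Y n ω) = c})
    (hlim : ∀ c ∈ Q, P' {ω | lab (Z ω) = c} ≤ liminf (fun n => P n {ω | lab (Y n ω) = c}) atTop)
    (G : Set S) :
    P' {ω | lab (Z ω) ∈ Q ∧ ∀ y, lab y = lab (Z ω) → y ∈ G} ≤
      liminf (fun n => P n {ω | Y n ω ∈ G}) atTop := by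
  set D : Set T := {c | c ∈ Q ∧ ∀ y, lab y = c → y ∈ G}
  have hD : D.Countable := hQ.mono fun c hc => hc.1
  have : Countable D := hD.to_subtype
  let : MeasurableSpace D := ⊤
  have h1 : P' {ω | lab (Z ω) ∈ Q ∧ ∀ y, lab y = lab (Z ω) → y ∈ G} ≤
      ∑' c : D, P' {ω | lab (Z ω) = c} := by
    refine (measure_mono ?_).trans (measure_iUnion_le (fun c : D => {ω | lab (Z ω) = c}))
    intro ω hω
    exact Set.mem_iUnion.2 ⟨⟨lab (Z ω), hω⟩, rfl⟩
  have h2 : ∑' c : D, P' {ω | lab (Z ω) = c} ≤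
      liminf (fun n => ∑' c : D, P n {ω | lab (Y n ω) = c}) atTop := by
    have := lintegral_liminf_le (μ := Measure.count) (u := (atTop : Filter ℕ))
      (f := fun n (c : D) => P n {ω | lab (Y n ω) = c}) (fun n => measurable_from_top)
    simp only [lintegral_count] at this
    exact (ENNReal.tsum_le_tsum fun c : D => hlim c c.2.1).trans this
  refine h1.trans (h2.trans (liminf_le_liminf (Eventually.of_forall fun n => ?_)))
  rw [← measure_iUnion]
  · refine measure_mono ?_
    intro ω hω
    obtain ⟨c, hc⟩ := Set.mem_iUnion.1 hω
    exact c.2.2 _ hc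
  · intro c d hcd
    refine Set.disjoint_left.2 fun ω h h' => hcd (Subtype.ext ?_)
    exact h.symm.trans h'
  · exact fun c => hmeas n c

/-- A criterion for convergence in distribution that needs no tightness and no metrizability.
A sequence of labellings cuts the space into cells; a point of an open set, if it lies in the set
`U` that carries the limit, has all but finitely many of its cells inside the open set. Then it is
enough to control the probability of each of countably many cells. -/
theorem tendstoInDistribution_of_cells {S : Type*} [TopologicalSpace S] [MeasurableSpace S]
    [OpensMeasurableSpace S] {Ω : ℕ → Type*} [∀ n, MeasurableSpace (Ω n)]
    {P : ∀ n, Measure (Ω n)} [∀ n, IsProbabilityMeasure (P n)]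
    {Ω' : Type*} [MeasurableSpace Ω'] {P' : Measure Ω'} [IsProbabilityMeasure P']
    {Y : ∀ n, Ω n → S} {Z : Ω' → S} (hY : ∀ n, AEMeasurable (Y n) (P n)) (hZ : AEMeasurable Z P')
    {T : ℕ → Type*} (lab : ∀ k, S → T k) (Q : ∀ k, Set (T k)) (hQ : ∀ k, (Q k).Countable)
    (U : Set S) (hU : ∀ᵐ ω ∂P', Z ω ∈ U)
    (hopen : ∀ G, IsOpen G → ∀ x ∈ G, x ∈ U →
      ∀ᶠ k in atTop, lab k x ∈ Q k ∧ ∀ y, lab k y = lab k x → y ∈ G)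
    (hmeas : ∀ k n c, MeasurableSet {ω | lab k (Y n ω) = c})
    (hlim : ∀ k, ∀ c ∈ Q k,
      P' {ω | lab k (Z ω) = c} ≤ liminf (fun n => P n {ω | lab k (Y n ω) = c}) atTop) :
    TendstoInDistribution Y atTop Z P P' := by
  refine ⟨hY, hZ, tendsto_of_forall_isOpen_le_liminf' fun G hG => ?_⟩
  simp only [ProbabilityMeasure.coe_mk]
  rw [Measure.map_apply_of_aemeasurable hZ hG.measurableSet]
  simp_rw [fun n => Measure.map_apply_of_aemeasurable (hY n) hG.measurableSet]
  set H : ℕ → Set Ω' := fun K =>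
    {ω | ∀ k ≥ K, lab k (Z ω) ∈ Q k ∧ ∀ y, lab k y = lab k (Z ω) → y ∈ G}
  have hH : Monotone H := fun K L hKL ω hω k hk => hω k (hKL.trans hk)
  have h1 : P' (Z ⁻¹' G) ≤ P' (⋃ K, H K) := by
    refine measure_mono_ae ?_
    filter_upwards [hU] with ω hω hG'
    obtain ⟨K, hK⟩ := eventually_atTop.1 (hopen G hG (Z ω) hG' hω)
    exact Set.mem_iUnion.2 ⟨K, hK⟩
  refine h1.trans ?_
  rw [hH.measure_iUnion]
  refine iSup_le fun K => ?_
  refine (measure_mono (show H K ⊆ _ from fun ω hω => hω K le_rfl)).trans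
    (measure_le_liminf_of_cells (hQ K) (hmeas K) (hlim K) G)

/-! ### Poisson limit of the counts of independent points in disjoint small sets -/

open Complex in
/-- The disjointness of the sets makes the characteristic function of the vector of their indicators
affine in the masses. -/
theorem charFun_map_indicators {Γ D : Type*} [Fintype Γ] [MeasurableSpace D] (μ : Measure D)
    [IsProbabilityMeasure μ] (A : Γ → Set D) (hA : ∀ γ, MeasurableSet (A γ))
    (hdisj : Pairwise (fun γ δ => Disjoint (A γ) (A δ))) (t : EuclideanSpace ℝ Γ) :
    charFun (μ.map fun z => (WithLp.toLp 2 fun γ => (A γ).indicator (fun _ => (1 : ℝ)) z :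
      EuclideanSpace ℝ Γ)) t = 1 + ∑ γ, (μ.real (A γ) : ℂ) * (cexp (t γ * I) - 1) := by
  classical
  have hm : Measurable fun z => (WithLp.toLp 2 fun γ => (A γ).indicator (fun _ => (1 : ℝ)) z :
      EuclideanSpace ℝ Γ) := by
    refine (WithLp.measurable_toLp 2 _).comp (measurable_pi_lambda _ fun γ => ?_)
    exact measurable_const.indicator (hA γ)
  rw [charFun_apply, integral_map hm.aemeasurable (by fun_prop)]
  have key : ∀ z : D, cexp (inner ℝ (WithLp.toLp 2 fun γ => (A γ).indicator (fun _ => (1 : ℝ)) z :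
      EuclideanSpace ℝ Γ) t * I) =
      1 + ∑ γ, (A γ).indicator (fun _ => cexp (t γ * I) - 1) z := by
    intro z
    simp only [PiLp.inner_apply]
    by_cases h : ∃ γ, z ∈ A γ
    · obtain ⟨γ, hγ⟩ := h
      have h0 : ∀ δ, δ ≠ γ → z ∉ A δ := fun δ hδ hz => Set.disjoint_left.1 (hdisj hδ) hz hγ
      rw [Finset.sum_eq_single γ, Finset.sum_eq_single γ]
      · simp [hγ]
      · intro δ _ hδ
        simp [h0 δ hδ]
      · simp
      · intro δ _ hδ
        simp [h0 δ hδ]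
      · simp
    · push Not at h
      simp [h]
  simp_rw [key]
  rw [integral_add (integrable_const _)
    (integrable_finsetSum _ fun γ _ => (integrable_const _).indicator (hA γ)),
    integral_finsetSum _ fun γ _ => (integrable_const _).indicator (hA γ)]
  simp [integral_indicator (hA _)]

/-- If the mass of each of finitely many disjoint sets is asymptotic to `lam γ / n`, then the
numbers of points of an `n`-sample in these sets are asymptotically independent Poisson
variables. -/
theorem poisson_le_liminf_counts {Γ D : Type*} [Fintype Γ] [MeasurableSpace D]
    {Ω : ℕ → Type*} [∀ n, MeasurableSpace (Ω n)]
    {P : ∀ n, Measure (Ω n)} [∀ n, IsProbabilityMeasure (P n)] (X : ∀ n, Fin n → Ω n → D)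
    (hX : ∀ n i, Measurable (X n i)) (μ : ℕ → Measure D)
    (hlaw : ∀ᶠ n in atTop, ∀ i, HasLaw (X n i) (μ n) (P n))
    (hindep : ∀ᶠ n in atTop, iIndepFun (X n) (P n))
    (A : ℕ → Γ → Set D) (hA : ∀ n γ, MeasurableSet (A n γ))
    (hdisj : ∀ n, Pairwise (fun γ δ => Disjoint (A n γ) (A n δ)))
    (lam : Γ → ℝ≥0) (hlam : ∀ γ, Tendsto (fun n : ℕ => n * (μ n).real (A n γ)) atTop (𝓝 (lam γ)))
    (c : Γ → ℕ) :
    ∏ γ, poissonMeasure (lam γ) {c γ} ≤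
      liminf (fun n => P n {ω | ∀ γ, ∑ i, (A n γ).indicator (fun _ => (1 : ℝ)) (X n i ω) = c γ})
        atTop := by
  classical
  let v : ∀ n, D → EuclideanSpace ℝ Γ := fun n z =>
    WithLp.toLp 2 fun γ => (A n γ).indicator (fun _ => (1 : ℝ)) z
  have hv : ∀ n, Measurable (v n) := fun n =>
    (WithLp.measurable_toLp 2 _).comp (measurable_pi_lambda _ fun γ =>
      measurable_const.indicator (hA n γ))
  let W : ∀ n, Ω n → EuclideanSpace ℝ Γ := fun n ω => ∑ i, v n (X n i ω)
  have hW : ∀ n, Measurable (W n) := fun n =>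
    Finset.measurable_fun_sum _ fun i _ => (hv n).comp (hX n i)
  let κ : Measure (Γ → ℝ) := Measure.pi fun γ => (poissonMeasure (lam γ)).map ((↑) : ℕ → ℝ)
  have : ∀ γ, IsProbabilityMeasure ((poissonMeasure (lam γ)).map ((↑) : ℕ → ℝ)) := fun γ =>
    Measure.isProbabilityMeasure_map (by fun_prop)
  have hto : Measurable (WithLp.toLp 2 : (Γ → ℝ) → EuclideanSpace ℝ Γ) :=
    WithLp.measurable_toLp 2 _
  have : IsProbabilityMeasure (κ.map (WithLp.toLp 2 : (Γ → ℝ) → EuclideanSpace ℝ Γ)) :=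
    Measure.isProbabilityMeasure_map hto.aemeasurable
  have hPW : ∀ n, IsProbabilityMeasure ((P n).map (W n)) := fun n =>
    Measure.isProbabilityMeasure_map (hW n).aemeasurable
  have hconv : Tendsto (β := ProbabilityMeasure (EuclideanSpace ℝ Γ))
      (fun n => ⟨(P n).map (W n), hPW n⟩) atTop (𝓝 ⟨κ.map (WithLp.toLp 2), inferInstance⟩) := by
    refine ProbabilityMeasure.tendsto_iff_tendsto_charFun.2 fun t => ?_
    simp only [ProbabilityMeasure.coe_mk]
    have hκ : charFun (κ.map (WithLp.toLp 2 : (Γ → ℝ) → EuclideanSpace ℝ Γ)) t =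
        Complex.exp (∑ γ, (lam γ : ℂ) * (Complex.exp (t γ * Complex.I) - 1)) := by
      rw [charFun_pi, Complex.exp_sum]
      refine Finset.prod_congr rfl fun γ _ => ?_
      rw [charFun_map_cast_poissonMeasure]
    rw [hκ]
    have hlim : Tendsto (fun n : ℕ => (1 + ∑ γ, ((μ n).real (A n γ) : ℂ) *
        (Complex.exp (t γ * Complex.I) - 1)) ^ n) atTop
        (𝓝 (Complex.exp (∑ γ, (lam γ : ℂ) * (Complex.exp (t γ * Complex.I) - 1)))) := by
      refine Complex.tendsto_one_add_pow_exp_of_tendsto ?_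
      simp_rw [Finset.mul_sum, ← mul_assoc]
      refine tendsto_finsetSum _ fun γ _ => ?_
      refine Tendsto.mul_const _ ?_
      have := (Complex.continuous_ofReal.tendsto _).comp (hlam γ)
      simpa [Function.comp_def] using this
    refine hlim.congr' ?_
    filter_upwards [hlaw, hindep] with n hl hi
    rcases Nat.eq_zero_or_pos n with rfl | hn
    · have : W 0 = fun _ => 0 := by
        funext ω
        simp [W]
      rw [this]
      simp [charFun_apply]
    have hprob : IsProbabilityMeasure (μ n) := by
      rw [← (hl ⟨0, hn⟩).map_eq]
      exact Measure.isProbabilityMeasure_map (hX n _).aemeasurable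
    have hsum := (hi.comp (fun _ => v n) (fun _ => hv n)).charFun_map_fun_sum_eq_prod
      (fun i => ((hv n).comp (hX n i)).aemeasurable)
    have hone : ∀ i, charFun ((P n).map (v n ∘ X n i)) t =
        1 + ∑ γ, ((μ n).real (A n γ) : ℂ) * (Complex.exp (t γ * Complex.I) - 1) := by
      intro i
      rw [← Measure.map_map (hv n) (hX n i), (hl i).map_eq]
      exact charFun_map_indicators (μ n) (A n) (hA n) (hdisj n) t
    have : (fun ω => ∑ i, (v n ∘ X n i) ω) = W n := rfl
    rw [this] at hsum
    rw [hsum, Finset.prod_apply]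
    simp [hone]
  -- a box around the integer vector `c` contains no other integer vector
  let G : Set (EuclideanSpace ℝ Γ) := {x | ∀ γ, |x γ - c γ| < 1 / 2}
  have hG : IsOpen G := by
    simp only [G, Set.ofPred_forall]
    exact isOpen_iInter_of_finite fun γ => isOpen_lt (by fun_prop) continuous_const
  have hport := ProbabilityMeasure.le_liminf_measure_open_of_tendsto hconv hG
  simp only [ProbabilityMeasure.coe_mk] at hport
  have hleft : ∏ γ, poissonMeasure (lam γ) {c γ} ≤
      κ.map (WithLp.toLp 2 : (Γ → ℝ) → EuclideanSpace ℝ Γ) G := by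
    rw [Measure.map_apply hto hG.measurableSet]
    calc ∏ γ, poissonMeasure (lam γ) {c γ}
        ≤ ∏ γ, ((poissonMeasure (lam γ)).map ((↑) : ℕ → ℝ)) {(c γ : ℝ)} := by
          refine Finset.prod_le_prod' fun γ _ => ?_
          rw [Measure.map_apply (by fun_prop) (measurableSet_singleton _)]
          exact measure_mono (by simp)
      _ = κ (Set.pi Set.univ fun γ => {(c γ : ℝ)}) := by rw [Measure.pi_pi]
      _ ≤ _ := by
          refine measure_mono fun x hx => ?_
          intro γ
          have : x γ = c γ := hx γ trivial
          simp [this]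
  refine hleft.trans (hport.trans (liminf_le_liminf (Eventually.of_forall fun n => ?_)))
  rw [Measure.map_apply (hW n) hG.measurableSet]
  refine measure_mono fun ω hω γ => ?_
  have hγ : |W n ω γ - c γ| < 1 / 2 := hω γ
  have hWγ : W n ω γ = ∑ i, (A n γ).indicator (fun _ => (1 : ℝ)) (X n i ω) := by
    simp [W, v]
  have hnat : W n ω γ = ((Finset.univ.filter fun i => X n i ω ∈ A n γ).card : ℝ) := by
    rw [hWγ]
    simp [Set.indicator_apply]
  rw [← hWγ, hnat]
  rw [hnat] at hγ
  have h1 := abs_lt.1 hγ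
  have h2 : ((Finset.univ.filter fun i => X n i ω ∈ A n γ).card : ℤ) = c γ := by
    have a1 : ((Finset.univ.filter fun i => X n i ω ∈ A n γ).card : ℝ) < (c γ : ℝ) + 1 := by
      linarith
    have a2 : (c γ : ℝ) < ((Finset.univ.filter fun i => X n i ω ∈ A n γ).card : ℝ) + 1 := by
      linarith
    have a1' : (Finset.univ.filter fun i => X n i ω ∈ A n γ).card < c γ + 1 := by exact_mod_cast a1
    have a2' : c γ < (Finset.univ.filter fun i => X n i ω ∈ A n γ).card + 1 := by exact_mod_cast a2
    omega
  exact_mod_cast h2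

/-! ### Convergence of point processes from counts in cells -/

/-- The cell of `E` of the points that lie to the right of exactly those thresholds among
`d 0, …, d (k - 1)` that are marked in `γ`. -/
def cell (E : Set EReal) (d : ℕ → ℝ) (k : ℕ) (γ : Fin k → Bool) : Set E :=
  {y | ∀ j : Fin k, ((d j : ℝ) : EReal) < y ↔ γ j = true}

/-- The patterns of the cells that lie to the right of at least one threshold. -/
abbrev Pattern (k : ℕ) : Type := {γ : Fin k → Bool // ∃ j, γ j = true}

/-- The thresholds `d` are dense in the order sense between `a` and `b`. -/
def DenseThresholds (a b : EReal) (d : ℕ → ℝ) : Prop :=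
  (∀ j, a < (d j : EReal) ∧ (d j : EReal) < b) ∧
    ∀ x y : EReal, a ≤ x → x < y → y ≤ b → ∃ j, x < (d j : EReal) ∧ (d j : EReal) < y

theorem exists_denseThresholds {a b : EReal} (hab : a < b) : ∃ d, DenseThresholds a b d := by
  let S : Set ℚ := {q | a < ((q : ℝ) : EReal) ∧ ((q : ℝ) : EReal) < b}
  obtain ⟨q, hq⟩ := EReal.lt_iff_exists_rat_btwn.1 hab
  have hS : S.Nonempty := ⟨q, hq⟩
  obtain ⟨e, he⟩ := (Set.to_countable S).exists_eq_range hS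
  refine ⟨fun j => (e j : ℝ), fun j => ?_, fun x y hx hxy hy => ?_⟩
  · have : e j ∈ S := he ▸ Set.mem_range_self j
    exact this
  · obtain ⟨q, hq⟩ := EReal.lt_iff_exists_rat_btwn.1 hxy
    have : q ∈ S := ⟨hx.trans_lt hq.1, hq.2.trans_le hy⟩
    rw [he] at this
    obtain ⟨j, rfl⟩ := this
    exact ⟨j, hq⟩

theorem measurableSet_cell (E : Set EReal) (d : ℕ → ℝ) (k : ℕ) (γ : Fin k → Bool) :
    MeasurableSet (cell E d k γ) := by
  simp only [cell, Set.ofPred_forall]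
  refine MeasurableSet.iInter fun j => ?_
  have h : MeasurableSet {y : E | ((d j : ℝ) : EReal) < y} :=
    measurableSet_lt measurable_const measurable_subtype_coe
  by_cases hj : γ j = true
  · simpa [hj] using h
  · have : {y : E | ((d j : ℝ) : EReal) < y ↔ γ j = true} = {y : E | ((d j : ℝ) : EReal) < y}ᶜ := by
      ext y
      simp [hj]
    rw [this]
    exact h.compl

theorem disjoint_cell (E : Set EReal) (d : ℕ → ℝ) (k : ℕ) {γ δ : Fin k → Bool} (h : γ ≠ δ) :
    Disjoint (cell E d k γ) (cell E d k δ) := by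
  refine Set.disjoint_left.2 fun y hy hy' => h (funext fun j => ?_)
  have := (hy j).symm.trans (hy' j)
  exact Bool.eq_iff_iff.2 this

theorem setOf_lt_eq_iUnion_cell (E : Set EReal) (d : ℕ → ℝ) {k : ℕ} (j : Fin k) :
    {y : E | ((d j : ℝ) : EReal) < y} =
      ⋃ γ ∈ (Finset.univ.filter fun γ : Fin k → Bool => γ j = true), cell E d k γ := by
  classical
  ext y
  simp only [Set.mem_ofPred_eq, Set.mem_iUnion, Finset.mem_filter, Finset.mem_univ, true_and]
  constructor
  · intro h
    refine ⟨fun i => decide (((d i : ℝ) : EReal) < y), by simpa using h, fun i => by simp⟩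
  · rintro ⟨γ, hγ, hy⟩
    exact (hy j).2 hγ

/-- Sufficiently many thresholds make the oscillation of a continuous function small on every cell,
uniformly: an application of compactness of `[a, b]`. -/
theorem eventually_osc_lt_of_continuousOn {a b : EReal} {d : ℕ → ℝ} (hd : DenseThresholds a b d)
    {f : EReal → ℝ} (hf : ContinuousOn f (Set.Icc a b)) {ε : ℝ} (hε : 0 < ε) :
    ∃ k, ∀ y ∈ Set.Icc a b, ∀ y' ∈ Set.Icc a b,
      (∀ j < k, ((d j : ℝ) : EReal) < y ↔ ((d j : ℝ) : EReal) < y') → |f y - f y'| < ε := by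
  suffices h : ∃ k, ∀ y ∈ Set.Icc a b ∩ Set.Icc a b, ∀ y' ∈ Set.Icc a b,
      (∀ j < k, ((d j : ℝ) : EReal) < y ↔ ((d j : ℝ) : EReal) < y') → |f y - f y'| < ε by
    obtain ⟨k, hk⟩ := h
    exact ⟨k, fun y hy => hk y ⟨hy, hy⟩⟩
  refine (isCompact_Icc (a := a) (b := b)).induction_on
    (p := fun S => ∃ k, ∀ y ∈ S ∩ Set.Icc a b, ∀ y' ∈ Set.Icc a b,
      (∀ j < k, ((d j : ℝ) : EReal) < y ↔ ((d j : ℝ) : EReal) < y') → |f y - f y'| < ε)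
    ⟨0, by simp⟩ ?_ ?_ ?_
  · rintro S T hST ⟨k, hk⟩
    exact ⟨k, fun y hy => hk y ⟨hST hy.1, hy.2⟩⟩
  · rintro S T ⟨k, hk⟩ ⟨l, hl⟩
    refine ⟨max k l, ?_⟩
    rintro y ⟨hy | hy, hy2⟩ y' hy' h
    · exact hk y ⟨hy, hy2⟩ y' hy' fun j hj => h j (lt_of_lt_of_le hj (le_max_left _ _))
    · exact hl y ⟨hy, hy2⟩ y' hy' fun j hj => h j (lt_of_lt_of_le hj (le_max_right _ _))
  · intro x hx
    have hc := hf x hx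
    have hfx : {y | |f y - f x| < ε / 2} ∈ 𝓝[Set.Icc a b] x := by
      have := hc (Metric.ball_mem_nhds (f x) (half_pos hε))
      simpa [Set.preimage, Metric.ball, Real.dist_eq] using this
    obtain ⟨W, hW, hWf⟩ := mem_nhdsWithin_iff_exists_mem_nhds_inter.1 hfx
    have hleft : ∃ V ∈ 𝓝 x, ∃ k, ∀ y ∈ V, ∀ y' ∈ Set.Icc a b,
        (∀ j < k, ((d j : ℝ) : EReal) < y ↔ ((d j : ℝ) : EReal) < y') → y' ≤ x → y' ∈ W := by
      rcases hx.1.eq_or_lt with rfl | hax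
      · refine ⟨Set.univ, univ_mem, 0, fun y _ y' hy' _ h => ?_⟩
        rw [le_antisymm h hy'.1]
        exact mem_of_mem_nhds hW
      · obtain ⟨l, hl, hlW⟩ := exists_Ioc_subset_of_mem_nhds hW ⟨a, hax⟩
        obtain ⟨p, hp, hpx⟩ := hd.2 (max l a) x (le_max_right _ _) (max_lt hl hax) hx.2
        refine ⟨Set.Ioi (d p : EReal), Ioi_mem_nhds hpx, p + 1, fun y hy y' _ h hy'x => ?_⟩
        exact hlW ⟨(le_max_left l a).trans_lt (hp.trans ((h p (Nat.lt_succ_self p)).1 hy)), hy'x⟩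
    have hright : ∃ V ∈ 𝓝 x, ∃ k, ∀ y ∈ V, ∀ y' ∈ Set.Icc a b,
        (∀ j < k, ((d j : ℝ) : EReal) < y ↔ ((d j : ℝ) : EReal) < y') → x ≤ y' → y' ∈ W := by
      rcases hx.2.eq_or_lt with rfl | hxb
      · refine ⟨Set.univ, univ_mem, 0, fun y _ y' hy' _ h => ?_⟩
        rw [le_antisymm hy'.2 h]
        exact mem_of_mem_nhds hW
      · obtain ⟨u, hu, huW⟩ := exists_Ico_subset_of_mem_nhds hW ⟨b, hxb⟩
        obtain ⟨q, hxq, hq⟩ := hd.2 x (min u b) hx.1 (lt_min hu hxb) (min_le_right _ _)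
        refine ⟨Set.Iio (d q : EReal), Iio_mem_nhds hxq, q + 1, fun y hy y' _ h hy'x => ?_⟩
        refine huW ⟨hy'x, lt_of_le_of_lt (not_lt.1 fun hlt => ?_) (hq.trans_le (min_le_left u b))⟩
        exact lt_asymm ((h q (Nat.lt_succ_self q)).2 hlt) hy
    obtain ⟨V, hV, k, hk⟩ := hleft
    obtain ⟨V', hV', l, hl⟩ := hright
    refine ⟨V ∩ V' ∩ (W ∩ Set.Icc a b), ?_, max k l, ?_⟩
    · exact inter_mem (mem_nhdsWithin_of_mem_nhds (inter_mem hV hV'))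
        (inter_mem (mem_nhdsWithin_of_mem_nhds hW) self_mem_nhdsWithin)
    · rintro y ⟨⟨hy, hyW⟩, -⟩ y' hy' h
      have h1 : |f y - f x| < ε / 2 := hWf hyW
      have h2 : |f y' - f x| < ε / 2 := by
        refine hWf ⟨?_, hy'⟩
        rcases le_total y' x with hle | hle
        · exact hk y hy.1 y' hy' (fun j hj => h j (lt_of_lt_of_le hj (le_max_left _ _))) hle
        · exact hl y hy.2 y' hy' (fun j hj => h j (lt_of_lt_of_le hj (le_max_right _ _))) hle
      rw [abs_lt] at *
      constructor <;> linarith [h1.1, h1.2, h2.1, h2.2]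

/-- A test function on `(a, b]` vanishes to the left of some threshold, and its extension by `0` is
continuous on `[a, b]`. -/
theorem exists_osc_lt {a b : EReal} (hab : a < b) {d : ℕ → ℝ} (hd : DenseThresholds a b d)
    (f : C_c(Set.Ioc a b, ℝ)) :
    (∃ j, ∀ y : Set.Ioc a b, f y ≠ 0 → ((d j : ℝ) : EReal) < y) ∧
    ∀ ε > 0, ∃ k, ∀ y y' : Set.Ioc a b,
      (∀ j < k, ((d j : ℝ) : EReal) < y ↔ ((d j : ℝ) : EReal) < y') → |f y - f y'| < ε := by
  classical
  let K : Set EReal := Subtype.val '' tsupport f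
  have hK : IsCompact K := f.hasCompactSupport.isCompact.image continuous_subtype_val
  have hKE : K ⊆ Set.Ioc a b := by
    rintro _ ⟨y, -, rfl⟩
    exact y.2
  have haK : Kᶜ ∈ 𝓝 a := hK.isClosed.isOpen_compl.mem_nhds fun h => lt_irrefl a (hKE h).1
  have hf0 : ∀ y : Set.Ioc a b, (y : EReal) ∉ K → f y = 0 := fun y hy =>
    image_eq_zero_of_notMem_tsupport fun h => hy ⟨y, h, rfl⟩
  constructor
  · obtain ⟨u, hu, huK⟩ := exists_Ico_subset_of_mem_nhds haK ⟨b, hab⟩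
    obtain ⟨j, hj, hj'⟩ := hd.2 a (min u b) le_rfl (lt_min hu hab) (min_le_right _ _)
    refine ⟨j, fun y hy => not_le.1 fun hle => hy (hf0 y ?_)⟩
    exact huK ⟨y.2.1.le, hle.trans_lt (hj'.trans_le (min_le_left _ _))⟩
  · intro ε hε
    let g : EReal → ℝ := fun y => if h : y ∈ Set.Ioc a b then f ⟨y, h⟩ else 0
    have hgf : ∀ y : Set.Ioc a b, g y = f y := fun y => dif_pos y.2
    have hg : ContinuousOn g (Set.Icc a b) := by
      intro x hx
      by_cases hxK : x ∈ K
      · have hE : ContinuousOn g (Set.Ioc a b) := by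
          rw [continuousOn_iff_continuous_domRestrict]
          exact f.continuous.congr fun y => (hgf y).symm
        have hxE := hKE hxK
        refine (hE x hxE).mono_of_mem_nhdsWithin ?_
        filter_upwards [self_mem_nhdsWithin, mem_nhdsWithin_of_mem_nhds (Ioi_mem_nhds hxE.1)]
          with y hy hy'
        exact ⟨hy', hy.2⟩
      · have : g =ᶠ[𝓝 x] fun _ => 0 := by
          filter_upwards [hK.isClosed.isOpen_compl.mem_nhds hxK] with y hy
          by_cases h : y ∈ Set.Ioc a b
          · rw [← hf0 ⟨y, h⟩ hy, ← hgf]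
          · exact dif_neg h
        exact (continuousAt_const.congr this.symm).continuousWithinAt
    obtain ⟨k, hk⟩ := eventually_osc_lt_of_continuousOn hd hg hε
    refine ⟨k, fun y y' h => ?_⟩
    rw [← hgf, ← hgf]
    exact hk y (Set.Ioc_subset_Icc_self y.2) y' (Set.Ioc_subset_Icc_self y'.2) h

/-- Two measures with the same finite masses of the cells give close integrals to a function that
varies little on each cell and vanishes to the left of a threshold. -/
theorem abs_integral_sub_le {a b : EReal} {d : ℕ → ℝ} {k : ℕ} (j : Fin k)
    {f : Set.Ioc a b → ℝ} (hf : Continuous f) (hfj : ∀ y, f y ≠ 0 → ((d j : ℝ) : EReal) < y)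
    {ε : ℝ} (hosc : ∀ y y' : Set.Ioc a b,
      (∀ j < k, ((d j : ℝ) : EReal) < y ↔ ((d j : ℝ) : EReal) < y') → |f y - f y'| ≤ ε)
    {m m' : Measure (Set.Ioc a b)}
    (hm : ∀ γ : Pattern k, m (cell _ d k γ) ≠ ∞)
    (hmm : ∀ γ : Pattern k, m' (cell _ d k γ) = m (cell _ d k γ)) :
    |∫ y, f y ∂m' - ∫ y, f y ∂m| ≤ 2 * ε * m.real {y | ((d j : ℝ) : EReal) < y} := by
  classical
  set F := Finset.univ.filter fun γ : Fin k → Bool => γ j = true with hF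
  have hP : ∀ γ ∈ F, ∃ i, γ i = true := fun γ hγ => ⟨j, by simpa [hF] using hγ⟩
  have hcell : ∀ γ ∈ F, ∀ κ : Measure (Set.Ioc a b), κ (cell _ d k γ) ≠ ∞ →
      IntegrableOn f (cell _ d k γ) κ ∧
      ∀ x ∈ cell _ d k γ, |∫ y in cell _ d k γ, f y ∂κ - κ.real (cell _ d k γ) * f x| ≤
        ε * κ.real (cell _ d k γ) := by
    intro γ hγ κ hκ
    have hb : ∀ x ∈ cell (Set.Ioc a b) d k γ, ∀ y ∈ cell _ d k γ, |f y - f x| ≤ ε :=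
      fun x hx y hy => hosc y x fun i hi => (hy ⟨i, hi⟩).trans (hx ⟨i, hi⟩).symm
    have hfin : IsFiniteMeasure (κ.restrict (cell _ d k γ)) :=
      ⟨by simpa using hκ.lt_top⟩
    have hint : IntegrableOn f (cell _ d k γ) κ := by
      rcases (cell (Set.Ioc a b) d k γ).eq_empty_or_nonempty with h | ⟨x, hx⟩
      · simp [h]
      · refine Integrable.of_bound hf.aestronglyMeasurable (|f x| + ε) ?_
        refine (ae_restrict_iff' (measurableSet_cell _ _ _ _)).2 (Eventually.of_forall ?_)
        intro y hy
        have h1 := hb x hx y hy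
        have h2 := abs_sub_abs_le_abs_sub (f y) (f x)
        rw [Real.norm_eq_abs]
        linarith
    refine ⟨hint, fun x hx => ?_⟩
    have h1 : ∫ y in cell _ d k γ, f y ∂κ - κ.real (cell _ d k γ) * f x =
        ∫ y in cell _ d k γ, (f y - f x) ∂κ := by
      rw [integral_sub hint (integrable_const _)]
      simp
    rw [h1, ← Real.norm_eq_abs]
    exact norm_setIntegral_le_of_norm_le_const hκ.lt_top (fun y hy => hb x hx y hy)
  have hsum : ∀ κ : Measure (Set.Ioc a b), (∀ γ ∈ F, κ (cell _ d k γ) ≠ ∞) →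
      ∫ y, f y ∂κ = ∑ γ ∈ F, ∫ y in cell _ d k γ, f y ∂κ := by
    intro κ hκ
    rw [← setIntegral_eq_integral_of_forall_compl_eq_zero
      (s := {y : Set.Ioc a b | ((d j : ℝ) : EReal) < y})
      (fun y hy => by_contra fun h => hy (hfj y h)),
      setOf_lt_eq_iUnion_cell _ d j, integral_biUnion_finset]
    · exact fun γ _ => measurableSet_cell _ _ _ _
    · exact fun γ _ δ _ h => disjoint_cell _ _ _ h
    · exact fun γ hγ => (hcell γ hγ κ (hκ γ hγ)).1
  have hmF : ∀ γ ∈ F, m (cell _ d k γ) ≠ ∞ := fun γ hγ => hm ⟨γ, hP γ hγ⟩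
  have hmmF : ∀ γ ∈ F, m' (cell _ d k γ) = m (cell _ d k γ) := fun γ hγ => hmm ⟨γ, hP γ hγ⟩
  have hreal : m.real {y | ((d j : ℝ) : EReal) < y} = ∑ γ ∈ F, m.real (cell _ d k γ) := by
    rw [setOf_lt_eq_iUnion_cell _ d j]
    refine measureReal_biUnion_finset (fun γ _ δ _ h => disjoint_cell _ _ _ h)
      (fun γ _ => measurableSet_cell _ _ _ _) hmF
  rw [hsum m hmF, hsum m' fun γ hγ => by rw [hmmF γ hγ]; exact hmF γ hγ, ← Finset.sum_sub_distrib,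
    hreal, Finset.mul_sum]
  refine (Finset.abs_sum_le_sum_abs _ _).trans (Finset.sum_le_sum fun γ hγ => ?_)
  rcases (cell (Set.Ioc a b) d k γ).eq_empty_or_nonempty with h | ⟨x, hx⟩
  · simp [h]
  · have h1 := (hcell γ hγ m (hmF γ hγ)).2 x hx
    have h2 := (hcell γ hγ m' (by rw [hmmF γ hγ]; exact hmF γ hγ)).2 x hx
    have h3 : m'.real (cell _ d k γ) = m.real (cell _ d k γ) := by
      simp [measureReal_def, hmmF γ hγ]
    rw [h3] at h2
    rw [abs_le] at *
    constructor <;> linarith [h1.1, h1.2, h2.1, h2.2]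

/-- Vague neighbourhoods contain all point measures with the same counts in sufficiently fine
cells. -/
theorem eventually_mem_of_cell_counts_eq {a b : EReal} (hab : a < b) {d : ℕ → ℝ}
    (hd : DenseThresholds a b d) {m : PointMeasure (Set.Ioc a b)}
    (hm : ∀ k, ∀ γ : Pattern k, m.1 (cell _ d k γ) ≠ ∞) {G : Set (PointMeasure (Set.Ioc a b))}
    (hG : G ∈ 𝓝 m) :
    ∀ᶠ k in atTop, ∀ m' : PointMeasure (Set.Ioc a b),
      (fun γ : Pattern k => m'.1 (cell _ d k γ)) = (fun γ : Pattern k => m.1 (cell _ d k γ)) →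
        m' ∈ G := by
  let S : Set (ℕ × PointMeasure (Set.Ioc a b)) := {p | (fun γ : Pattern p.1 =>
    p.2.1 (cell _ d p.1 γ)) = (fun γ : Pattern p.1 => m.1 (cell _ d p.1 γ))}
  suffices h : Tendsto Prod.snd (comap Prod.fst (atTop : Filter ℕ) ⊓ 𝓟 S) (𝓝 m) by
    have h2 := h hG
    rw [mem_map, mem_inf_principal, mem_comap] at h2
    obtain ⟨t, ht, hts⟩ := h2
    filter_upwards [ht] with k hk m' hm'
    have h3 : ((k, m') : ℕ × _) ∈ Prod.fst ⁻¹' t := hk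
    exact hts h3 hm'
  rw [nhds_iInf, tendsto_iInf]
  intro f
  rw [nhds_induced, tendsto_comap_iff, Metric.tendsto_nhds]
  intro ε hε
  obtain ⟨⟨j, hj⟩, hosc⟩ := exists_osc_lt hab hd f
  set M := m.1.real {y | ((d j : ℝ) : EReal) < y} with hM
  have hM0 : 0 ≤ M := measureReal_nonneg
  obtain ⟨k₀, hk₀⟩ := hosc (ε / (2 * (M + 1))) (by positivity)
  rw [eventually_inf_principal, eventually_comap]
  filter_upwards [eventually_ge_atTop (max k₀ (j + 1))] with k hk p hp hpS
  subst hp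
  rw [Real.dist_eq]
  have hjk : j < p.1 := lt_of_lt_of_le (Nat.lt_succ_self j) ((le_max_right _ _).trans hk)
  have := abs_integral_sub_le (m := m.1) (m' := p.2.1) ⟨j, hjk⟩ f.continuous hj
    (ε := ε / (2 * (M + 1)))
    (fun y y' h => (hk₀ y y' fun i hi => h i (hi.trans_le ((le_max_left _ _).trans hk))).le)
    (hm p.1) (fun γ => congrFun hpS γ)
  refine this.trans_lt ?_
  change 2 * (ε / (2 * (M + 1))) * M < ε
  rw [show 2 * (ε / (2 * (M + 1))) * M = ε * (M / (M + 1)) by field_simp]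
  have : M / (M + 1) < 1 := by
    rw [div_lt_one (by linarith)]
    linarith
  nlinarith

theorem IsPoissonProcess.ae_counts_nat {Ω : Type*} [MeasurableSpace Ω] {E : Set EReal}
    {η : Ω → PointMeasure E} {m : Measure E} {P : Measure Ω} (hη : IsPoissonProcess η m P)
    {B : Set E} (hB : MeasurableSet B) (hm : m B ≠ ∞) :
    ∀ᵐ ω ∂P, ∃ c : ℕ, (η ω).1 B = c := by
  have h := hη.law B hB hm
  have : ∀ᵐ x ∂(Measure.map (fun k : ℕ => (k : ℝ≥0∞)) (poissonMeasure (m B).toNNReal)),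
      ∃ c : ℕ, x = (c : ℝ≥0∞) := by
    refine (ae_map_iff Measurable.of_discrete.aemeasurable ?_).2
      (Eventually.of_forall fun k => ⟨k, rfl⟩)
    have : {x : ℝ≥0∞ | ∃ c : ℕ, x = c} = Set.range fun c : ℕ => (c : ℝ≥0∞) := by
      ext x
      simp [eq_comm]
    rw [this]
    exact (Set.countable_range _).measurableSet
  rw [← h.map_eq] at this
  exact ae_of_ae_map h.aemeasurable this

/-- The independence of the counts, which is indexed by `Fin m` in the definition, over an arbitrary
finite index type. -/
theorem IsPoissonProcess.measure_counts {Ω : Type*} [MeasurableSpace Ω] {E : Set EReal}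
    {η : Ω → PointMeasure E} {m : Measure E} {P : Measure Ω} (hη : IsPoissonProcess η m P)
    {Γ : Type*} [Fintype Γ] {B : Γ → Set E} (hB : ∀ γ, MeasurableSet (B γ))
    (hm : ∀ γ, m (B γ) ≠ ∞) (hdisj : Pairwise fun γ δ => Disjoint (B γ) (B δ)) (c : Γ → ℕ) :
    P {ω | ∀ γ, (η ω).1 (B γ) = c γ} = ∏ γ, poissonMeasure (m (B γ)).toNNReal {c γ} := by
  classical
  let e := Fintype.equivFin Γ
  have hind := hη.indep _ (B ∘ e.symm) (fun i => hB _) fun i j hij =>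
    hdisj fun h => hij (e.symm.injective h)
  have h1 := hind.measure_inter_preimage_eq_mul Finset.univ
    (sets := fun i => {(c (e.symm i) : ℝ≥0∞)}) (fun i _ => measurableSet_singleton _)
  have h2 : {ω | ∀ γ, (η ω).1 (B γ) = c γ} = ⋂ i ∈ (Finset.univ : Finset (Fin (Fintype.card Γ))),
      (fun ω => (η ω).1 ((B ∘ e.symm) i)) ⁻¹' {(c (e.symm i) : ℝ≥0∞)} := by
    ext ω
    simp only [Set.mem_ofPred_eq, Finset.mem_univ, Set.iInter_true, Set.mem_iInter,
      Set.mem_preimage, Function.comp, Set.mem_singleton_iff]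
    exact ⟨fun h i => h _, fun h γ => by simpa using h (e γ)⟩
  rw [h2, h1, ← Equiv.prod_comp e.symm fun γ => poissonMeasure (m (B γ)).toNNReal {c γ}]
  refine Finset.prod_congr rfl fun i _ => ?_
  have h := hη.law (B (e.symm i)) (hB _) (hm _)
  have h3 : P ((fun ω => (η ω).1 ((B ∘ e.symm) i)) ⁻¹' {(c (e.symm i) : ℝ≥0∞)}) =
      P.map (fun ω => (η ω).1 (B (e.symm i))) {(c (e.symm i) : ℝ≥0∞)} :=
    (Measure.map_apply_of_aemeasurable h.aemeasurable (measurableSet_singleton _)).symm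
  rw [h3, h.map_eq, Measure.map_apply (by fun_prop) (measurableSet_singleton _)]
  congr 1
  ext k
  simp

/-- Convergence to a Poisson process follows from the convergence of the counts in the cells cut
out by finitely many thresholds. -/
theorem tendstoInDistribution_pointProcess {a b : EReal} (hab : a < b) {d : ℕ → ℝ}
    (hd : DenseThresholds a b d) {Ω : ℕ → Type*} [∀ n, MeasurableSpace (Ω n)]
    {P : ∀ n, Measure (Ω n)} [∀ n, IsProbabilityMeasure (P n)]
    {Ω' : Type*} [MeasurableSpace Ω'] {P' : Measure Ω'} [IsProbabilityMeasure P']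
    {ι : ℕ → Type*} [∀ n, MeasurableSpace (ι n)] [∀ n, DiscreteMeasurableSpace (ι n)]
    {N : ∀ n, ι n → PointMeasure (Set.Ioc a b)} {D : ∀ n, Ω n → ι n} (hD : ∀ n, Measurable (D n))
    {η : Ω' → PointMeasure (Set.Ioc a b)} {m : Measure (Set.Ioc a b)}
    (hη : IsPoissonProcess η m P') (hfin : ∀ j, m {y | ((d j : ℝ) : EReal) < y} ≠ ∞)
    (hlim : ∀ k, ∀ c : Pattern k → ℕ,
      ∏ γ : Pattern k, poissonMeasure (m (cell _ d k γ)).toNNReal {c γ} ≤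
        liminf (fun n => P n {ω | ∀ γ : Pattern k, (N n (D n ω)).1 (cell _ d k γ) = c γ}) atTop) :
    TendstoInDistribution (fun n ω => N n (D n ω)) atTop η P P' := by
  have hcellfin : ∀ k, ∀ γ : Pattern k, m (cell _ d k γ) ≠ ∞ := by
    rintro k ⟨γ, j, hj⟩
    exact measure_ne_top_of_subset (fun y hy => (hy j).2 hj) (hfin j)
  refine tendstoInDistribution_of_cells (T := fun k => Pattern k → ℝ≥0∞)
    (fun n => ((Measurable.of_discrete (f := N n)).comp (hD n)).aemeasurable)
    hη.measurable.aemeasurable (fun k m' γ => m'.1 (cell _ d k γ))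
    (fun k => Set.range fun c : Pattern k → ℕ => fun γ => (c γ : ℝ≥0∞))
    (fun k => Set.countable_range _)
    {m' | ∀ k, ∀ γ : Pattern k, ∃ c : ℕ, m'.1 (cell _ d k γ) = c} ?_ ?_ ?_ ?_
  · refine ae_all_iff.2 fun k => ae_all_iff.2 fun γ => ?_
    exact hη.ae_counts_nat (measurableSet_cell _ _ _ _) (hcellfin k γ)
  · intro G hG x hx hxU
    have h := eventually_mem_of_cell_counts_eq hab hd (m := x) (fun k γ => by
      obtain ⟨c, hc⟩ := hxU k γ
      rw [hc]
      exact ENNReal.natCast_ne_top c) (hG.mem_nhds hx)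
    filter_upwards [h] with k hk
    refine ⟨?_, hk⟩
    choose c hc using hxU k
    exact ⟨c, funext fun γ => (hc γ).symm⟩
  · intro k n c
    exact hD n (MeasurableSet.of_discrete
      (s := {i | (fun γ : Pattern k => (N n i).1 (cell _ d k γ)) = c}))
  · rintro k _ ⟨c, rfl⟩
    have h1 : {ω | (fun γ : Pattern k => (η ω).1 (cell _ d k γ)) = fun γ => (c γ : ℝ≥0∞)} =
        {ω | ∀ γ : Pattern k, (η ω).1 (cell _ d k γ) = c γ} := by
      ext ω
      exact funext_iff
    rw [h1, hη.measure_counts (fun γ => measurableSet_cell _ _ _ _) (hcellfin k)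
      (fun γ δ h => disjoint_cell _ _ _ fun h' => h (Subtype.ext h')) c]
    refine (hlim k c).trans (le_of_eq ?_)
    congr 1
    funext n
    congr 1
    ext ω
    exact funext_iff.symm

/-! ### Point processes that are close to a process of independent points -/

/-- A cell is cut out by at most two of its thresholds. -/
theorem pattern_iff (d : ℕ → ℝ) {k : ℕ} (γ : Pattern k) :
    (∃ p : Fin k, ∀ x : EReal, (∀ j : Fin k, ((d j : ℝ) : EReal) < x ↔ γ.1 j = true) ↔
      ((d p : ℝ) : EReal) < x) ∨
    ∃ p q : Fin k, ∀ x : EReal, (∀ j : Fin k, ((d j : ℝ) : EReal) < x ↔ γ.1 j = true) ↔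
      ((d p : ℝ) : EReal) < x ∧ ¬ ((d q : ℝ) : EReal) < x := by
  classical
  obtain ⟨γ, j₀, hj₀⟩ := γ
  obtain ⟨p, hp, hpm⟩ := Finset.exists_max_image (Finset.univ.filter fun j => γ j = true)
    (fun j => d j) ⟨j₀, by simpa using hj₀⟩
  simp only [Finset.mem_filter, Finset.mem_univ, true_and] at hp hpm
  have h1 : ∀ x : EReal, ((d p : ℝ) : EReal) < x → ∀ j, γ j = true → ((d j : ℝ) : EReal) < x :=
    fun x hx j hj => (EReal.coe_le_coe_iff.2 (hpm j hj)).trans_lt hx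
  by_cases hF : ∃ j, γ j = false
  · obtain ⟨q₀, hq₀⟩ := hF
    obtain ⟨q, hq, hqm⟩ := Finset.exists_min_image (Finset.univ.filter fun j => γ j = false)
      (fun j => d j) ⟨q₀, by simpa using hq₀⟩
    simp only [Finset.mem_filter, Finset.mem_univ, true_and] at hq hqm
    refine Or.inr ⟨p, q, fun x => ⟨fun h => ⟨(h p).2 hp, fun hlt => ?_⟩, ?_⟩⟩
    · have := (h q).1 hlt
      simp only at this
      rw [hq] at this
      exact Bool.noConfusion this
    · rintro ⟨hx, hx'⟩ j
      refine ⟨fun hj => ?_, h1 x hx j⟩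
      by_contra hne
      have hjf : γ j = false := by simpa using hne
      exact hx' ((EReal.coe_le_coe_iff.2 (hqm j hjf)).trans_lt hj)
  · push Not at hF
    refine Or.inl ⟨p, fun x => ⟨fun h => (h p).2 hp, fun hx j => ?_⟩⟩
    have : γ j = true := by simpa using hF j
    exact ⟨fun _ => this, fun hj => h1 x hx j hj⟩

open Classical in
/-- The points `y i ≤ a`, which `pointsIn` discards, lie to the right of no threshold, hence in no
cell of a `Pattern`. -/
theorem pointsIn_cell {a b : EReal} {d : ℕ → ℝ} (hd : ∀ j, a < (d j : EReal)) {k : ℕ}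
    (γ : Pattern k) {n : ℕ} (y : Fin n → EReal) (hy : ∀ i, y i ≤ b) :
    (pointsIn (Set.Ioc a b) y).1 (cell _ d k γ) =
      ((Finset.univ.filter fun i => ∀ j : Fin k, ((d j : ℝ) : EReal) < y i ↔ γ.1 j = true).card :
        ℝ≥0∞) := by
  change (Measure.sum fun i : {i : Fin n // y i ∈ Set.Ioc a b} =>
    Measure.dirac (⟨y i, i.2⟩ : Set.Ioc a b)) (cell _ d k γ) = _
  rw [Measure.sum_apply _ (measurableSet_cell _ _ _ _), tsum_fintype]
  have h1 : ∀ i : {i : Fin n // y i ∈ Set.Ioc a b},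
      Measure.dirac (⟨y i, i.2⟩ : Set.Ioc a b) (cell _ d k γ) =
        if ∀ j : Fin k, ((d j : ℝ) : EReal) < y i ↔ γ.1 j = true then 1 else 0 := by
    intro i
    rw [Measure.dirac_apply' _ (measurableSet_cell _ _ _ _), Set.indicator_apply]
    exact if_congr Iff.rfl rfl rfl
  simp_rw [h1]
  rw [← Finset.sum_subtype (Finset.univ.filter fun i => y i ∈ Set.Ioc a b) (by simp)
    (fun i => if ∀ j : Fin k, ((d j : ℝ) : EReal) < y i ↔ γ.1 j = true then (1 : ℝ≥0∞) else 0),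
    Finset.sum_filter_of_ne, Finset.sum_boole]
  intro i _ hi
  obtain ⟨j, hj⟩ := γ.2
  have := (ite_ne_right_iff.1 hi).1
  exact ⟨(hd j).trans ((this j).2 hj), hy i⟩

/-- A sequence of samples `X n i` of law `μ n` with scores `M n (X n i)`, and variables `Y n i`
that follow the scores: above every level `t ∈ (a, b)` there are on average asymptotically `Λ t`
of the scores, and for `s < t`, with probability tending to `1`, no `Y n i` is on the other side
of `[s, t]` than its score. -/
structure CloseToScores (a b : EReal) (Λ : ℝ → ℝ) {D : Type*} [MeasurableSpace D]
    {Ω : ℕ → Type*} [∀ n, MeasurableSpace (Ω n)] (P : ∀ n, Measure (Ω n))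
    (X : ∀ n, Fin n → Ω n → D) (μ : ℕ → Measure D) (M : ℕ → D → ℝ) (Y : ∀ n, Fin n → Ω n → ℝ) :
    Prop where
  measurable_X : ∀ n i, Measurable (X n i)
  law : ∀ᶠ n in atTop, ∀ i, HasLaw (X n i) (μ n) (P n)
  indep : ∀ᶠ n in atTop, iIndepFun (X n) (P n)
  measurable_M : ∀ n, Measurable (M n)
  tail : ∀ t : ℝ, a < t → (t : EReal) < b →
    Tendsto (fun n : ℕ => n * (μ n).real {z | t < M n z}) atTop (𝓝 (Λ t))
  continuousAt : ∀ t : ℝ, a < t → (t : EReal) < b → ContinuousAt Λ t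
  upper : ∀ s t : ℝ, a < s → s < t → (t : EReal) < b →
    Tendsto (fun n => (P n).real {ω | ∃ i, t < Y n i ω ∧ M n (X n i ω) ≤ s}) atTop (𝓝 0)
  lower : ∀ s t : ℝ, a < s → s < t → (t : EReal) < b →
    Tendsto (fun n => (P n).real {ω | ∃ i, Y n i ω ≤ s ∧ t < M n (X n i ω)}) atTop (𝓝 0)

variable {a b : EReal} {Λ : ℝ → ℝ} {D : Type*} [MeasurableSpace D]
  {Ω : ℕ → Type*} [∀ n, MeasurableSpace (Ω n)] {P : ∀ n, Measure (Ω n)}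
  [∀ n, IsProbabilityMeasure (P n)]
  {X : ∀ n, Fin n → Ω n → D} {μ : ℕ → Measure D} {M : ℕ → D → ℝ} {Y : ∀ n, Fin n → Ω n → ℝ}

/-- With high probability the variables and their scores are on the same side of any given level:
few scores lie close to the level, by the continuity of `Λ`, and the others stay on their side. -/
theorem CloseToScores.tendsto_exists_ne (h : CloseToScores a b Λ P X μ M Y) {t : ℝ} (hat : a < t)
    (htb : (t : EReal) < b) :
    Tendsto (fun n => (P n).real {ω | ∃ i, ¬ (t < Y n i ω ↔ t < M n (X n i ω))}) atTop (𝓝 0) := by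
  rw [Metric.tendsto_nhds]
  intro ε hε
  have hcont := h.continuousAt t hat htb
  rw [Metric.continuousAt_iff] at hcont
  obtain ⟨δ, hδ, hΛ⟩ := hcont (ε / 6) (by positivity)
  obtain ⟨s₀, hs₀, hs₀t⟩ := EReal.lt_iff_exists_real_btwn.1 hat
  obtain ⟨u₀, hu₀t, hu₀⟩ := EReal.lt_iff_exists_real_btwn.1 htb
  rw [EReal.coe_lt_coe_iff] at hs₀t hu₀t
  obtain ⟨s, hs1, hst⟩ := exists_between (max_lt hs₀t (by linarith : t - δ < t))
  obtain ⟨u, htu, hu1⟩ := exists_between (lt_min hu₀t (by linarith : t < t + δ))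
  have hs2 := max_lt_iff.1 hs1
  have hu2 := lt_min_iff.1 hu1
  have has : a < (s : EReal) := hs₀.trans (EReal.coe_lt_coe_iff.2 hs2.1)
  have hub : (u : EReal) < b := (EReal.coe_lt_coe_iff.2 hu2.1).trans hu₀
  have hsb : (s : EReal) < b := (EReal.coe_lt_coe_iff.2 hst).trans htb
  have hau : a < (u : EReal) := hat.trans (EReal.coe_lt_coe_iff.2 htu)
  have hΛs : |Λ s - Λ t| < ε / 6 := hΛ (by rw [Real.dist_eq, abs_lt]; constructor <;> linarith)
  have hΛu : |Λ u - Λ t| < ε / 6 := hΛ (by rw [Real.dist_eq, abs_lt]; constructor <;> linarith)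
  have htail := ((h.tail s has hsb).sub (h.tail u hau hub)).eventually_lt_const
    (u := ε / 2) (by
      have h1 := abs_lt.1 hΛs
      have h2 := abs_lt.1 hΛu
      linarith [h1.2, h2.1])
  filter_upwards [htail, (h.upper s t has hst htb).eventually_lt_const (u := ε / 4)
    (by positivity), (h.lower t u hat htu hub).eventually_lt_const (u := ε / 4)
    (by positivity), h.law] with n h1 h2 h3 hl
  rw [Real.dist_eq, sub_zero, abs_of_nonneg measureReal_nonneg]
  rcases Nat.eq_zero_or_pos n with rfl | hn
  · simpa using hε
  have hprob : IsProbabilityMeasure (μ n) := by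
    rw [← (hl ⟨0, hn⟩).map_eq]
    exact Measure.isProbabilityMeasure_map (h.measurable_X n _).aemeasurable
  have hsub : {ω | ∃ i, ¬ (t < Y n i ω ↔ t < M n (X n i ω))} ⊆
      ({ω | ∃ i, t < Y n i ω ∧ M n (X n i ω) ≤ s} ∪ {ω | ∃ i, Y n i ω ≤ t ∧ u < M n (X n i ω)}) ∪
        ⋃ i ∈ (Finset.univ : Finset (Fin n)),
          {ω | X n i ω ∈ {z | s < M n z} \ {z | u < M n z}} := by
    rintro ω ⟨i, hi⟩
    by_cases c1 : s < M n (X n i ω)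
    · by_cases c2 : u < M n (X n i ω)
      · have c3 : t < M n (X n i ω) := htu.trans c2
        refine Or.inl (Or.inr ⟨i, ?_, c2⟩)
        by_contra c4
        exact hi ⟨fun _ => c3, fun _ => not_le.1 c4⟩
      · refine Or.inr ?_
        simp only [Set.mem_iUnion]
        exact ⟨i, Finset.mem_univ i, c1, c2⟩
    · refine Or.inl (Or.inl ⟨i, ?_, not_lt.1 c1⟩)
      by_contra c4
      exact hi ⟨fun h' => absurd h' c4, fun h' => absurd (hst.trans h') c1⟩
  have hms : ∀ r : ℝ, MeasurableSet {z | r < M n z} := fun r =>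
    measurableSet_lt measurable_const (h.measurable_M n)
  have hi : ∀ i ∈ (Finset.univ : Finset (Fin n)),
      (P n).real {ω | X n i ω ∈ {z | s < M n z} \ {z | u < M n z}} =
      (μ n).real {z | s < M n z} - (μ n).real {z | u < M n z} := by
    intro i _
    rw [(hl i).measureReal_eq (p := fun z => z ∈ {z | s < M n z} \ {z | u < M n z})
      ((hms s).diff (hms u))]
    exact measureReal_sdiff (fun z (hz : u < M n z) => (hst.trans htu).trans hz) (hms u)
  calc (P n).real _ ≤ _ := measureReal_mono hsub
    _ ≤ _ := measureReal_union_le _ _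
    _ ≤ _ := add_le_add (measureReal_union_le _ _) (measureReal_biUnion_finset_le _ _)
    _ < ε := by
      rw [Finset.sum_congr rfl hi]
      simp only [Finset.sum_const, Finset.card_univ, Fintype.card_fin, nsmul_eq_mul]
      rw [mul_sub]
      linarith

theorem tendsto_measureReal_of_subset_union {A B C : ∀ n, Set (Ω n)}
    (hAB : ∀ n, A n ⊆ B n ∪ C n) (hBA : ∀ n, B n ⊆ A n ∪ C n)
    (hC : Tendsto (fun n => (P n).real (C n)) atTop (𝓝 0)) {l : ℝ}
    (hA : Tendsto (fun n => (P n).real (A n)) atTop (𝓝 l)) :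
    Tendsto (fun n => (P n).real (B n)) atTop (𝓝 l) := by
  refine tendsto_of_tendsto_of_tendsto_of_le_of_le (by simpa using hA.sub hC)
    (by simpa using hA.add hC) (fun n => ?_) fun n => ?_
  · have := (measureReal_mono (μ := P n) (hAB n)).trans (measureReal_union_le _ _)
    simp only
    linarith
  · exact (measureReal_mono (hBA n)).trans (measureReal_union_le _ _)

/-- The maximum of the variables has in the limit the law of the rightmost point of the Poisson
process, because no score exceeds `t` with probability `(1 - Λ t / n + o(1 / n)) ^ n`. -/
theorem CloseToScores.tendsto_forall_le (h : CloseToScores a b Λ P X μ M Y) {t : ℝ} (hat : a < t)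
    (htb : (t : EReal) < b) :
    Tendsto (fun n => (P n).real {ω | ∀ i, Y n i ω ≤ t}) atTop (𝓝 (Real.exp (-Λ t))) := by
  refine tendsto_measureReal_of_subset_union (A := fun n => {ω | ∀ i, M n (X n i ω) ≤ t})
    (C := fun n => {ω | ∃ i, ¬ (t < Y n i ω ↔ t < M n (X n i ω))}) (fun n ω hω => ?_)
    (fun n ω hω => ?_) (h.tendsto_exists_ne hat htb) ?_
  · by_cases hc : ∃ i, ¬ (t < Y n i ω ↔ t < M n (X n i ω))
    · exact Or.inr hc
    · push Not at hc
      exact Or.inl fun i => not_lt.1 fun hi => not_lt.2 (hω i) ((hc i).1 hi)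
  · by_cases hc : ∃ i, ¬ (t < Y n i ω ↔ t < M n (X n i ω))
    · exact Or.inr hc
    · push Not at hc
      exact Or.inl fun i => not_lt.1 fun hi => not_lt.2 (hω i) ((hc i).2 hi)
  have hlim : Tendsto (fun n : ℕ => (1 + -(μ n).real {z | t < M n z}) ^ n) atTop
      (𝓝 (Real.exp (-Λ t))) := by
    refine Real.tendsto_one_add_pow_exp_of_tendsto ?_
    simpa using (h.tail t hat htb).neg
  refine hlim.congr' ?_
  filter_upwards [h.law, h.indep] with n hl hi
  have hms : MeasurableSet {z | M n z ≤ t} := measurableSet_le (h.measurable_M n) measurable_const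
  have h1 := hi.measure_inter_preimage_eq_mul Finset.univ (sets := fun _ => {z | M n z ≤ t})
    (fun i _ => hms)
  have h2 : {ω | ∀ i, M n (X n i ω) ≤ t} =
      ⋂ i ∈ (Finset.univ : Finset (Fin n)), X n i ⁻¹' {z | M n z ≤ t} := by
    ext ω
    simp
  rw [h2, measureReal_def (P n), h1, ENNReal.toReal_prod]
  have h3 : ∀ i : Fin n, ((P n) (X n i ⁻¹' {z | M n z ≤ t})).toReal =
      1 + -(μ n).real {z | t < M n z} := by
    intro i
    have hprob : IsProbabilityMeasure (μ n) := by
      rw [← (hl i).map_eq]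
      exact Measure.isProbabilityMeasure_map (h.measurable_X n _).aemeasurable
    have := (hl i).measureReal_eq (p := fun z => M n z ≤ t) hms
    rw [← sub_eq_add_neg, ← probReal_compl_eq_one_sub
      (measurableSet_lt measurable_const (h.measurable_M n))]
    refine this.trans ?_
    congr 1
    ext z
    simp
  rw [Finset.prod_congr rfl fun i _ => h3 i]
  simp

/-- Half-lines are nested, so the mass of their difference is determined by their masses, whatever
the order of `p` and `q`. -/
theorem toReal_measure_sdiff_chain {T : Type*} [MeasurableSpace T] (κ : Measure T) {φ : T → EReal}
    (hφ : Measurable φ) {p q : ℝ} (hp : κ {x | (p : EReal) < φ x} ≠ ∞)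
    (hq : κ {x | (q : EReal) < φ x} ≠ ∞) :
    (κ {x | (p : EReal) < φ x ∧ ¬ (q : EReal) < φ x}).toReal =
      max 0 ((κ {x | (p : EReal) < φ x}).toReal - (κ {x | (q : EReal) < φ x}).toReal) := by
  have hset : {x | (p : EReal) < φ x ∧ ¬ (q : EReal) < φ x} =
    {x | (p : EReal) < φ x} \ {x | (q : EReal) < φ x} := rfl
  have hmq : MeasurableSet {x | (q : EReal) < φ x} := measurableSet_lt measurable_const hφ
  rcases le_total p q with hle | hle
  · have hsub : {x | (q : EReal) < φ x} ⊆ {x | (p : EReal) < φ x} :=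
      fun x hx => (EReal.coe_le_coe_iff.2 hle).trans_lt hx
    rw [hset, measure_sdiff hsub hmq.nullMeasurableSet hq,
      ENNReal.toReal_sub_of_le (measure_mono hsub) hp, max_eq_right]
    exact sub_nonneg.2 (ENNReal.toReal_mono hp (measure_mono hsub))
  · have hsub : {x | (p : EReal) < φ x} ⊆ {x | (q : EReal) < φ x} :=
      fun x hx => (EReal.coe_le_coe_iff.2 hle).trans_lt hx
    rw [hset, Set.sdiff_eq_empty.2 hsub, max_eq_left]
    · simp
    · exact sub_nonpos.2 (ENNReal.toReal_mono hq (measure_mono hsub))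

/-- The tails of the scores and of the intensity measure `m` determine the masses of the cells, each
of which is a half-line or a difference of two of them. -/
theorem tendsto_mul_measureReal_cell (h : CloseToScores a b Λ P X μ M Y) {d : ℕ → ℝ}
    (hd : DenseThresholds a b d) {m : Measure (Set.Ioc a b)}
    (hm : ∀ t : ℝ, a < t → (t : EReal) < b → m {y | (t : EReal) < y} = ENNReal.ofReal (Λ t))
    {k : ℕ} (γ : Pattern k) :
    Tendsto (fun n : ℕ => n * (μ n).real
        {z | ∀ j : Fin k, ((d j : ℝ) : EReal) < (M n z : EReal) ↔ γ.1 j = true})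
      atTop (𝓝 ((m (cell _ d k γ)).toNNReal : ℝ)) := by
  have hΛ0 : ∀ j, 0 ≤ Λ (d j) := fun j => ge_of_tendsto' (h.tail _ (hd.1 j).1 (hd.1 j).2)
    fun n => by positivity
  have hmj : ∀ j, m {y | ((d j : ℝ) : EReal) < y} = ENNReal.ofReal (Λ (d j)) :=
    fun j => hm _ (hd.1 j).1 (hd.1 j).2
  rcases pattern_iff d γ with ⟨p, hp⟩ | ⟨p, q, hpq⟩
  · have hc : cell (Set.Ioc a b) d k γ = {y : Set.Ioc a b | ((d p : ℝ) : EReal) < y} := by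
      ext y
      exact hp y
    rw [hc, hmj, ENNReal.coe_toNNReal_eq_toReal, ENNReal.toReal_ofReal (hΛ0 p)]
    simp_rw [hp, EReal.coe_lt_coe_iff]
    exact h.tail _ (hd.1 p).1 (hd.1 p).2
  · have hc : cell (Set.Ioc a b) d k γ =
        {y : Set.Ioc a b | ((d p : ℝ) : EReal) < y ∧ ¬ ((d q : ℝ) : EReal) < y} := by
      ext y
      exact hpq y
    have h1 := toReal_measure_sdiff_chain m (φ := fun y : Set.Ioc a b => (y : EReal))
      (p := d p) (q := d q) measurable_subtype_coe
      (by rw [hmj]; exact ENNReal.ofReal_ne_top) (by rw [hmj]; exact ENNReal.ofReal_ne_top)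
    rw [ENNReal.coe_toNNReal_eq_toReal, hc, h1, hmj, hmj, ENNReal.toReal_ofReal (hΛ0 p),
      ENNReal.toReal_ofReal (hΛ0 q)]
    have h2 := (tendsto_const_nhds (x := (0 : ℝ))).max ((h.tail _ (hd.1 p).1 (hd.1 p).2).sub
      (h.tail _ (hd.1 q).1 (hd.1 q).2))
    refine h2.congr' ?_
    filter_upwards [h.law] with n hl
    rcases Nat.eq_zero_or_pos n with rfl | hn
    · simp
    have hprob : IsProbabilityMeasure (μ n) := by
      rw [← (hl ⟨0, hn⟩).map_eq]
      exact Measure.isProbabilityMeasure_map (h.measurable_X n _).aemeasurable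
    simp_rw [hpq]
    have h3 := toReal_measure_sdiff_chain (μ n) (φ := fun z => (M n z : EReal))
      (p := d p) (q := d q) ((h.measurable_M n).coe_real_ereal) (measure_ne_top _ _)
      (measure_ne_top _ _)
    simp only [EReal.coe_lt_coe_iff, ← measureReal_def] at h3 ⊢
    rw [h3]
    rw [mul_max_of_nonneg _ _ n.cast_nonneg, mul_zero, mul_sub]

open Classical in
/-- Variables close to the scores of independent points, discrete and with values at most `b`, form
asymptotically a Poisson process with intensity `Λ t` above `t`. -/
theorem CloseToScores.tendstoInDistribution {ι : ℕ → Type*} [∀ n, MeasurableSpace (ι n)]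
    [∀ n, DiscreteMeasurableSpace (ι n)] {y : ∀ n, ι n → Fin n → ℝ} {K : ∀ n, Ω n → ι n}
    (hab : a < b) (hK : ∀ n, Measurable (K n))
    (h : CloseToScores a b Λ P X μ M fun n i ω => y n (K n ω) i)
    (hy : ∀ n k i, (y n k i : EReal) ≤ b)
    {Ω' : Type*} [MeasurableSpace Ω'] {P' : Measure Ω'} [IsProbabilityMeasure P']
    {η : Ω' → PointMeasure (Set.Ioc a b)} {m : Measure (Set.Ioc a b)}
    (hη : IsPoissonProcess η m P')
    (hm : ∀ t : ℝ, a < t → (t : EReal) < b → m {y | (t : EReal) < y} = ENNReal.ofReal (Λ t)) :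
    TendstoInDistribution (fun n ω => pointsIn (Set.Ioc a b) fun i => (y n (K n ω) i : EReal))
      atTop η P P' := by
  obtain ⟨d, hd⟩ := exists_denseThresholds hab
  refine tendstoInDistribution_pointProcess hab hd
    (N := fun n k => pointsIn (Set.Ioc a b) fun i => (y n k i : EReal)) hK hη
    (fun j => by rw [hm _ (hd.1 j).1 (hd.1 j).2]; exact ENNReal.ofReal_ne_top) fun k c => ?_
  let A : ∀ n, Pattern k → Set D := fun n γ =>
    {z | ∀ j : Fin k, ((d j : ℝ) : EReal) < (M n z : EReal) ↔ γ.1 j = true}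
  have hA : ∀ n γ, MeasurableSet (A n γ) := by
    intro n γ
    simp only [A, Set.ofPred_forall, EReal.coe_lt_coe_iff]
    refine MeasurableSet.iInter fun j => ?_
    have hj : MeasurableSet {z | d j < M n z} := measurableSet_lt measurable_const
      (h.measurable_M n)
    by_cases hγ : γ.1 j = true
    · simpa [hγ] using hj
    · have : {z | d j < M n z ↔ γ.1 j = true} = {z | d j < M n z}ᶜ := by
        ext z
        simp [hγ]
      rw [this]
      exact hj.compl
  have hdisj : ∀ n, Pairwise fun γ δ => Disjoint (A n γ) (A n δ) := by
    intro n γ δ hγδ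
    refine Set.disjoint_left.2 fun z hz hz' => hγδ (Subtype.ext (funext fun j => ?_))
    exact Bool.eq_iff_iff.2 ((hz j).symm.trans (hz' j))
  have hpois := poisson_le_liminf_counts X h.measurable_X μ h.law h.indep A hA hdisj
    (fun γ => (m (cell _ d k γ)).toNNReal) (fun γ => tendsto_mul_measureReal_cell h hd hm γ) c
  let B : ∀ n, Set (Ω n) := fun n =>
    ⋃ j ∈ (Finset.univ : Finset (Fin k)),
      {ω | ∃ i, ¬ (d j < y n (K n ω) i ↔ d j < M n (X n i ω))}
  have hB : Tendsto (fun n => P n (B n)) atTop (𝓝 0) := by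
    have h1 : Tendsto (fun n => ∑ j : Fin k, (P n).real
        {ω | ∃ i, ¬ (d j < y n (K n ω) i ↔ d j < M n (X n i ω))}) atTop (𝓝 0) := by
      simpa using tendsto_finsetSum (Finset.univ : Finset (Fin k)) fun j _ =>
        h.tendsto_exists_ne (hd.1 j).1 (hd.1 j).2
    have h2 : Tendsto (fun n => (P n).real (B n)) atTop (𝓝 0) :=
      squeeze_zero (fun n => measureReal_nonneg) (fun n => measureReal_biUnion_finset_le _ _) h1
    have h3 := ENNReal.tendsto_ofReal h2
    simpa using h3
  have hle : ∀ n, P n {ω | ∀ γ, ∑ i, (A n γ).indicator (fun _ => (1 : ℝ)) (X n i ω) = c γ} ≤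
      P n {ω | ∀ γ : Pattern k, (pointsIn (Set.Ioc a b) fun i => (y n (K n ω) i : EReal)).1
        (cell _ d k γ) = c γ} + P n (B n) := by
    intro n
    refine (measure_mono fun ω hω => ?_).trans (measure_union_le _ _)
    by_cases hωB : ω ∈ B n
    · exact Or.inr hωB
    · refine Or.inl fun γ => ?_
      rw [pointsIn_cell (fun j => (hd.1 j).1) γ _ fun i => hy _ _ _]
      have h1 : ((Finset.univ.filter fun i => X n i ω ∈ A n γ).card : ℝ) = c γ := by
        rw [← hω γ, Finset.natCast_card_filter]
        refine Finset.sum_congr rfl fun i _ => ?_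
        by_cases hz : X n i ω ∈ A n γ <;> simp [hz]
      rw [← Nat.cast_inj.1 h1]
      congr 2
      refine Finset.filter_congr fun i _ => ?_
      refine forall_congr' fun j => ?_
      have h2 : d j < y n (K n ω) i ↔ d j < M n (X n i ω) := by
        by_contra hne
        refine hωB ?_
        simp only [B, Set.mem_iUnion]
        exact ⟨j, Finset.mem_univ j, i, hne⟩
      rw [EReal.coe_lt_coe_iff, EReal.coe_lt_coe_iff, h2]
  refine (hpois.trans (liminf_le_liminf (Eventually.of_forall hle))).trans (le_of_eq ?_)
  exact ENNReal.liminf_add_of_right_tendsto_zero hB _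

/-! ### Convergence in distribution on the line -/

theorem measure_Ioc_eq_ofReal_sub {T : Type*} [MeasurableSpace T] (κ : Measure T)
    [IsFiniteMeasure κ] {W : T → ℝ} (hW : AEMeasurable W κ) {u v : ℝ} (huv : u ≤ v) :
    κ {ω | u < W ω ∧ W ω ≤ v} =
      ENNReal.ofReal (κ.real {ω | W ω ≤ v} - κ.real {ω | W ω ≤ u}) := by
  have hset : {ω | u < W ω ∧ W ω ≤ v} = {ω | W ω ≤ v} \ {ω | W ω ≤ u} := by
    ext ω
    simp [and_comm]
  have hsub : {ω | W ω ≤ u} ⊆ {ω | W ω ≤ v} := fun ω hω => le_trans hω huv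
  rw [hset, measure_sdiff hsub (nullMeasurableSet_le hW aemeasurable_const)
    (measure_ne_top _ _), ENNReal.ofReal_sub _ measureReal_nonneg, measureReal_def,
    measureReal_def, ENNReal.ofReal_toReal (measure_ne_top _ _),
    ENNReal.ofReal_toReal (measure_ne_top _ _)]

/-- Convergence of the distribution functions on an interval that carries the limit law implies
convergence in distribution. -/
theorem tendstoInDistribution_of_tendsto_le {a b : EReal} {Ω : ℕ → Type*}
    [∀ n, MeasurableSpace (Ω n)] {P : ∀ n, Measure (Ω n)} [∀ n, IsProbabilityMeasure (P n)]
    {Ω' : Type*} [MeasurableSpace Ω'] {P' : Measure Ω'} [IsProbabilityMeasure P']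
    {Y : ∀ n, Ω n → ℝ} {Z : Ω' → ℝ} (hY : ∀ n, Measurable (Y n)) (hZ : AEMeasurable Z P')
    (hab : ∀ᵐ ω ∂P', a < (Z ω : EReal) ∧ (Z ω : EReal) < b)
    (h : ∀ t : ℝ, a < t → (t : EReal) < b →
      Tendsto (fun n => (P n).real {ω | Y n ω ≤ t}) atTop (𝓝 (P'.real {ω | Z ω ≤ t}))) :
    TendstoInDistribution Y atTop Z P P' := by
  have hcell : ∀ (k : ℕ) (c : ℤ) (x : ℝ), ⌈(2 : ℝ) ^ k * x⌉ = c ↔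
      ((c : ℝ) - 1) / 2 ^ k < x ∧ x ≤ (c : ℝ) / 2 ^ k := by
    intro k c x
    have h2 : (0 : ℝ) < 2 ^ k := by positivity
    rw [Int.ceil_eq_iff, div_lt_iff₀ h2, le_div_iff₀ h2, mul_comm x]
  refine tendstoInDistribution_of_cells (T := fun _ => ℤ) (fun n => (hY n).aemeasurable) hZ
    (fun k x => ⌈(2 : ℝ) ^ k * x⌉)
    (fun k => {c | a < ((((c : ℝ) - 1) / 2 ^ k : ℝ) : EReal) ∧ (((c : ℝ) / 2 ^ k : ℝ) : EReal) < b})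
    (fun k => Set.to_countable _) {x | a < (x : EReal) ∧ (x : EReal) < b} hab ?_ ?_ ?_
  · intro G hG x hxG hx
    have hopen : IsOpen (G ∩ ((fun x : ℝ => (x : EReal)) ⁻¹' Set.Ioo a b)) :=
      hG.inter (isOpen_Ioo.preimage continuous_coe_real_ereal)
    obtain ⟨δ, hδ, hball⟩ := Metric.isOpen_iff.1 hopen x ⟨hxG, hx⟩
    have hpow : Tendsto (fun k : ℕ => (1 / 2 : ℝ) ^ k) atTop (𝓝 0) :=
      tendsto_pow_atTop_nhds_zero_of_lt_one (by norm_num) (by norm_num)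
    filter_upwards [hpow.eventually_lt_const hδ] with k hk
    have h2 : (0 : ℝ) < 2 ^ k := by positivity
    obtain ⟨h3, h4⟩ := (hcell k _ x).1 rfl
    set c := ⌈(2 : ℝ) ^ k * x⌉
    have h5 : (c : ℝ) / 2 ^ k = ((c : ℝ) - 1) / 2 ^ k + (1 / 2) ^ k := by
      rw [div_pow, one_pow]
      ring
    have hmem : ∀ y : ℝ, ((c : ℝ) - 1) / 2 ^ k ≤ y → y ≤ (c : ℝ) / 2 ^ k →
        y ∈ G ∧ a < (y : EReal) ∧ (y : EReal) < b := by
      intro y hy hy'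
      have : y ∈ Metric.ball x δ := by
        rw [Metric.mem_ball, Real.dist_eq, abs_lt]
        constructor <;> linarith
      exact hball this
    refine ⟨⟨(hmem _ le_rfl
        (by rw [h5]; linarith [pow_pos (show (0 : ℝ) < 1 / 2 by norm_num) k])).2.1,
      (hmem _ (by rw [h5]; linarith [pow_pos (show (0 : ℝ) < 1 / 2 by norm_num) k]) le_rfl).2.2⟩,
      fun y hy => ?_⟩
    obtain ⟨h6, h7⟩ := (hcell k c y).1 hy
    exact (hmem y h6.le h7).1
  · intro k n c
    simp_rw [hcell]
    exact (measurableSet_lt measurable_const (hY n)).inter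
      (measurableSet_le (hY n) measurable_const)
  · rintro k c ⟨hc1, hc2⟩
    simp_rw [hcell]
    set u := ((c : ℝ) - 1) / 2 ^ k
    set v := (c : ℝ) / 2 ^ k
    have huv : u ≤ v := by
      have h2 : (0 : ℝ) < 2 ^ k := by positivity
      exact div_le_div_of_nonneg_right (by linarith) h2.le
    have hau : (u : EReal) < b := (EReal.coe_le_coe_iff.2 huv).trans_lt hc2
    have hav : a < (v : EReal) := hc1.trans_le (EReal.coe_le_coe_iff.2 huv)
    rw [measure_Ioc_eq_ofReal_sub P' hZ huv]
    simp_rw [fun n => measure_Ioc_eq_ofReal_sub (P n) (hY n).aemeasurable huv]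
    exact (ENNReal.tendsto_ofReal ((h v hav hc2).sub (h u hc1 hau))).liminf_eq.ge

/-! ### Deviations of the number of neighbours of a node -/

open Classical in
/-- The number of points, other than `x i` itself, that are related to `x i`. -/
def neighbourCount {D : Type*} (R : Set (D × D)) {n : ℕ} (x : Fin n → D) (i : Fin n) : ℝ :=
  ((Finset.univ.filter fun j => j ≠ i ∧ (x i, x j) ∈ R).card : ℝ)

theorem neighbourCount_eq {D : Type*} (R : Set (D × D)) {m : ℕ} (x : Fin (m + 1) → D)
    (i : Fin (m + 1)) :
    neighbourCount R x i =
      ∑ j : Fin m, {w | (x i, w) ∈ R}.indicator (fun _ => (1 : ℝ)) (x (i.succAbove j)) := by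
  classical
  rw [neighbourCount, Finset.natCast_card_filter, Fin.sum_univ_succAbove _ i]
  simp only [ne_eq, not_true_eq_false, false_and, if_false, zero_add]
  refine Finset.sum_congr rfl fun j _ => ?_
  by_cases h : (x i, x (i.succAbove j)) ∈ R <;> simp [h, Fin.succAbove_ne]

theorem measureReal_exists_le {Ω : Type*} [MeasurableSpace Ω] {P : Measure Ω} {n : ℕ}
    {Q : Fin n → Ω → Prop} {e : ℝ}
    (h : ∀ i, P.real {ω | Q i ω} ≤ e) : P.real {ω | ∃ i, Q i ω} ≤ n * e := by
  have : {ω | ∃ i, Q i ω} = ⋃ i ∈ (Finset.univ : Finset (Fin n)), {ω | Q i ω} := by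
    ext ω
    simp
  rw [this]
  refine (measureReal_biUnion_finset_le _ _).trans ((Finset.sum_le_sum fun i _ => h i).trans ?_)
  simp

section Chernoff

variable {D : Type*} [MeasurableSpace D] (μ : Measure D) [IsProbabilityMeasure μ]

theorem mgf_indicator {A : Set D} (hA : MeasurableSet A) (s : ℝ) :
    mgf (A.indicator fun _ => (1 : ℝ)) μ s = 1 + μ.real A * (Real.exp s - 1) := by
  have h : ∀ z, Real.exp (s * A.indicator (fun _ => (1 : ℝ)) z) =
      1 + A.indicator (fun _ => Real.exp s - 1) z := by
    intro z
    by_cases hz : z ∈ A <;> simp [hz]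
  unfold mgf
  simp_rw [h]
  rw [integral_add (integrable_const _) ((integrable_const _).indicator hA), integral_indicator hA]
  simp

/-- The moment generating function of a binomial variable is at most that of the Poisson variable
with the same mean. -/
theorem mgf_count_le (m : ℕ) {A : Set D} (hA : MeasurableSet A) (s : ℝ) :
    mgf (fun y : Fin m → D => ∑ j, A.indicator (fun _ => (1 : ℝ)) (y j))
      (Measure.pi fun _ => μ) s ≤ Real.exp (m * μ.real A * (Real.exp s - 1)) := by
  have hmeas : ∀ j : Fin m, Measurable fun y : Fin m → D => A.indicator (fun _ => (1 : ℝ)) (y j) :=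
    fun j => (measurable_const.indicator hA).comp (measurable_pi_apply j)
  have hind : iIndepFun (fun (j : Fin m) (y : Fin m → D) => A.indicator (fun _ => (1 : ℝ)) (y j))
      (Measure.pi fun _ => μ) :=
    iIndepFun_pi (X := fun _ => A.indicator fun _ => (1 : ℝ))
      fun _ => (measurable_const.indicator hA).aemeasurable
  have h1 := hind.mgf_sum hmeas Finset.univ (t := s)
  have h2 : (∑ j, fun y : Fin m → D => A.indicator (fun _ => (1 : ℝ)) (y j)) =
      fun y => ∑ j, A.indicator (fun _ => (1 : ℝ)) (y j) := by
    ext y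
    simp
  rw [h2] at h1
  have h3 : ∀ j : Fin m, mgf (fun y : Fin m → D => A.indicator (fun _ => (1 : ℝ)) (y j))
      (Measure.pi fun _ => μ) s = 1 + μ.real A * (Real.exp s - 1) := by
    intro j
    rw [← mgf_indicator μ hA s]
    have hmp := measurePreserving_eval (fun _ : Fin m => μ) j
    have := mgf_map (μ := Measure.pi fun _ : Fin m => μ) (Y := Function.eval j)
      (X := A.indicator fun _ => (1 : ℝ)) hmp.measurable.aemeasurable (t := s)
      (by exact (Real.measurable_exp.comp (measurable_const.mul
        (measurable_const.indicator hA))).aestronglyMeasurable)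
    rw [hmp.map_eq] at this
    rw [this]
    rfl
  rw [h1, Finset.prod_congr rfl fun j _ => h3 j]
  simp only [Finset.prod_const, Finset.card_univ, Fintype.card_fin]
  rw [mul_assoc, Real.exp_nat_mul]
  refine pow_le_pow_left₀ ?_ (by linarith [Real.add_one_le_exp (μ.real A * (Real.exp s - 1))]) m
  have h4 : μ.real A ≤ 1 := measureReal_le_one
  have h5 : 0 ≤ μ.real A := measureReal_nonneg
  nlinarith [Real.exp_pos s]

theorem integrable_exp_count (m : ℕ) {A : Set D} (hA : MeasurableSet A) (s : ℝ) :
    Integrable (fun y : Fin m → D =>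
      Real.exp (s * ∑ j, A.indicator (fun _ => (1 : ℝ)) (y j))) (Measure.pi fun _ => μ) := by
  have hmeas : ∀ j : Fin m, Measurable fun y : Fin m → D => A.indicator (fun _ => (1 : ℝ)) (y j) :=
    fun j => (measurable_const.indicator hA).comp (measurable_pi_apply j)
  refine Integrable.of_bound (C := Real.exp (|s| * m)) ?_ (Eventually.of_forall fun y => ?_)
  · exact (Real.measurable_exp.comp (measurable_const.mul
      (Finset.measurable_fun_sum _ fun j _ => hmeas j))).aestronglyMeasurable
  · rw [Real.norm_eq_abs, Real.abs_exp, Real.exp_le_exp]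
    have h1 : 0 ≤ ∑ j, A.indicator (fun _ => (1 : ℝ)) (y j) :=
      Finset.sum_nonneg fun j _ => Set.indicator_nonneg (fun _ _ => zero_le_one) _
    have h2 : ∑ j, A.indicator (fun _ => (1 : ℝ)) (y j) ≤ ∑ j : Fin m, 1 :=
      Finset.sum_le_sum fun j _ => Set.indicator_le_self' (fun _ _ => zero_le_one) _
    simp only [Finset.sum_const, Finset.card_univ, Fintype.card_fin, nsmul_eq_mul, mul_one] at h2
    calc s * _ ≤ |s| * _ := mul_le_mul_of_nonneg_right (le_abs_self s) h1
      _ ≤ |s| * m := mul_le_mul_of_nonneg_left h2 (abs_nonneg s)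

/-- Chernoff bound for the upper tail of a binomial variable of mean at most `S`. -/
theorem count_ge_le (m : ℕ) {A : Set D} (hA : MeasurableSet A) {s S T : ℝ} (hs : 0 ≤ s)
    (hS : m * μ.real A ≤ S) :
    (Measure.pi fun _ : Fin m => μ).real {y | T ≤ ∑ j, A.indicator (fun _ => (1 : ℝ)) (y j)} ≤
      Real.exp (-(s * T) + S * (Real.exp s - 1)) := by
  refine (measure_ge_le_exp_mul_mgf T hs (integrable_exp_count μ m hA s)).trans ?_
  rw [Real.exp_add, neg_mul]
  refine mul_le_mul_of_nonneg_left ((mgf_count_le μ m hA s).trans ?_) (Real.exp_pos _).le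
  rw [Real.exp_le_exp]
  exact mul_le_mul_of_nonneg_right hS (by linarith [Real.add_one_le_exp s])

/-- Chernoff bound for the lower tail of a binomial variable of mean at least `T`. -/
theorem count_le_le (m : ℕ) {A : Set D} (hA : MeasurableSet A) {s S T : ℝ} (hs : 0 ≤ s)
    (hT : T ≤ m * μ.real A) :
    (Measure.pi fun _ : Fin m => μ).real {y | ∑ j, A.indicator (fun _ => (1 : ℝ)) (y j) ≤ S} ≤
      Real.exp (s * S - T * (1 - Real.exp (-s))) := by
  refine (measure_le_le_exp_mul_mgf S (neg_nonpos.2 hs)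
    (integrable_exp_count μ m hA (-s))).trans ?_
  rw [sub_eq_add_neg, Real.exp_add, neg_neg]
  refine mul_le_mul_of_nonneg_left ((mgf_count_le μ m hA (-s)).trans ?_) (Real.exp_pos _).le
  rw [Real.exp_le_exp]
  have h1 : Real.exp (-s) ≤ 1 := Real.exp_le_one_iff.2 (neg_nonpos.2 hs)
  nlinarith

variable {μ}

/-- A bound that holds conditionally on the position of the node `i` holds unconditionally. -/
theorem measureReal_le_of_forall_section {Ω : Type*} [MeasurableSpace Ω] {P : Measure Ω}
    [IsProbabilityMeasure P] {m : ℕ} {X : Fin (m + 1) → Ω → D} (hlaw : ∀ i, HasLaw (X i) μ P)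
    (hind : iIndepFun X P) (i : Fin (m + 1)) {B : Set (D × (Fin m → D))} (hB : MeasurableSet B)
    {e : ℝ} (he : ∀ z, (Measure.pi fun _ : Fin m => μ).real {y | (z, y) ∈ B} ≤ e) :
    P.real {ω | (X i ω, fun j => X (i.succAbove j) ω) ∈ B} ≤ e := by
  have hX : ∀ i, AEMeasurable (X i) P := fun i => (hlaw i).aemeasurable
  have h1 := (iIndepFun_iff_map_fun_eq_pi_map hX).1 hind
  simp_rw [fun i => (hlaw i).map_eq] at h1
  have h2 := measurePreserving_piFinSuccAbove (fun _ : Fin (m + 1) => μ) i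
  have h3 : P {ω | (X i ω, fun j => X (i.succAbove j) ω) ∈ B} =
      (μ.prod (Measure.pi fun _ : Fin m => μ)) B := by
    rw [← h2.map_eq, Measure.map_apply h2.measurable hB, ← h1,
      Measure.map_apply_of_aemeasurable (aemeasurable_pi_lambda _ hX) (h2.measurable hB)]
    rfl
  have he0 : 0 ≤ e := measureReal_nonneg.trans (he (X i P.nonempty_of_neZero.some))
  rw [measureReal_def, h3, Measure.prod_apply hB]
  refine ENNReal.toReal_le_of_le_ofReal he0 ?_
  calc ∫⁻ z, (Measure.pi fun _ : Fin m => μ) (Prod.mk z ⁻¹' B) ∂μ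
      ≤ ∫⁻ _, ENNReal.ofReal e ∂μ := by
        refine lintegral_mono fun z => ?_
        rw [← ENNReal.ofReal_toReal (measure_ne_top (Measure.pi fun _ : Fin m => μ) _)]
        exact ENNReal.ofReal_le_ofReal (he z)
    _ = ENNReal.ofReal e := by simp

variable {Ω : Type*} [MeasurableSpace Ω] {P : Measure Ω} [IsProbabilityMeasure P] {n : ℕ}
  {X : Fin n → Ω → D} {R : Set (D × D)}

theorem measurable_section (hR : MeasurableSet R) (m : ℕ) :
    Measurable fun q : D × (Fin m → D) =>
      ∑ j, {w | (q.1, w) ∈ R}.indicator (fun _ => (1 : ℝ)) (q.2 j) := by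
  refine Finset.measurable_fun_sum _ fun j _ => ?_
  have h1 : Measurable fun q : D × (Fin m → D) => R.indicator (fun _ => (1 : ℝ)) (q.1, q.2 j) :=
    (measurable_const.indicator hR).comp
      (measurable_fst.prodMk ((measurable_pi_apply j).comp measurable_snd))
  exact h1

theorem measurable_measureReal_section (hR : MeasurableSet R) :
    Measurable fun z => μ.real {w | (z, w) ∈ R} :=
  (measurable_measure_prodMk_left hR).ennreal_toReal

/-- It is unlikely that some node with a small expected number of neighbours has many. -/
theorem exists_neighbourCount_ge_le (hlaw : ∀ i, HasLaw (X i) μ P) (hind : iIndepFun X P)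
    (hR : MeasurableSet R) {s S T : ℝ} (hs : 0 ≤ s) :
    P.real {ω | ∃ i, T ≤ neighbourCount R (fun j => X j ω) i ∧
      ((n : ℝ) - 1) * μ.real {w | (X i ω, w) ∈ R} ≤ S} ≤
      n * Real.exp (-(s * T) + S * (Real.exp s - 1)) := by
  refine measureReal_exists_le fun i => ?_
  rcases n with - | m
  · exact i.elim0
  simp_rw [neighbourCount_eq]
  refine measureReal_le_of_forall_section hlaw hind i (B := {q | T ≤ ∑ j,
    {w | (q.1, w) ∈ R}.indicator (fun _ => (1 : ℝ)) (q.2 j) ∧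
    (((m + 1 : ℕ) : ℝ) - 1) * μ.real {w | (q.1, w) ∈ R} ≤ S}) ?_ fun z => ?_
  · exact (measurableSet_le measurable_const (measurable_section hR m)).inter
      (measurableSet_le (measurable_const.mul ((measurable_measureReal_section hR).comp
        measurable_fst)) measurable_const)
  · by_cases hz : (((m + 1 : ℕ) : ℝ) - 1) * μ.real {w | (z, w) ∈ R} ≤ S
    · refine (measureReal_mono fun y hy => hy.1).trans (count_ge_le μ m
        (A := {w | (z, w) ∈ R}) (measurable_prodMk_left hR) hs ?_)
      simpa using hz
    · have : {y : Fin m → D | (z, y) ∈ {q : D × (Fin m → D) | T ≤ ∑ j,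
          {w | (q.1, w) ∈ R}.indicator (fun _ => (1 : ℝ)) (q.2 j) ∧
          (((m + 1 : ℕ) : ℝ) - 1) * μ.real {w | (q.1, w) ∈ R} ≤ S}} = ∅ :=
        Set.eq_empty_of_forall_notMem fun y hy => hz hy.2
      rw [this, measureReal_empty]
      positivity

/-- It is unlikely that some node with a large expected number of neighbours has few. -/
theorem exists_neighbourCount_le_le (hlaw : ∀ i, HasLaw (X i) μ P) (hind : iIndepFun X P)
    (hR : MeasurableSet R) {s S T : ℝ} (hs : 0 ≤ s) :
    P.real {ω | ∃ i, neighbourCount R (fun j => X j ω) i ≤ S ∧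
      T ≤ ((n : ℝ) - 1) * μ.real {w | (X i ω, w) ∈ R}} ≤
      n * Real.exp (s * S - T * (1 - Real.exp (-s))) := by
  refine measureReal_exists_le fun i => ?_
  rcases n with - | m
  · exact i.elim0
  simp_rw [neighbourCount_eq]
  refine measureReal_le_of_forall_section hlaw hind i (B := {q | ∑ j,
    {w | (q.1, w) ∈ R}.indicator (fun _ => (1 : ℝ)) (q.2 j) ≤ S ∧
    T ≤ (((m + 1 : ℕ) : ℝ) - 1) * μ.real {w | (q.1, w) ∈ R}}) ?_ fun z => ?_
  · exact (measurableSet_le (measurable_section hR m) measurable_const).inter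
      (measurableSet_le measurable_const (measurable_const.mul
        ((measurable_measureReal_section hR).comp measurable_fst)))
  · by_cases hz : T ≤ (((m + 1 : ℕ) : ℝ) - 1) * μ.real {w | (z, w) ∈ R}
    · refine (measureReal_mono fun y hy => hy.1).trans (count_le_le μ m
        (A := {w | (z, w) ∈ R}) (measurable_prodMk_left hR) hs ?_)
      simpa using hz
    · have : {y : Fin m → D | (z, y) ∈ {q : D × (Fin m → D) | ∑ j,
          {w | (q.1, w) ∈ R}.indicator (fun _ => (1 : ℝ)) (q.2 j) ≤ S ∧
          T ≤ (((m + 1 : ℕ) : ℝ) - 1) * μ.real {w | (q.1, w) ∈ R}}} = ∅ :=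
        Set.eq_empty_of_forall_notMem fun y hy => hz hy.2
      rw [this, measureReal_empty]
      positivity

end Chernoff

section Scale

variable {D : Type*} [MeasurableSpace D]
  {Ω : ℕ → Type*} [∀ n, MeasurableSpace (Ω n)] {P : ∀ n, Measure (Ω n)}
  [∀ n, IsProbabilityMeasure (P n)]
  {X : ∀ n, Fin n → Ω n → D} {μ : ℕ → Measure D} {R : ℕ → Set (D × D)} {l : ℝ}

theorem tendsto_mul_exp_neg_rpow {l c : ℝ} (hl : 0 < l) (hc : 0 < c) :
    Tendsto (fun n : ℕ => (n : ℝ) * Real.exp (-c * (n : ℝ) ^ l)) atTop (𝓝 0) := by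
  have h1 := (tendsto_rpow_mul_exp_neg_mul_atTop_nhds_zero (1 / l) c hc).comp
    ((tendsto_rpow_atTop hl).comp tendsto_natCast_atTop_atTop)
  refine h1.congr fun n => ?_
  simp only [Function.comp]
  rw [← Real.rpow_mul n.cast_nonneg, mul_one_div_cancel hl.ne', Real.rpow_one]

/-- On a polynomial scale, no node with normalized expected count at most `s` has normalized count
`t > s` or more. -/
theorem tendsto_exists_count_ge (hl : 0 < l)
    (hlaw : ∀ᶠ n in atTop, ∀ i, HasLaw (X n i) (μ n) (P n))
    (hind : ∀ᶠ n in atTop, iIndepFun (X n) (P n)) (hR : ∀ n, MeasurableSet (R n)) {s t : ℝ}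
    (hs : 0 < s) (hst : s < t) :
    Tendsto (fun n : ℕ => (P n).real {ω | ∃ i,
      t * (n : ℝ) ^ l ≤ neighbourCount (R n) (fun j => X n j ω) i ∧
      ((n : ℝ) - 1) * (μ n).real {w | (X n i ω, w) ∈ R n} ≤ s * (n : ℝ) ^ l}) atTop (𝓝 0) := by
  obtain ⟨u, hu, hc⟩ : ∃ u : ℝ, 0 < u ∧ 0 < u * t - s * (Real.exp u - 1) := by
    have ht : 0 < t := hs.trans hst
    refine ⟨Real.log (t / s), Real.log_pos ((one_lt_div hs).2 hst), ?_⟩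
    have h1 := Real.log_lt_sub_one_of_pos (div_pos hs ht) (div_lt_one ht |>.2 hst).ne
    rw [← inv_div, Real.log_inv, inv_div] at h1
    rw [Real.exp_log (div_pos ht hs)]
    have h2 : s * (t / s - 1) = t - s := by field_simp
    have h3 : (s / t - 1) * t = s - t := by field_simp
    rw [h2]
    nlinarith
  refine squeeze_zero' (Eventually.of_forall fun n => measureReal_nonneg) ?_
    (tendsto_mul_exp_neg_rpow hl hc)
  filter_upwards [hlaw, hind, eventually_gt_atTop 0] with n hl hi hn
  have hprob : IsProbabilityMeasure (μ n) := by
    rw [← (hl ⟨0, hn⟩).map_eq]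
    exact Measure.isProbabilityMeasure_map (hl ⟨0, hn⟩).aemeasurable
  refine (exists_neighbourCount_ge_le hl hi (hR n) hu.le).trans (le_of_eq ?_)
  congr 2
  ring

/-- On a polynomial scale, no node with normalized expected count at least `t` has normalized count
`s < t` or less. -/
theorem tendsto_exists_count_le (hl : 0 < l)
    (hlaw : ∀ᶠ n in atTop, ∀ i, HasLaw (X n i) (μ n) (P n))
    (hind : ∀ᶠ n in atTop, iIndepFun (X n) (P n)) (hR : ∀ n, MeasurableSet (R n)) {s t : ℝ}
    (hs : 0 < s) (hst : s < t) :
    Tendsto (fun n : ℕ => (P n).real {ω | ∃ i,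
      neighbourCount (R n) (fun j => X n j ω) i ≤ s * (n : ℝ) ^ l ∧
      t * (n : ℝ) ^ l ≤ ((n : ℝ) - 1) * (μ n).real {w | (X n i ω, w) ∈ R n}}) atTop (𝓝 0) := by
  obtain ⟨u, hu, hc⟩ : ∃ u : ℝ, 0 < u ∧ 0 < t * (1 - Real.exp (-u)) - u * s := by
    have ht : 0 < t := hs.trans hst
    refine ⟨Real.log (t / s), Real.log_pos ((one_lt_div hs).2 hst), ?_⟩
    have h1 := Real.log_lt_sub_one_of_pos (div_pos ht hs) (one_lt_div hs |>.2 hst).ne'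
    rw [← Real.log_inv, inv_div, Real.exp_log (div_pos hs ht)]
    have h2 : t * (1 - s / t) = t - s := by field_simp
    have h3 : (t / s - 1) * s = t - s := by field_simp
    rw [h2]
    nlinarith
  refine squeeze_zero' (Eventually.of_forall fun n => measureReal_nonneg) ?_
    (tendsto_mul_exp_neg_rpow hl hc)
  filter_upwards [hlaw, hind, eventually_gt_atTop 0] with n hl hi hn
  have hprob : IsProbabilityMeasure (μ n) := by
    rw [← (hl ⟨0, hn⟩).map_eq]
    exact Measure.isProbabilityMeasure_map (hl ⟨0, hn⟩).aemeasurable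
  refine (exists_neighbourCount_le_le hl hi (hR n) hu.le).trans (le_of_eq ?_)
  congr 2
  ring

end Scale

/-! ### The function `V` -/

/-- `exp` of the Busemann function at distance `r` in a direction at angle `φ` of the boundary
point. -/
def busemannExp (r φ : ℝ) : ℝ := Real.cosh r - Real.sinh r * Real.cos φ

theorem busemannExp_eq (r φ : ℝ) :
    busemannExp r φ =
      (1 + Real.cos φ) / 2 * Real.exp (-r) + (1 - Real.cos φ) / 2 * Real.exp r := by
  rw [busemannExp, Real.cosh_eq, Real.sinh_eq]
  ring

theorem exp_neg_abs_le_busemannExp (r φ : ℝ) : Real.exp (-|r|) ≤ busemannExp r φ := by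
  rw [busemannExp_eq]
  have h1 : Real.exp (-|r|) ≤ Real.exp (-r) := Real.exp_le_exp.2 (neg_le_neg (le_abs_self r))
  have h2 : Real.exp (-|r|) ≤ Real.exp r := Real.exp_le_exp.2 (neg_abs_le r)
  nlinarith [Real.neg_one_le_cos φ, Real.cos_le_one φ]

theorem busemannExp_le_exp_abs (r φ : ℝ) : busemannExp r φ ≤ Real.exp |r| := by
  rw [busemannExp_eq]
  have h1 : Real.exp (-r) ≤ Real.exp |r| := Real.exp_le_exp.2 (neg_le_abs r)
  have h2 : Real.exp r ≤ Real.exp |r| := Real.exp_le_exp.2 (le_abs_self r)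
  nlinarith [Real.neg_one_le_cos φ, Real.cos_le_one φ]

theorem busemannExp_pos (r φ : ℝ) : 0 < busemannExp r φ :=
  (Real.exp_pos _).trans_le (exp_neg_abs_le_busemannExp r φ)

theorem continuous_busemannExp : Continuous fun p : ℝ × ℝ => busemannExp p.1 p.2 := by
  unfold busemannExp
  fun_prop

theorem hasDerivAt_busemannExp (r φ : ℝ) :
    HasDerivAt (fun r => busemannExp r φ) (Real.sinh r - Real.cosh r * Real.cos φ) r :=
  (Real.hasDerivAt_cosh r).sub ((Real.hasDerivAt_sinh r).mul_const _)

theorem abs_deriv_busemannExp_le (r φ : ℝ) :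
    |Real.sinh r - Real.cosh r * Real.cos φ| ≤ busemannExp r φ := by
  rw [busemannExp_eq, Real.cosh_eq, Real.sinh_eq, abs_le]
  have h1 := Real.exp_pos r
  have h2 := Real.exp_pos (-r)
  constructor <;> nlinarith [Real.neg_one_le_cos φ, Real.cos_le_one φ]

theorem deriv_busemannExp_pos {r φ : ℝ} (hr : 0 < r) (h : 1 < busemannExp r φ) :
    0 < Real.sinh r - Real.cosh r * Real.cos φ := by
  have hs := Real.sinh_pos_iff.2 hr
  have hc := Real.one_lt_cosh.2 hr.ne'
  have h2 := Real.cosh_sq r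
  unfold busemannExp at h
  -- `sinh² - cosh sinh cos > sinh² - cosh (cosh - 1) = cosh - 1`
  have h3 : 0 < Real.sinh r * (Real.sinh r - Real.cosh r * Real.cos φ) := by nlinarith
  exact pos_of_mul_pos_right h3 hs.le

/-- The integrand of `V` after exchanging the roles of the angle and of the boundary layer. -/
def layerMass (r φ : ℝ) : ℝ := min 1 (busemannExp r φ ^ (-(1 / 2) : ℝ))

theorem layerMass_nonneg (r φ : ℝ) : 0 ≤ layerMass r φ :=
  le_min zero_le_one (Real.rpow_nonneg (busemannExp_pos r φ).le _)

theorem layerMass_le_one (r φ : ℝ) : layerMass r φ ≤ 1 := min_le_left _ _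

theorem continuous_layerMass : Continuous fun p : ℝ × ℝ => layerMass p.1 p.2 := by
  unfold layerMass
  exact continuous_const.min (continuous_busemannExp.rpow_const
    fun p => Or.inl (busemannExp_pos p.1 p.2).ne')

/-- Both sides are the area of the region of the pairs `(x, φ)` with
`cosh r - sinh r * cos φ ≤ x⁻²`, cut in either direction. -/
theorem lintegral_layers {r : ℝ} (hr : 0 < r) :
    ∫⁻ x in Set.Ioc (0 : ℝ) 1, ENNReal.ofReal
        (Real.arccos (max (-1) ((Real.cosh r - (x ^ 2)⁻¹) / Real.sinh r))) =
      ∫⁻ φ in Set.Ioc (0 : ℝ) Real.pi, ENNReal.ofReal (layerMass r φ) := by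
  have hs := Real.sinh_pos_iff.2 hr
  set c : ℝ → ℝ := fun x => (Real.cosh r - (x ^ 2)⁻¹) / Real.sinh r with hc
  have hcm : Measurable c := by
    simp only [hc]
    fun_prop
  let S : Set (ℝ × ℝ) := {p | p.1 ∈ Set.Ioc (0 : ℝ) 1 ∧ p.2 ∈ Set.Ioc (0 : ℝ) Real.pi ∧
    c p.1 ≤ Real.cos p.2}
  have hS : MeasurableSet S := by
    have hle : MeasurableSet {p : ℝ × ℝ | c p.1 ≤ Real.cos p.2} :=
      measurableSet_le (hcm.comp measurable_fst) (Real.measurable_cos.comp measurable_snd)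
    exact (measurable_fst measurableSet_Ioc).inter ((measurable_snd measurableSet_Ioc).inter hle)
  have h1 := Measure.prod_apply (μ := (volume : Measure ℝ)) (ν := (volume : Measure ℝ)) hS
  have h2 := Measure.prod_apply_symm (μ := (volume : Measure ℝ)) (ν := (volume : Measure ℝ)) hS
  have e1 : ∀ x, volume (Prod.mk x ⁻¹' S) = (Set.Ioc (0 : ℝ) 1).indicator (fun x =>
      ENNReal.ofReal (Real.arccos (max (-1) (c x)))) x := by
    intro x
    by_cases hx : x ∈ Set.Ioc (0 : ℝ) 1
    · rw [Set.indicator_of_mem hx]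
      have hc1 : c x ≤ 1 := by
        simp only [hc]
        rw [div_le_one hs]
        have : 1 ≤ (x ^ 2)⁻¹ := (one_le_inv₀ (by have := hx.1; positivity)).2
          (by nlinarith [hx.1, hx.2])
        linarith [Real.cosh_sub_sinh r, Real.exp_le_one_iff.2 (neg_nonpos.2 hr.le)]
      have hset : Prod.mk x ⁻¹' S = Set.Ioc 0 (Real.arccos (max (-1) (c x))) := by
        ext φ
        have hiff : ∀ φ ∈ Set.Icc 0 Real.pi,
            (φ ≤ Real.arccos (max (-1) (c x)) ↔ c x ≤ Real.cos φ) := by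
          intro φ hφ
          rw [← Real.strictAntiOn_cos.le_iff_ge ⟨Real.arccos_nonneg _, Real.arccos_le_pi _⟩ hφ,
            Real.cos_arccos (le_max_left _ _) (max_le (by norm_num) hc1), max_le_iff]
          exact ⟨fun h => h.2, fun h => ⟨Real.neg_one_le_cos φ, h⟩⟩
        constructor
        · rintro ⟨-, hφ, hcφ⟩
          exact ⟨hφ.1, (hiff φ ⟨hφ.1.le, hφ.2⟩).2 hcφ⟩
        · rintro ⟨hφ, hφ'⟩
          have hπ := hφ'.trans (Real.arccos_le_pi _)
          exact ⟨hx, ⟨hφ, hπ⟩, (hiff φ ⟨hφ.le, hπ⟩).1 hφ'⟩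
      rw [hset, Real.volume_Ioc, sub_zero]
    · rw [Set.indicator_of_notMem hx]
      have : Prod.mk x ⁻¹' S = ∅ := Set.eq_empty_of_forall_notMem fun φ hφ => hx hφ.1
      rw [this, measure_empty]
  have e2 : ∀ φ, volume ((fun x => (x, φ)) ⁻¹' S) = (Set.Ioc (0 : ℝ) Real.pi).indicator (fun φ =>
      ENNReal.ofReal (layerMass r φ)) φ := by
    intro φ
    by_cases hφ : φ ∈ Set.Ioc (0 : ℝ) Real.pi
    · rw [Set.indicator_of_mem hφ]
      have hset : (fun x => (x, φ)) ⁻¹' S = Set.Ioc 0 (layerMass r φ) := by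
        ext x
        have hiff : 0 < x → (c x ≤ Real.cos φ ↔ x ≤ busemannExp r φ ^ (-(1 / 2) : ℝ)) := by
          intro hx
          have hK := busemannExp_pos r φ
          simp only [hc]
          rw [div_le_iff₀ hs, Real.rpow_neg hK.le, ← Real.sqrt_eq_rpow]
          have h3 : Real.cosh r - (x ^ 2)⁻¹ ≤ Real.cos φ * Real.sinh r ↔
              busemannExp r φ ≤ (x ^ 2)⁻¹ := by
            unfold busemannExp
            constructor <;> intro h <;> linarith
          rw [h3, le_inv_comm₀ hK (by positivity), ← Real.sqrt_inv, Real.le_sqrt' hx]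
        constructor
        · rintro ⟨hx, -, hcx⟩
          exact ⟨hx.1, le_min hx.2 ((hiff hx.1).1 hcx)⟩
        · rintro ⟨hx, hx'⟩
          exact ⟨⟨hx, hx'.trans (min_le_left _ _)⟩, hφ, (hiff hx).2 (hx'.trans (min_le_right _ _))⟩
      rw [hset, Real.volume_Ioc, sub_zero]
    · rw [Set.indicator_of_notMem hφ]
      have : (fun x => (x, φ)) ⁻¹' S = ∅ := Set.eq_empty_of_forall_notMem fun x hx => hφ hx.2.1
      rw [this, measure_empty]
  rw [h1] at h2
  simp_rw [e1, e2] at h2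
  rwa [lintegral_indicator measurableSet_Ioc, lintegral_indicator measurableSet_Ioc] at h2

theorem V_eq_integral {r : ℝ} (hr : 0 < r) :
    V r = 1 / Real.pi * ∫ φ in (0 : ℝ)..Real.pi, layerMass r φ := by
  rw [V, intervalIntegral.integral_of_le zero_le_one,
    intervalIntegral.integral_of_le Real.pi_pos.le, integral_eq_lintegral_of_nonneg_ae,
    integral_eq_lintegral_of_nonneg_ae, lintegral_layers hr]
  · exact Eventually.of_forall fun φ => layerMass_nonneg r φ
  · exact (continuous_layerMass.comp (Continuous.prodMk_right r)).aestronglyMeasurable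
  · exact Eventually.of_forall fun φ => Real.arccos_nonneg _
  · refine Measurable.aestronglyMeasurable ?_
    exact Real.continuous_arccos.measurable.comp (by fun_prop)

/-- The derivative of `layerMass · φ`, away from the angle where the minimum changes sides. -/
def layerMassDeriv (r φ : ℝ) : ℝ :=
  if 1 < busemannExp r φ then
    -(1 / 2) * busemannExp r φ ^ (-(1 / 2) - 1 : ℝ) * (Real.sinh r - Real.cosh r * Real.cos φ)
  else 0

theorem hasDerivAt_rpow_busemannExp (r φ : ℝ) :
    HasDerivAt (fun r => busemannExp r φ ^ (-(1 / 2) : ℝ)) (-(1 / 2) *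
      busemannExp r φ ^ (-(1 / 2) - 1 : ℝ) * (Real.sinh r - Real.cosh r * Real.cos φ)) r := by
  have := (hasDerivAt_busemannExp r φ).rpow_const (p := (-(1 / 2) : ℝ))
    (Or.inl (busemannExp_pos r φ).ne')
  convert this using 1
  ring

theorem hasDerivAt_layerMass {r φ : ℝ} (h : busemannExp r φ ≠ 1) :
    HasDerivAt (fun r => layerMass r φ) (layerMassDeriv r φ) r := by
  have hcont : ContinuousAt (fun r => busemannExp r φ) r :=
    (hasDerivAt_busemannExp r φ).continuousAt
  rcases lt_or_gt_of_ne h with hlt | hgt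
  · rw [layerMassDeriv, if_neg hlt.le.not_gt]
    refine (hasDerivAt_const r (1 : ℝ)).congr_of_eventuallyEq ?_
    filter_upwards [hcont.eventually_lt_const hlt] with s hs
    exact min_eq_left (Real.one_le_rpow_of_pos_of_le_one_of_nonpos (busemannExp_pos s φ) hs.le
      (by norm_num))
  · rw [layerMassDeriv, if_pos hgt]
    refine (hasDerivAt_rpow_busemannExp r φ).congr_of_eventuallyEq ?_
    filter_upwards [hcont.eventually_const_lt hgt] with s hs
    exact min_eq_right (Real.rpow_le_one_of_one_le_of_nonpos hs.le (by norm_num))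

theorem layerMassDeriv_nonpos {r : ℝ} (hr : 0 < r) (φ : ℝ) : layerMassDeriv r φ ≤ 0 := by
  unfold layerMassDeriv
  split_ifs with h
  · have h1 := deriv_busemannExp_pos hr h
    have h2 : 0 ≤ busemannExp r φ ^ (-(1 / 2) - 1 : ℝ) :=
      Real.rpow_nonneg (busemannExp_pos r φ).le _
    nlinarith [mul_nonneg h2 h1.le]
  · exact le_rfl

/-- The Lipschitz bound is uniform in the angle, which allows differentiation under the integral. -/
theorem lipschitzOnWith_layerMass (r₀ φ : ℝ) :
    LipschitzOnWith (Real.toNNReal (Real.exp (|r₀| + 1))) (fun r => layerMass r φ)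
      (Metric.ball r₀ 1) := by
  have h1 : LipschitzOnWith (Real.toNNReal (Real.exp (|r₀| + 1)))
      (fun r => busemannExp r φ ^ (-(1 / 2) : ℝ)) (Metric.ball r₀ 1) := by
    refine (convex_ball r₀ 1).lipschitzOnWith_of_nnnorm_hasDerivWithin_le
      (fun r _ => (hasDerivAt_rpow_busemannExp r φ).hasDerivWithinAt) fun r hr => ?_
    rw [← NNReal.coe_le_coe, coe_nnnorm, Real.coe_toNNReal _ (Real.exp_pos _).le, norm_mul,
      norm_mul]
    have hK := busemannExp_pos r φ
    have h2 : ‖Real.sinh r - Real.cosh r * Real.cos φ‖ ≤ busemannExp r φ :=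
      abs_deriv_busemannExp_le r φ
    have h3 : ‖busemannExp r φ ^ (-(1 / 2) - 1 : ℝ)‖ = busemannExp r φ ^ (-(1 / 2) - 1 : ℝ) :=
      Real.norm_of_nonneg (Real.rpow_nonneg hK.le _)
    have hr' : |r| ≤ |r₀| + 1 := by
      have : |r - r₀| < 1 := hr
      have h4 := abs_sub_abs_le_abs_sub r r₀
      linarith
    have h5 : busemannExp r φ ^ (-(1 / 2) : ℝ) ≤ Real.exp (|r₀| + 1) := by
      have h6 : busemannExp r φ ^ (-(1 / 2) : ℝ) ≤ Real.exp (-|r|) ^ (-(1 / 2) : ℝ) :=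
        Real.rpow_le_rpow_of_nonpos (Real.exp_pos _) (exp_neg_abs_le_busemannExp r φ) (by norm_num)
      refine h6.trans ?_
      rw [← Real.exp_mul, Real.exp_le_exp]
      nlinarith [abs_nonneg r]
    have h7 : busemannExp r φ ^ (-(1 / 2) - 1 : ℝ) * busemannExp r φ =
        busemannExp r φ ^ (-(1 / 2) : ℝ) := by
      rw [Real.rpow_sub_one hK.ne']
      field_simp
    rw [h3]
    have h8 : ‖(-(1 / 2) : ℝ)‖ = 1 / 2 := by norm_num
    rw [h8]
    calc 1 / 2 * busemannExp r φ ^ (-(1 / 2) - 1 : ℝ) * ‖Real.sinh r - Real.cosh r * Real.cos φ‖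
        ≤ 1 / 2 * busemannExp r φ ^ (-(1 / 2) - 1 : ℝ) * busemannExp r φ :=
          mul_le_mul_of_nonneg_left h2 (by rw [← h3]; positivity)
      _ = 1 / 2 * busemannExp r φ ^ (-(1 / 2) : ℝ) := by rw [mul_assoc, h7]
      _ ≤ Real.exp (|r₀| + 1) := by linarith [Real.exp_pos (|r₀| + 1)]
  refine LipschitzOnWith.of_dist_le_mul fun x hx y hy => (le_trans ?_ (h1.dist_le_mul x hx y hy))
  rw [Real.dist_eq, Real.dist_eq]
  refine (abs_min_sub_min_le_max 1 (busemannExp x φ ^ (-(1 / 2) : ℝ)) 1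
    (busemannExp y φ ^ (-(1 / 2) : ℝ))).trans ?_
  simp

theorem ae_busemannExp_ne_one {r : ℝ} (hr : 0 < r) :
    ∀ᵐ φ, φ ∈ Set.Ioc 0 Real.pi → busemannExp r φ ≠ 1 := by
  have hs := Real.sinh_pos_iff.2 hr
  have hsub : {φ | ¬ (φ ∈ Set.Ioc 0 Real.pi → busemannExp r φ ≠ 1)}.Subsingleton := by
    intro φ hφ ψ hψ
    simp only [Set.mem_ofPred_eq, not_forall, not_not] at hφ hψ
    obtain ⟨hφ1, hφ2⟩ := hφ
    obtain ⟨hψ1, hψ2⟩ := hψ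
    refine Real.injOn_cos (Set.Ioc_subset_Icc_self hφ1) (Set.Ioc_subset_Icc_self hψ1) ?_
    unfold busemannExp at hφ2 hψ2
    have : Real.sinh r * Real.cos φ = Real.sinh r * Real.cos ψ := by linarith
    exact mul_left_cancel₀ hs.ne' this
  exact hsub.measure_zero volume

theorem measurable_layerMassDeriv (r : ℝ) : Measurable (layerMassDeriv r) := by
  unfold layerMassDeriv
  have hK : Measurable (busemannExp r) := (continuous_busemannExp.comp
    (Continuous.prodMk_right r)).measurable
  refine Measurable.ite (measurableSet_lt measurable_const hK) ?_ measurable_const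
  exact (measurable_const.mul (hK.pow_const _)).mul (by fun_prop)

theorem hasDerivAt_integral_layerMass {r : ℝ} (hr : 0 < r) :
    IntervalIntegrable (layerMassDeriv r) volume 0 Real.pi ∧
    HasDerivAt (fun r => ∫ φ in (0 : ℝ)..Real.pi, layerMass r φ)
      (∫ φ in (0 : ℝ)..Real.pi, layerMassDeriv r φ) r := by
  have hcont : ∀ r, Continuous (layerMass r) := fun r =>
    continuous_layerMass.comp (Continuous.prodMk_right r)
  refine intervalIntegral.hasDerivAt_integral_of_dominated_loc_of_lip
    (bound := fun _ => Real.exp (|r| + 1)) (Metric.ball_mem_nhds r one_pos)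
    (Eventually.of_forall fun r => (hcont r).aestronglyMeasurable)
    ((hcont r).intervalIntegrable _ _) (measurable_layerMassDeriv r).aestronglyMeasurable
    (Eventually.of_forall fun φ _ => ?_) intervalIntegrable_const ?_
  · rw [Real.nnabs_of_nonneg (Real.exp_pos _).le]
    exact lipschitzOnWith_layerMass r φ
  · filter_upwards [ae_busemannExp_ne_one hr] with φ hφ hφ'
    rw [Set.uIoc_of_le Real.pi_pos.le] at hφ'
    exact hasDerivAt_layerMass (hφ hφ')

theorem integral_layerMassDeriv_neg {r : ℝ} (hr : 0 < r) :
    ∫ φ in (0 : ℝ)..Real.pi, layerMassDeriv r φ < 0 := by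
  have hint := (hasDerivAt_integral_layerMass hr).1
  rw [intervalIntegrable_iff_integrableOn_Ioc_of_le Real.pi_pos.le] at hint
  rw [intervalIntegral.integral_of_le Real.pi_pos.le, ← neg_pos, ← integral_neg]
  rw [setIntegral_pos_iff_support_of_nonneg_ae
    (Eventually.of_forall fun φ => neg_nonneg.2 (layerMassDeriv_nonpos hr φ)) hint.neg]
  have hsub : Set.Ioo (Real.pi / 2) Real.pi ⊆
      (Function.support fun φ => -layerMassDeriv r φ) ∩ Set.Ioc 0 Real.pi := by
    intro φ hφ
    have hπ := Real.pi_pos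
    refine ⟨?_, by linarith [hφ.1], hφ.2.le⟩
    have hcos : Real.cos φ < 0 := Real.cos_neg_of_pi_div_two_lt_of_lt hφ.1 (by linarith [hφ.2])
    have hK : 1 < busemannExp r φ := by
      unfold busemannExp
      nlinarith [Real.sinh_pos_iff.2 hr, Real.one_lt_cosh.2 hr.ne']
    have h1 := deriv_busemannExp_pos hr hK
    have h2 : 0 < busemannExp r φ ^ (-(1 / 2) - 1 : ℝ) :=
      Real.rpow_pos_of_pos (busemannExp_pos r φ) _
    rw [Function.mem_support, layerMassDeriv, if_pos hK]
    have h3 := mul_pos h2 h1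
    intro h
    nlinarith
  refine lt_of_lt_of_le ?_ (measure_mono hsub)
  rw [Real.volume_Ioo, ENNReal.ofReal_pos]
  linarith [Real.pi_pos]

theorem exists_hasDerivAt_V {r : ℝ} (hr : 0 < r) : ∃ v < 0, HasDerivAt V v r := by
  refine ⟨1 / Real.pi * ∫ φ in (0 : ℝ)..Real.pi, layerMassDeriv r φ, ?_, ?_⟩
  · exact mul_neg_of_pos_of_neg (by positivity) (integral_layerMassDeriv_neg hr)
  · refine ((hasDerivAt_integral_layerMass hr).2.const_mul (1 / Real.pi)).congr_of_eventuallyEq ?_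
    filter_upwards [Ioi_mem_nhds hr] with s hs
    exact V_eq_integral hs

theorem strictAntiOn_V : StrictAntiOn V (Set.Ioi 0) := by
  refine strictAntiOn_of_deriv_neg (convex_Ioi 0) (fun r hr => ?_) fun r hr => ?_
  · obtain ⟨v, -, hv⟩ := exists_hasDerivAt_V hr
    exact hv.continuousAt.continuousWithinAt
  · rw [interior_Ioi] at hr
    obtain ⟨v, hv0, hv⟩ := exists_hasDerivAt_V hr
    rwa [hv.deriv]

theorem tendsto_integral_layerMass {l : Filter ℝ} [l.IsCountablyGenerated] {f : ℝ → ℝ}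
    (h : ∀ φ ∈ Set.Ioc 0 Real.pi, Tendsto (fun r => layerMass r φ) l (𝓝 (f φ))) :
    Tendsto (fun r => ∫ φ in (0 : ℝ)..Real.pi, layerMass r φ) l
      (𝓝 (∫ φ in (0 : ℝ)..Real.pi, f φ)) := by
  refine intervalIntegral.tendsto_integral_filter_of_dominated_convergence (fun _ => 1)
    (Eventually.of_forall fun r =>
      (continuous_layerMass.comp (Continuous.prodMk_right r)).aestronglyMeasurable)
    (Eventually.of_forall fun r => Eventually.of_forall fun φ _ => ?_) intervalIntegrable_const
    (Eventually.of_forall fun φ hφ => ?_)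
  · rw [Real.norm_of_nonneg (layerMass_nonneg r φ)]
    exact layerMass_le_one r φ
  · rw [Set.uIoc_of_le Real.pi_pos.le] at hφ
    exact h φ hφ

theorem tendsto_V_zero : Tendsto V (𝓝[>] 0) (𝓝 1) := by
  have h1 : Tendsto (fun r => ∫ φ in (0 : ℝ)..Real.pi, layerMass r φ) (𝓝[>] 0)
      (𝓝 (∫ φ in (0 : ℝ)..Real.pi, (1 : ℝ))) := by
    refine tendsto_integral_layerMass fun φ _ => ?_
    have h2 : Tendsto (fun r => layerMass r φ) (𝓝 0) (𝓝 (layerMass 0 φ)) :=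
      (continuous_layerMass.comp (Continuous.prodMk_left φ)).tendsto 0
    have h3 : layerMass 0 φ = 1 := by simp [layerMass, busemannExp]
    rw [h3] at h2
    exact h2.mono_left nhdsWithin_le_nhds
  have h4 := h1.const_mul (1 / Real.pi)
  have h5 : 1 / Real.pi * ∫ φ in (0 : ℝ)..Real.pi, (1 : ℝ) = 1 := by
    simp [Real.pi_ne_zero]
  rw [h5] at h4
  refine h4.congr' ?_
  filter_upwards [self_mem_nhdsWithin] with r hr
  exact (V_eq_integral hr).symm

theorem tendsto_V_atTop : Tendsto V atTop (𝓝 0) := by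
  have h1 : Tendsto (fun r => ∫ φ in (0 : ℝ)..Real.pi, layerMass r φ) atTop
      (𝓝 (∫ φ in (0 : ℝ)..Real.pi, (0 : ℝ))) := by
    refine tendsto_integral_layerMass fun φ hφ => ?_
    have hcos : Real.cos φ < 1 := by
      rw [← Real.cos_zero]
      exact Real.strictAntiOn_cos ⟨le_rfl, Real.pi_pos.le⟩ ⟨hφ.1.le, hφ.2⟩ hφ.1
    have hK : Tendsto (fun r => busemannExp r φ) atTop atTop := by
      refine tendsto_atTop_mono (f := fun r => (1 - Real.cos φ) / 2 * Real.exp r) (fun r => ?_)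
        (Real.tendsto_exp_atTop.const_mul_atTop (by linarith))
      rw [busemannExp_eq]
      have := mul_nonneg (by linarith [Real.neg_one_le_cos φ] : 0 ≤ (1 + Real.cos φ) / 2)
        (Real.exp_pos (-r)).le
      linarith
    have h2 := (tendsto_rpow_neg_atTop (by norm_num : (0 : ℝ) < 1 / 2)).comp hK
    refine squeeze_zero (fun r => layerMass_nonneg r φ) (fun r => min_le_right _ _) h2
  have h4 := h1.const_mul (1 / Real.pi)
  simp only [intervalIntegral.integral_zero, mul_zero] at h4
  refine h4.congr' ?_
  filter_upwards [eventually_gt_atTop 0] with r hr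
  exact (V_eq_integral hr).symm

theorem bijOn_V : Set.BijOn V (Set.Ioi 0) (Set.Ioo 0 1) := by
  refine ⟨fun r hr => ⟨?_, ?_⟩, strictAntiOn_V.injOn, fun y hy => ?_⟩
  · have hr0 : (0 : ℝ) < r := hr
    have h1 : V (r + 1) < V r := strictAntiOn_V hr (by simp; linarith) (by linarith)
    refine lt_of_le_of_lt (le_of_tendsto tendsto_V_atTop ?_) h1
    filter_upwards [eventually_gt_atTop (r + 1)] with s hs
    exact (strictAntiOn_V (by simp; linarith) (by simp; linarith) hs).le
  · have hr0 : (0 : ℝ) < r := hr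
    have h1 : V r < V (r / 2) := strictAntiOn_V (by simp; linarith) hr (by linarith)
    refine lt_of_lt_of_le h1 (ge_of_tendsto tendsto_V_zero ?_)
    filter_upwards [Ioo_mem_nhdsGT (half_pos hr0)] with s hs
    exact (strictAntiOn_V hs.1 (half_pos hr0) hs.2).le
  · obtain ⟨r₁, hr₁, hr₁0⟩ :=
      ((tendsto_V_zero.eventually_const_lt hy.2).and self_mem_nhdsWithin).exists
    obtain ⟨r₂, hr₂, hr₂1⟩ :=
      ((tendsto_V_atTop.eventually_lt_const hy.1).and (eventually_gt_atTop r₁)).exists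
    have hr₁0 : (0 : ℝ) < r₁ := hr₁0
    have hcont : ContinuousOn V (Set.Icc r₁ r₂) := by
      intro r hr
      obtain ⟨v, -, hv⟩ := exists_hasDerivAt_V (hr₁0.trans_le hr.1)
      exact hv.continuousAt.continuousWithinAt
    obtain ⟨r, hr, rfl⟩ := intermediate_value_Icc' hr₂1.le hcont ⟨hr₂.le, hr₁.le⟩
    exact ⟨r, hr₁0.trans_le hr.1, rfl⟩

theorem Vinv_pos {y : ℝ} (hy : y ∈ Set.Ioo (0 : ℝ) 1) : 0 < Vinv y :=
  Function.invFunOn_mem (bijOn_V.surjOn hy)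

theorem V_Vinv {y : ℝ} (hy : y ∈ Set.Ioo (0 : ℝ) 1) : V (Vinv y) = y :=
  Function.invFunOn_eq (bijOn_V.surjOn hy)

theorem Vinv_V {r : ℝ} (hr : 0 < r) : Vinv (V r) = r :=
  bijOn_V.injOn (Vinv_pos (bijOn_V.mapsTo hr)) hr (V_Vinv (bijOn_V.mapsTo hr))

theorem strictAntiOn_Vinv : StrictAntiOn Vinv (Set.Ioo 0 1) := by
  intro x hx y hy hxy
  have := strictAntiOn_V.lt_iff_gt (Vinv_pos hx) (Vinv_pos hy)
  rw [V_Vinv hx, V_Vinv hy] at this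
  exact this.1 hxy

theorem hasDerivAt_Vinv {y : ℝ} (hy : y ∈ Set.Ioo (0 : ℝ) 1) : ∃ v, HasDerivAt Vinv v y := by
  obtain ⟨v, hv, hd⟩ := exists_hasDerivAt_V (Vinv_pos hy)
  have hmono : StrictMonoOn (fun y => -Vinv y) (Set.Ioo 0 1) :=
    fun x hx y hy hxy => neg_lt_neg (strictAntiOn_Vinv hx hy hxy)
  have himage : (fun y => -Vinv y) '' Set.Ioo 0 1 ∈ 𝓝 (-Vinv y) := by
    filter_upwards [Iio_mem_nhds (neg_neg_of_pos (Vinv_pos hy))] with x hx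
    have hx' : 0 < -x := neg_pos.2 hx
    exact ⟨V (-x), bijOn_V.mapsTo hx', by simp [Vinv_V hx']⟩
  have hcont : ContinuousAt Vinv y := by
    have := hmono.continuousAt_of_image_mem_nhds (Ioo_mem_nhds hy.1 hy.2) himage
    exact this.neg.congr (Eventually.of_forall fun x => neg_neg (Vinv x))
  refine ⟨v⁻¹, hd.of_local_left_inverse hcont hv.ne ?_⟩
  filter_upwards [Ioo_mem_nhds hy.1 hy.2] with x hx
  exact V_Vinv hx

theorem differentiableOn_Vinv : DifferentiableOn ℝ Vinv (Set.Ioo 0 1) := by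
  intro y hy
  obtain ⟨v, hv⟩ := hasDerivAt_Vinv hy
  exact hv.differentiableAt.differentiableWithinAt

/-! ### Hyperbolic geometry of a node -/

/-- The hyperbolic law of cosines. -/
theorem hypDist_polar_le_iff {r s φ ψ R : ℝ} (hR : 0 ≤ R) :
    hypDist (polar (r, φ)) (polar (s, ψ)) ≤ R ↔
      Real.cosh r * Real.cosh s - Real.sinh r * Real.sinh s * Real.cos (φ - ψ) ≤ Real.cosh R := by
  have hnorm : ∀ r φ : ℝ, ‖((polar (r, φ) : Disc) : ℂ)‖ ^ 2 = Real.tanh (r / 2) ^ 2 := by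
    intro r φ
    simp only [polar, Complex.UnitDisc.coe_mk]
    rw [norm_mul, Complex.norm_exp_ofReal_mul_I, mul_one, Complex.norm_real, Real.norm_eq_abs,
      sq_abs]
  have hsub : ‖((polar (r, φ) : Disc) : ℂ) - (polar (s, ψ) : Disc)‖ ^ 2 =
      Real.tanh (r / 2) ^ 2 + Real.tanh (s / 2) ^ 2 -
        2 * Real.tanh (r / 2) * Real.tanh (s / 2) * Real.cos (φ - ψ) := by
    simp only [polar, Complex.UnitDisc.coe_mk]
    rw [← Complex.normSq_eq_norm_sq, Complex.normSq_apply, Real.cos_sub]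
    simp only [Complex.sub_re, Complex.sub_im, Complex.re_ofReal_mul, Complex.im_ofReal_mul,
      Complex.exp_ofReal_mul_I_re, Complex.exp_ofReal_mul_I_im]
    linear_combination Real.tanh (r / 2) ^ 2 * Real.sin_sq_add_cos_sq φ +
      Real.tanh (s / 2) ^ 2 * Real.sin_sq_add_cos_sq ψ
  have harg : 1 + 2 * ‖((polar (r, φ) : Disc) : ℂ) - (polar (s, ψ) : Disc)‖ ^ 2 /
      ((1 - ‖((polar (r, φ) : Disc) : ℂ)‖ ^ 2) * (1 - ‖((polar (s, ψ) : Disc) : ℂ)‖ ^ 2)) =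
      Real.cosh r * Real.cosh s - Real.sinh r * Real.sinh s * Real.cos (φ - ψ) := by
    rw [hnorm, hnorm, hsub]
    have h1 : ∀ x : ℝ, 1 - Real.tanh x ^ 2 = (Real.cosh x ^ 2)⁻¹ := by
      intro x
      have hc := Real.cosh_pos x
      have := Real.cosh_sq x
      rw [Real.tanh_eq_sinh_div_cosh]
      field_simp
      linarith
    rw [h1, h1]
    have hr := Real.cosh_pos (r / 2)
    have hs := Real.cosh_pos (s / 2)
    have e1 : Real.cosh r = Real.cosh (r / 2) ^ 2 + Real.sinh (r / 2) ^ 2 := by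
      rw [← Real.cosh_two_mul]
      ring_nf
    have e2 : Real.cosh s = Real.cosh (s / 2) ^ 2 + Real.sinh (s / 2) ^ 2 := by
      rw [← Real.cosh_two_mul]
      ring_nf
    have e3 : Real.sinh r = 2 * Real.sinh (r / 2) * Real.cosh (r / 2) := by
      rw [← Real.sinh_two_mul]
      ring_nf
    have e4 : Real.sinh s = 2 * Real.sinh (s / 2) * Real.cosh (s / 2) := by
      rw [← Real.sinh_two_mul]
      ring_nf
    rw [e1, e2, e3, e4, Real.tanh_eq_sinh_div_cosh, Real.tanh_eq_sinh_div_cosh]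
    have q1 := Real.cosh_sq (r / 2)
    have q2 := Real.cosh_sq (s / 2)
    set A := Real.cosh (r / 2)
    set B := Real.cosh (s / 2)
    set a := Real.sinh (r / 2)
    set b := Real.sinh (s / 2)
    field_simp
    linear_combination (-(B ^ 2 - b ^ 2)) * q1 - q2
  unfold hypDist
  have hpos : 0 < Real.cosh r * Real.cosh s - Real.sinh r * Real.sinh s * Real.cos (φ - ψ) := by
    rw [← harg]
    have h1 : ∀ z : Disc, 0 < 1 - ‖(z : ℂ)‖ ^ 2 := fun z => by
      have := z.norm_lt_one
      have h0 := norm_nonneg (z : ℂ)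
      nlinarith
    have h2 := mul_pos (h1 (polar (r, φ))) (h1 (polar (s, ψ)))
    positivity
  rw [harg]
  conv_lhs => rw [← Real.arcosh_cosh hR]
  exact Real.arcosh_le_arcosh hpos (Real.cosh_pos R)

theorem measurable_polar : Measurable polar := by
  refine Continuous.measurable ?_
  refine Complex.UnitDisc.isEmbedding_coe.continuous_iff.2 ?_
  simp only [Function.comp_def, polar, Complex.UnitDisc.coe_mk]
  have : Continuous Real.tanh := by
    have : Real.tanh = fun x => Real.sinh x / Real.cosh x := by
      ext x
      exact Real.tanh_eq_sinh_div_cosh x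
    rw [this]
    exact Real.continuous_sinh.div Real.continuous_cosh fun x => (Real.cosh_pos x).ne'
  fun_prop

/-- The pairs of points of the disc at distance at most `R`. -/
def closePairs (R : ℝ) : Set (Disc × Disc) := {p | hypDist p.1 p.2 ≤ R}

theorem measurableSet_closePairs (R : ℝ) : MeasurableSet (closePairs R) := by
  have hc : Measurable fun z : Disc => (z : ℂ) :=
    Complex.UnitDisc.isEmbedding_coe.continuous.measurable
  have h1 : Measurable fun p : Disc × Disc => (p.1 : ℂ) := hc.comp measurable_fst
  have h2 : Measurable fun p : Disc × Disc => (p.2 : ℂ) := hc.comp measurable_snd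
  refine measurableSet_le ?_ measurable_const
  unfold hypDist Real.arcosh
  refine Real.measurable_log.comp ?_
  fun_prop

/-- The law of the distance of a node to the origin, for a domain of radius `R`. -/
def radialLaw (α R : ℝ) : Measure ℝ := volume.withDensity fun r => ENNReal.ofReal
  (if 0 ≤ r ∧ r < R then α * Real.sinh (α * r) / (Real.cosh (α * R) - 1) else 0)

theorem nodeLaw_eq (α ν : ℝ) (n : ℕ) : nodeLaw α ν n = ((radialLaw α (diskRadius ν n)).prod
    (volume[|Set.Ioc (-Real.pi) Real.pi])).map polar := rfl

/-- The distribution function of `radialLaw` on `[0, R]`. -/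
def radialCdf (α R t : ℝ) : ℝ := (Real.cosh (α * t) - 1) / (Real.cosh (α * R) - 1)

section Radial

variable {α R : ℝ}

theorem cosh_sub_one_pos (hα : 0 < α) (hR : 0 < R) : 0 < Real.cosh (α * R) - 1 :=
  sub_pos.2 (Real.one_lt_cosh.2 (mul_pos hα hR).ne')

instance : NullSingletonClass (radialLaw α R) := by
  unfold radialLaw
  infer_instance

theorem radialLaw_eq (α R : ℝ) : radialLaw α R = volume.withDensity ((Set.Ioc 0 R).indicator
    fun r => ENNReal.ofReal (α * Real.sinh (α * r) / (Real.cosh (α * R) - 1))) := by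
  refine withDensity_congr_ae ?_
  filter_upwards [(measure_singleton R : volume {R} = 0) |> compl_mem_ae_iff.2] with r hr
  have hr' : r ≠ R := hr
  by_cases h : r ∈ Set.Ioc 0 R
  · rw [Set.indicator_of_mem h, if_pos ⟨h.1.le, lt_of_le_of_ne h.2 hr'⟩]
  · rw [Set.indicator_of_notMem h]
    split_ifs with h'
    · have : r = 0 := by
        by_contra h0
        exact h ⟨lt_of_le_of_ne h'.1 (Ne.symm h0), h'.2.le⟩
      simp [this]
    · simp

theorem radialLaw_apply_eq_zero {s : Set ℝ} (hs : MeasurableSet s) (h : Disjoint s (Set.Ioc 0 R)) :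
    radialLaw α R s = 0 := by
  rw [radialLaw_eq, withDensity_apply _ hs, setLIntegral_indicator measurableSet_Ioc,
    Set.inter_comm, h.inter_eq]
  simp

theorem radialLaw_Icc (hα : 0 < α) (hR : 0 < R) {t : ℝ} (ht : 0 ≤ t) (htR : t ≤ R) :
    radialLaw α R (Set.Icc 0 t) = ENNReal.ofReal (radialCdf α R t) := by
  have hD := cosh_sub_one_pos hα hR
  have hset : Set.Ioc 0 R ∩ Set.Icc 0 t = Set.Ioc 0 t := by
    ext x
    constructor
    · rintro ⟨h1, h2⟩
      exact ⟨h1.1, h2.2⟩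
    · rintro h
      exact ⟨⟨h.1, h.2.trans htR⟩, h.1.le, h.2⟩
  rw [radialLaw_eq, withDensity_apply _ measurableSet_Icc, setLIntegral_indicator measurableSet_Ioc,
    hset]
  have hcont : Continuous fun r => α * Real.sinh (α * r) / (Real.cosh (α * R) - 1) := by fun_prop
  rw [← ofReal_integral_eq_lintegral_ofReal hcont.integrableOn_Ioc]
  · congr 1
    rw [← intervalIntegral.integral_of_le ht, intervalIntegral.integral_eq_sub_of_hasDerivAt
      (f := radialCdf α R) (fun x _ => ?_) (hcont.intervalIntegrable _ _)]
    · simp [radialCdf]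
    · unfold radialCdf
      have h1 := ((Real.hasDerivAt_cosh (α * x)).comp x ((hasDerivAt_id x).const_mul α)).sub_const 1
      have e : α * Real.sinh (α * x) / (Real.cosh (α * R) - 1) =
          Real.sinh (α * x) * (α * 1) / (Real.cosh (α * R) - 1) := by ring
      rw [e]
      exact h1.div_const (Real.cosh (α * R) - 1)
  · refine (ae_restrict_iff' measurableSet_Ioc).2 (Eventually.of_forall fun r hr => ?_)
    have := Real.sinh_pos_iff.2 (mul_pos hα hr.1)
    change 0 ≤ _
    positivity

theorem isProbabilityMeasure_radialLaw (hα : 0 < α) (hR : 0 < R) :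
    IsProbabilityMeasure (radialLaw α R) := by
  refine ⟨?_⟩
  rw [← Set.union_compl_self (Set.Icc 0 R), measure_union disjoint_compl_right
    measurableSet_Icc.compl, radialLaw_Icc hα hR hR.le le_rfl, radialLaw_apply_eq_zero
    measurableSet_Icc.compl]
  · simp [radialCdf, (cosh_sub_one_pos hα hR).ne']
  · exact Set.disjoint_left.2 fun x hx hx' => hx (Set.Ioc_subset_Icc_self hx')

theorem ae_radialLaw (α R : ℝ) : ∀ᵐ r ∂(radialLaw α R), r ∈ Set.Ioo 0 R := by
  have h1 : radialLaw α R (Set.Ioo 0 R)ᶜ = 0 := by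
    have : (Set.Ioo 0 R)ᶜ ⊆ (Set.Ioc 0 R)ᶜ ∪ {R} := by
      intro x hx
      by_cases h : x = R
      · exact Or.inr h
      · exact Or.inl fun h' => hx ⟨h'.1, lt_of_le_of_ne h'.2 h⟩
    refine measure_mono_null this (measure_union_null
      (radialLaw_apply_eq_zero measurableSet_Ioc.compl disjoint_compl_left) (measure_singleton R))
  exact h1

theorem radialLaw_Iio (hα : 0 < α) (hR : 0 < R) {t : ℝ} (ht : 0 ≤ t) (htR : t ≤ R) :
    radialLaw α R (Set.Iio t) = ENNReal.ofReal (radialCdf α R t) := by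
  rw [← radialLaw_Icc hα hR ht htR]
  refine le_antisymm (measure_mono_ae ?_) ?_
  · filter_upwards [ae_radialLaw α R] with r hr hrt
    exact ⟨hr.1.le, le_of_lt hrt⟩
  · rw [measure_congr (Iio_ae_eq_Iic (μ := radialLaw α R) (a := t))]
    exact measure_mono fun r hr => hr.2

theorem le_radialLaw_real (hα : 0 < α) (hR : 0 < R) {t : ℝ} (ht : 0 ≤ t) (htR : t ≤ R) {S : Set ℝ}
    (hS : ∀ s, 0 < s → s < t → s ∈ S) : radialCdf α R t ≤ (radialLaw α R).real S := by
  have := isProbabilityMeasure_radialLaw hα hR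
  rw [measureReal_def, ← ENNReal.ofReal_le_iff_le_toReal (measure_ne_top _ _),
    ← radialLaw_Iio hα hR ht htR]
  refine measure_mono_ae ?_
  filter_upwards [ae_radialLaw α R] with r hr hrt
  exact hS r hr.1 hrt

theorem radialLaw_real_le (hα : 0 < α) (hR : 0 < R) {t : ℝ} (ht : 0 ≤ t) (htR : t ≤ R) {S : Set ℝ}
    (hS : ∀ s ∈ S, 0 < s → s < R → s ≤ t) : (radialLaw α R).real S ≤ radialCdf α R t := by
  have := isProbabilityMeasure_radialLaw hα hR
  have h0 : 0 ≤ radialCdf α R t :=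
    div_nonneg (sub_nonneg.2 (Real.one_le_cosh _)) (cosh_sub_one_pos hα hR).le
  rw [measureReal_def]
  refine ENNReal.toReal_le_of_le_ofReal h0 ?_
  rw [← radialLaw_Icc hα hR ht htR]
  refine measure_mono_ae ?_
  filter_upwards [ae_radialLaw α R] with r hr hrS
  exact ⟨hr.1.le, hS r hrS hr.1 hr.2⟩

end Radial

/-! ### The mass of a ball -/

/-- The mass, under the radial law, of the points in direction `ψ` at distance at most `R` of a node
at distance `r` of the origin. -/
def directionMass (α R r ψ : ℝ) : ℝ := (radialLaw α R).real
  {s | Real.cosh r * Real.cosh s - Real.sinh r * Real.sinh s * Real.cos ψ ≤ Real.cosh R}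

/-- The mass of the ball of radius `R` around a point at distance `r` of the origin. -/
def ballMass (α R r : ℝ) : ℝ :=
  1 / (2 * Real.pi) * ∫ ψ in (-Real.pi)..Real.pi, directionMass α R r ψ

section Ball

variable {α R : ℝ}

theorem measurableSet_ball (R : ℝ) (r : ℝ) : MeasurableSet {p : ℝ × ℝ |
    Real.cosh r * Real.cosh p.1 - Real.sinh r * Real.sinh p.1 * Real.cos p.2 ≤ Real.cosh R} := by
  have h : Continuous fun p : ℝ × ℝ =>
    Real.cosh r * Real.cosh p.1 - Real.sinh r * Real.sinh p.1 * Real.cos p.2 := by fun_prop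
  exact measurableSet_le h.measurable measurable_const

theorem measurable_directionMass (hα : 0 < α) (hR : 0 < R) (r : ℝ) :
    Measurable (directionMass α R r) := by
  have := isProbabilityMeasure_radialLaw hα hR
  exact (measurable_measure_prodMk_right (μ := radialLaw α R)
    (measurableSet_ball R r)).ennreal_toReal

theorem directionMass_nonneg (α R r ψ : ℝ) : 0 ≤ directionMass α R r ψ := measureReal_nonneg

theorem directionMass_le_one (hα : 0 < α) (hR : 0 < R) (r ψ : ℝ) : directionMass α R r ψ ≤ 1 := by
  have := isProbabilityMeasure_radialLaw hα hR
  exact measureReal_le_one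

theorem integrableOn_directionMass (hα : 0 < α) (hR : 0 < R) (r : ℝ) {s : Set ℝ}
    (hs : volume s ≠ ∞) : IntegrableOn (directionMass α R r) s := by
  have : IsFiniteMeasure (volume.restrict s) := ⟨by simpa using hs.lt_top⟩
  refine Integrable.of_bound (measurable_directionMass hα hR r).aestronglyMeasurable 1
    (Eventually.of_forall fun ψ => ?_)
  rw [Real.norm_of_nonneg (directionMass_nonneg _ _ _ _)]
  exact directionMass_le_one hα hR r ψ

/-- By rotational symmetry, the mass of a ball depends only on the radius of its centre. -/
theorem nodeLaw_ball {ν : ℝ} {n : ℕ} (hα : 0 < α) (hR : 0 < diskRadius ν n) (r φ : ℝ) :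
    (nodeLaw α ν n).real {w | (polar (r, φ), w) ∈ closePairs (diskRadius ν n)} =
      ballMass α (diskRadius ν n) r := by
  set R := diskRadius ν n
  have hprob := isProbabilityMeasure_radialLaw hα hR
  have hπ := Real.pi_pos
  have hm : MeasurableSet {w | (polar (r, φ), w) ∈ closePairs R} :=
    measurable_prodMk_left (measurableSet_closePairs R)
  rw [nodeLaw_eq, measureReal_def, Measure.map_apply measurable_polar hm,
    Measure.prod_apply_symm (measurable_polar hm), ProbabilityTheory.cond, lintegral_smul_measure]
  have hsec : ∀ ψ, (radialLaw α R) ((fun s => (s, ψ)) ⁻¹'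
      (polar ⁻¹' {w | (polar (r, φ), w) ∈ closePairs R})) =
      ENNReal.ofReal (directionMass α R r (φ - ψ)) := by
    intro ψ
    rw [directionMass, measureReal_def, ENNReal.ofReal_toReal (measure_ne_top _ _)]
    congr 1
    ext s
    exact hypDist_polar_le_iff hR.le
  rw [lintegral_congr hsec]
  have hvol : volume (Set.Ioc (-Real.pi) Real.pi) = ENNReal.ofReal (2 * Real.pi) := by
    rw [Real.volume_Ioc]
    ring_nf
  have hmd := measurable_directionMass hα hR r
  have hint : IntegrableOn (fun ψ => directionMass α R r (φ - ψ)) (Set.Ioc (-Real.pi) Real.pi) := by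
    refine Integrable.of_bound
      (hmd.comp (measurable_const.sub measurable_id)).aestronglyMeasurable 1
      (Eventually.of_forall fun ψ => ?_)
    rw [Real.norm_of_nonneg (directionMass_nonneg _ _ _ _)]
    exact directionMass_le_one hα hR r _
  rw [← ofReal_integral_eq_lintegral_ofReal hint
    (Eventually.of_forall fun ψ => directionMass_nonneg _ _ _ _), hvol, smul_eq_mul,
    ENNReal.toReal_mul, ENNReal.toReal_inv, ENNReal.toReal_ofReal (by positivity),
    ENNReal.toReal_ofReal (integral_nonneg fun ψ => directionMass_nonneg _ _ _ _),
    ← intervalIntegral.integral_of_le (by linarith), ballMass, one_div]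
  congr 1
  have hper : Function.Periodic (directionMass α R r) (2 * Real.pi) := by
    intro ψ
    simp only [directionMass, Real.cos_add_two_pi]
  rw [intervalIntegral.integral_comp_sub_left (fun x => directionMass α R r x)]
  have := hper.intervalIntegral_add_eq (φ - Real.pi) (-Real.pi)
  convert this using 2 <;> ring

theorem nodeLaw_radial {ν : ℝ} {n : ℕ} {A : Set Disc} (hA : MeasurableSet A) {B : Set ℝ}
    (h : ∀ r φ, polar (r, φ) ∈ A ↔ r ∈ B) :
    (nodeLaw α ν n).real A = (radialLaw α (diskRadius ν n)).real B := by
  have hset : polar ⁻¹' A = B ×ˢ Set.univ := by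
    ext ⟨r, φ⟩
    simp [h]
  have hprob : IsProbabilityMeasure (volume[|Set.Ioc (-Real.pi) Real.pi]) := by
    refine cond_isProbabilityMeasure_of_finite ?_ ?_ <;> simp [Real.volume_Ioc, Real.pi_pos]
  rw [nodeLaw_eq, measureReal_def, Measure.map_apply measurable_polar hA, hset, Measure.prod_prod,
    measure_univ, mul_one, measureReal_def]

/-- The closer a node is to the origin, the more neighbours it has on average. -/
theorem antitoneOn_ballMass (hα : 0 < α) (hR : 0 < R) : AntitoneOn (ballMass α R) (Set.Ici 0) := by
  have hprob := isProbabilityMeasure_radialLaw hα hR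
  intro r hr r' hr' hrr'
  have hr0 : (0 : ℝ) ≤ r := hr
  have hπ := Real.pi_pos
  refine mul_le_mul_of_nonneg_left ?_ (by positivity)
  refine intervalIntegral.integral_mono (by linarith) ?_ ?_ fun ψ => ?_
  · exact (intervalIntegrable_iff_integrableOn_Ioc_of_le (by linarith)).2
      (integrableOn_directionMass hα hR r' (by simp))
  · exact (intervalIntegrable_iff_integrableOn_Ioc_of_le (by linarith)).2
      (integrableOn_directionMass hα hR r (by simp))
  · refine ENNReal.toReal_mono (measure_ne_top _ _) (measure_mono_ae ?_)
    filter_upwards [ae_radialLaw α R] with s hs hs'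
    have h0 : Real.cosh s ≤ Real.cosh R := by
      rw [Real.cosh_le_cosh, abs_of_pos hs.1, abs_of_pos hR]
      exact hs.2.le
    -- a convex function of the radius that is at most `cosh R` at `0` and at `r'` is so between
    have hexp : ∀ x, Real.cosh x * Real.cosh s - Real.sinh x * Real.sinh s * Real.cos ψ =
        (Real.cosh s - Real.sinh s * Real.cos ψ) / 2 * Real.exp x +
        (Real.cosh s + Real.sinh s * Real.cos ψ) / 2 * (Real.exp x)⁻¹ := by
      intro x
      rw [Real.cosh_eq x, Real.sinh_eq x, Real.exp_neg]
      ring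
    have ha : 0 < (Real.cosh s - Real.sinh s * Real.cos ψ) / 2 :=
      half_pos (busemannExp_pos s ψ)
    have h1 : (Real.cosh s - Real.sinh s * Real.cos ψ) / 2 +
        (Real.cosh s + Real.sinh s * Real.cos ψ) / 2 ≤ Real.cosh R := by linarith
    have h2 : Real.cosh r' * Real.cosh s - Real.sinh r' * Real.sinh s * Real.cos ψ ≤
      Real.cosh R := hs'
    change Real.cosh r * Real.cosh s - Real.sinh r * Real.sinh s * Real.cos ψ ≤ Real.cosh R
    rw [hexp] at h2 ⊢
    have hx1 : 1 ≤ Real.exp r := Real.one_le_exp hr0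
    have hxy : Real.exp r ≤ Real.exp r' := Real.exp_le_exp.2 hrr'
    set a := (Real.cosh s - Real.sinh s * Real.cos ψ) / 2
    set b := (Real.cosh s + Real.sinh s * Real.cos ψ) / 2
    set x := Real.exp r
    set y := Real.exp r'
    have hx0 : 0 < x := by linarith
    have hy0 : 0 < y := by linarith
    have h2' : a * y ^ 2 + b ≤ Real.cosh R * y := by
      have := mul_le_mul_of_nonneg_right h2 hy0.le
      rw [add_mul, mul_assoc b, inv_mul_cancel₀ hy0.ne'] at this
      nlinarith
    suffices h3 : a * x ^ 2 + b ≤ Real.cosh R * x by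
      have : (a * x + b * x⁻¹) * x ≤ Real.cosh R * x := by
        rw [add_mul, mul_assoc b, inv_mul_cancel₀ hx0.ne']
        nlinarith
      exact le_of_mul_le_mul_right this hx0
    rcases hxy.eq_or_lt with h | h
    · rw [h]
      exact h2'
    · have hy1 : 0 < y - 1 := by linarith
      have key : (y - 1) * (a * x ^ 2 + b - Real.cosh R * x) =
          (y - x) * (a + b - Real.cosh R) + (x - 1) * (a * y ^ 2 + b - Real.cosh R * y) -
            a * (y - 1) * (x - 1) * (y - x) := by ring
      have k1 : (y - x) * (a + b - Real.cosh R) ≤ 0 :=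
        mul_nonpos_of_nonneg_of_nonpos (by linarith) (by linarith)
      have k2 : (x - 1) * (a * y ^ 2 + b - Real.cosh R * y) ≤ 0 :=
        mul_nonpos_of_nonneg_of_nonpos (by linarith) (by linarith)
      have k3 : 0 ≤ a * (y - 1) * (x - 1) * (y - x) :=
        mul_nonneg (mul_nonneg (mul_nonneg ha.le hy1.le) (by linarith)) (by linarith)
      by_contra hcon
      have k4 : 0 < (y - 1) * (a * x ^ 2 + b - Real.cosh R * x) :=
        mul_pos hy1 (by linarith [not_le.1 hcon])
      linarith

end Ball

/-! ### Estimates of the mass of a ball -/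

section Estimates

variable {α R : ℝ}

theorem radialCdf_sub_le (hα : 0 < α) (hR : 0 < R) {v : ℝ} (hv : 0 ≤ v) (hvR : v ≤ R) :
    radialCdf α R (R - v) ≤ Real.exp (-(α * v)) := by
  have hD := cosh_sub_one_pos hα hR
  rw [radialCdf, div_le_iff₀ hD, mul_sub, Real.cosh_eq, Real.cosh_eq,
    show α * R - α * v = α * R + -(α * v) by ring, neg_add, neg_neg, Real.exp_add, Real.exp_add,
    Real.exp_neg (α * R), Real.exp_neg (α * v)]
  have hx : 1 ≤ Real.exp (α * v) := Real.one_le_exp (by positivity)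
  have hxy : Real.exp (α * v) ≤ Real.exp (α * R) := Real.exp_le_exp.2 (by gcongr)
  set x := Real.exp (α * v)
  set y := Real.exp (α * R)
  have hx0 : 0 < x := by linarith
  have hy0 : 0 < y := by linarith
  have key : x⁻¹ * ((y + y⁻¹) / 2) - x⁻¹ * 1 - ((y * x⁻¹ + y⁻¹ * x) / 2 - 1) =
      (x - 1) * (2 * y - x - 1) / (2 * x * y) := by
    field_simp
    ring
  have : 0 ≤ (x - 1) * (2 * y - x - 1) / (2 * x * y) :=
    div_nonneg (mul_nonneg (by linarith) (by linarith)) (by positivity)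
  linarith

theorem exp_sub_le_radialCdf_sub (hα : 0 < α) (hR : 0 < R) {v : ℝ} (hv : 0 ≤ v) :
    Real.exp (-(α * v)) - 1 / (Real.cosh (α * R) - 1) ≤ radialCdf α R (max 0 (R - v)) := by
  have hD := cosh_sub_one_pos hα hR
  have hx : 1 ≤ Real.exp (α * v) := Real.one_le_exp (by positivity)
  have hy : 1 ≤ Real.exp (α * R) := Real.one_le_exp (by positivity)
  have hc : Real.cosh (α * R) = (Real.exp (α * R) + (Real.exp (α * R))⁻¹) / 2 := by
    rw [Real.cosh_eq, Real.exp_neg]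
  rcases le_total v R with h | h
  · rw [max_eq_right (by linarith), radialCdf, le_div_iff₀ hD, sub_mul,
      div_mul_cancel₀ _ hD.ne', hc, Real.cosh_eq,
      show α * (R - v) = α * R + -(α * v) by ring, neg_add, neg_neg, Real.exp_add, Real.exp_add,
      Real.exp_neg (α * R), Real.exp_neg (α * v)]
    set x := Real.exp (α * v)
    set y := Real.exp (α * R)
    have hx0 : 0 < x := by linarith
    have hy0 : 0 < y := by linarith
    have key : x⁻¹ * ((y + y⁻¹) / 2 - 1) - 1 - ((y * x⁻¹ + y⁻¹ * x) / 2 - 1) =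
        -((x ^ 2 + (2 * y - 1)) / (2 * x * y)) := by
      field_simp
      ring
    have : 0 ≤ (x ^ 2 + (2 * y - 1)) / (2 * x * y) :=
      div_nonneg (by nlinarith) (by positivity)
    linarith
  · rw [max_eq_left (by linarith), radialCdf, mul_zero, Real.cosh_zero, sub_self, zero_div,
      sub_nonpos, le_div_iff₀ hD]
    calc Real.exp (-(α * v)) * (Real.cosh (α * R) - 1)
        ≤ Real.exp (-(α * R)) * Real.exp (α * R) := by
          refine mul_le_mul (Real.exp_le_exp.2 ?_) ?_ hD.le (Real.exp_pos _).le
          · nlinarith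
          · rw [hc]
            have := inv_le_one_of_one_le₀ hy
            linarith
      _ = 1 := by rw [← Real.exp_add, neg_add_cancel, Real.exp_zero]

theorem one_sub_le_radialCdf_sub (hα : 0 < α) (hR : 0 < R) {v : ℝ} :
    1 - α * v * (Real.sinh (α * R) / (Real.cosh (α * R) - 1)) ≤
      radialCdf α R (max 0 (R - v)) := by
  have hD := cosh_sub_one_pos hα hR
  -- convexity of `cosh`
  have hconv : ∀ y u : ℝ, Real.cosh y - Real.cosh (y - u) ≤ Real.sinh y * u := by
    intro y u
    rw [Real.cosh_eq, Real.cosh_eq, Real.sinh_eq, neg_sub, Real.exp_sub, sub_eq_add_neg u y,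
      Real.exp_add]
    have h2 := Real.add_one_le_exp u
    have h3 := Real.add_one_le_exp (-u)
    rw [Real.exp_neg] at h3
    have h4 : Real.exp y * (-u + 1) ≤ Real.exp y * (Real.exp u)⁻¹ := by gcongr
    have h5 : Real.exp (-y) * (u + 1) ≤ Real.exp (-y) * Real.exp u := by gcongr
    rw [div_eq_mul_inv (Real.exp y)]
    linarith
  have hs : 0 ≤ Real.sinh (α * R) := Real.sinh_nonneg_iff.2 (by positivity)
  have h := hconv (α * R) (α * R - α * max 0 (R - v))
  rw [sub_sub_cancel] at h
  rw [radialCdf, le_div_iff₀ hD]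
  have h2 : Real.sinh (α * R) * (α * R - α * max 0 (R - v)) ≤ Real.sinh (α * R) * (α * v) := by
    refine mul_le_mul_of_nonneg_left ?_ hs
    have := le_max_right 0 (R - v)
    nlinarith
  have h3 : (1 - α * v * (Real.sinh (α * R) / (Real.cosh (α * R) - 1))) *
      (Real.cosh (α * R) - 1) = Real.cosh (α * R) - 1 - α * v * Real.sinh (α * R) := by
    field_simp
  rw [h3]
  linarith

/-- As a function of the radius `s` of the neighbour, the left-hand side of the hyperbolic law of
cosines is dominated by `busemannExp r ψ / 2 * exp s`. -/
theorem ball_condition_eq (r s ψ : ℝ) :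
    Real.cosh r * Real.cosh s - Real.sinh r * Real.sinh s * Real.cos ψ =
      busemannExp r ψ / 2 * Real.exp s + busemannExp (-r) ψ / 2 * (Real.exp s)⁻¹ := by
  rw [busemannExp, busemannExp, Real.cosh_neg, Real.sinh_neg, Real.cosh_eq s, Real.sinh_eq s,
    Real.exp_neg]
  ring

theorem min_one_rpow_eq {x : ℝ} (hx : 0 < x) (hα : 0 < α) :
    min 1 (x ^ (-α)) = Real.exp (-(α * max 0 (Real.log x))) := by
  rw [Real.rpow_def_of_pos hx]
  rcases le_total (Real.log x) 0 with h | h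
  · rw [max_eq_left h, mul_zero, neg_zero, Real.exp_zero,
      min_eq_left (Real.one_le_exp (by nlinarith))]
  · rw [max_eq_right h, min_eq_right (Real.exp_le_one_iff.2 (by nlinarith))]
    ring_nf

/-- Together with `le_directionMass`: a neighbour in direction `ψ` has radius at most about
`R - log (busemannExp r ψ)`, an event of probability about `min 1 (busemannExp r ψ ^ (-α))`. -/
theorem directionMass_le (hα : 0 < α) (hR : 0 < R) (r ψ : ℝ) :
    directionMass α R r ψ ≤
      min 1 ((busemannExp r ψ / (1 + Real.exp (-(2 * R)))) ^ (-α)) := by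
  have hK := busemannExp_pos r ψ
  have hc : 0 < 1 + Real.exp (-(2 * R)) := by positivity
  have hKc := div_pos hK hc
  rw [min_one_rpow_eq hKc hα]
  set v := max 0 (Real.log (busemannExp r ψ / (1 + Real.exp (-(2 * R))))) with hv
  rcases le_total (Real.log (busemannExp r ψ / (1 + Real.exp (-(2 * R))))) 0 with h0 | h0
  · rw [max_eq_left h0] at hv
    rw [hv, mul_zero, neg_zero, Real.exp_zero]
    exact directionMass_le_one hα hR r ψ
  rw [max_eq_right h0] at hv
  have hv0 : 0 ≤ v := hv ▸ h0
  have hev : Real.exp v * (1 + Real.exp (-(2 * R))) = busemannExp r ψ := by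
    rw [hv, Real.exp_log hKc]
    field_simp
  have hS : ∀ s ∈ {s | Real.cosh r * Real.cosh s - Real.sinh r * Real.sinh s * Real.cos ψ ≤
      Real.cosh R}, s ≤ R - v := by
    intro s hs
    rw [Set.mem_ofPred_eq, ball_condition_eq] at hs
    have h1 : busemannExp r ψ / 2 * Real.exp s ≤ Real.cosh R := by
      have : 0 < busemannExp (-r) ψ / 2 * (Real.exp s)⁻¹ := by
        have := busemannExp_pos (-r) ψ
        positivity
      linarith
    have h2 : Real.cosh R = (1 + Real.exp (-(2 * R))) / 2 * Real.exp R := by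
      have e : Real.exp (-R) = Real.exp (-(2 * R)) * Real.exp R := by
        rw [← Real.exp_add]
        ring_nf
      rw [Real.cosh_eq, e]
      ring
    rw [← hev, h2] at h1
    have h3 : Real.exp (v + s) ≤ Real.exp R := by
      rw [Real.exp_add]
      refine le_of_mul_le_mul_left ?_ (half_pos hc)
      linarith
    have := Real.exp_le_exp.1 h3
    linarith
  rcases le_total v R with h | h
  · exact (radialLaw_real_le hα hR (by linarith) (by linarith) fun s hs _ _ => hS s hs).trans
      (radialCdf_sub_le hα hR hv0 h)
  · refine (radialLaw_real_le hα hR le_rfl hR.le fun s hs _ _ => (hS s hs).trans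
      (by linarith)).trans ?_
    rw [radialCdf, mul_zero, Real.cosh_zero, sub_self, zero_div]
    positivity

theorem radialCdf_le_directionMass (hα : 0 < α) (hR : 0 < R) {r : ℝ} (hr : 0 ≤ r) (ψ : ℝ)
    (hrR : Real.exp (r - R) < 1) :
    radialCdf α R (max 0 (R - max 0 (Real.log (busemannExp r ψ / (1 - Real.exp (r - R)))))) ≤
      directionMass α R r ψ := by
  have hK := busemannExp_pos r ψ
  have hc : 0 < 1 - Real.exp (r - R) := by linarith
  have hKc := div_pos hK hc
  set w := Real.log (busemannExp r ψ / (1 - Real.exp (r - R))) with hw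
  have hw' : Real.exp w * (1 - Real.exp (r - R)) = busemannExp r ψ := by
    rw [hw, Real.exp_log hKc]
    field_simp
  refine le_radialLaw_real hα hR (le_max_left _ _) (max_le hR.le ?_) fun s hs hs' => ?_
  · linarith [le_max_left 0 w]
  · have h1 : s < R - max 0 w := by
      rcases lt_max_iff.1 hs' with h | h
      · linarith
      · exact h
    have h2 : w + s ≤ R := by linarith [le_max_right 0 w]
    rw [Set.mem_ofPred_eq, ball_condition_eq]
    have h3 : busemannExp r ψ * Real.exp s ≤ Real.exp R - Real.exp r := by
      rw [← hw']
      calc Real.exp w * (1 - Real.exp (r - R)) * Real.exp s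
          = (1 - Real.exp (r - R)) * Real.exp (w + s) := by rw [Real.exp_add]; ring
        _ ≤ (1 - Real.exp (r - R)) * Real.exp R := by gcongr
        _ = Real.exp R - Real.exp r := by
          rw [sub_mul, ← Real.exp_add, one_mul, sub_add_cancel]
    have h4 : busemannExp (-r) ψ * (Real.exp s)⁻¹ ≤ Real.exp r := by
      have h5 := busemannExp_le_exp_abs (-r) ψ
      rw [abs_neg, abs_of_nonneg hr] at h5
      calc busemannExp (-r) ψ * (Real.exp s)⁻¹ ≤ Real.exp r * 1 :=
            mul_le_mul h5 (inv_le_one_of_one_le₀ (Real.one_le_exp hs.le)) (by positivity)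
              (Real.exp_pos _).le
        _ = Real.exp r := mul_one _
    rw [Real.cosh_eq]
    have := Real.exp_pos (-R)
    linarith

theorem le_directionMass (hα : 0 < α) (hR : 0 < R) {r : ℝ} (hr : 0 ≤ r) (ψ : ℝ)
    (hrR : Real.exp (r - R) < 1) :
    min 1 ((busemannExp r ψ / (1 - Real.exp (r - R))) ^ (-α)) - 1 / (Real.cosh (α * R) - 1) ≤
      directionMass α R r ψ := by
  have hc : 0 < 1 - Real.exp (r - R) := by linarith
  rw [min_one_rpow_eq (div_pos (busemannExp_pos r ψ) hc) hα]
  exact (exp_sub_le_radialCdf_sub hα hR (le_max_left _ _)).trans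
    (radialCdf_le_directionMass hα hR hr ψ hrR)

/-- The complementary mass is bounded by a multiple of the width of the layer of the disc that is
cut off. Unlike `le_directionMass`, this has no additive error, which matters when the
complementary mass itself is small. -/
theorem one_sub_directionMass_le (hα : 0 < α) (hR : 0 < R) {r : ℝ} (hr : 0 ≤ r) (ψ : ℝ)
    (hrR : Real.exp (r - R) < 1) :
    1 - directionMass α R r ψ ≤
      α * max 0 (Real.log (busemannExp r ψ / (1 - Real.exp (r - R)))) *
        (Real.sinh (α * R) / (Real.cosh (α * R) - 1)) := by
  have := (one_sub_le_radialCdf_sub hα hR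
    (v := max 0 (Real.log (busemannExp r ψ / (1 - Real.exp (r - R)))))).trans
    (radialCdf_le_directionMass hα hR hr ψ hrR)
  linarith

end Estimates

section Limits

variable {α : ℝ} {R : ℕ → ℝ}

theorem tendsto_cosh_sub_one (hα : 0 < α) (hR : Tendsto R atTop atTop) :
    Tendsto (fun n => Real.cosh (α * R n) - 1) atTop atTop := by
  refine tendsto_atTop_mono (fun n => ?_) ((hR.const_mul_atTop (half_pos hα)).atTop_add
    (tendsto_const_nhds (x := (-1 : ℝ) / 2)))
  rw [Real.cosh_eq]
  have h1 := Real.add_one_le_exp (α * R n)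
  have h2 := Real.exp_pos (-(α * R n))
  linarith

/-- As the radius grows, the direction `ψ` loses all the nodes that lie beyond the horoball of
Busemann function `-log κ`. -/
theorem tendsto_directionMass (hα : 0 < α) (hR : Tendsto R atTop atTop) {r ψ : ℕ → ℝ}
    (hr : ∀ᶠ n in atTop, 0 ≤ r n) (hrR : Tendsto (fun n => Real.exp (r n - R n)) atTop (𝓝 0))
    {κ : ℝ}
    (hκ : 0 < κ) (hK : Tendsto (fun n => busemannExp (r n) (ψ n)) atTop (𝓝 κ)) :
    Tendsto (fun n => directionMass α (R n) (r n) (ψ n)) atTop (𝓝 (min 1 (κ ^ (-α)))) := by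
  have h1 : Tendsto (fun n => 1 + Real.exp (-(2 * R n))) atTop (𝓝 1) := by
    have := (Real.tendsto_exp_neg_atTop_nhds_zero.comp (hR.const_mul_atTop two_pos)).const_add 1
    simpa using this
  have h2 : Tendsto (fun n => 1 - Real.exp (r n - R n)) atTop (𝓝 1) := by
    simpa using hrR.const_sub 1
  have hm : ∀ {c : ℕ → ℝ}, Tendsto c atTop (𝓝 1) → Tendsto
      (fun n => min 1 ((busemannExp (r n) (ψ n) / c n) ^ (-α))) atTop (𝓝 (min 1 (κ ^ (-α)))) := by
    intro c hc
    have h3 := hK.div hc one_ne_zero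
    rw [div_one] at h3
    exact tendsto_const_nhds.min (h3.rpow_const (Or.inl hκ.ne'))
  have h4 : Tendsto (fun n => 1 / (Real.cosh (α * R n) - 1)) atTop (𝓝 0) :=
    (tendsto_cosh_sub_one hα hR).const_div_atTop 1
  have h5 := (hm h2).sub h4
  rw [sub_zero] at h5
  refine tendsto_of_tendsto_of_tendsto_of_le_of_le' h5 (hm h1) ?_ ?_
  · filter_upwards [hr, hR.eventually_gt_atTop 0, hrR.eventually_lt_const one_pos] with n h h' h''
    exact le_directionMass hα h' h (ψ n) h''
  · filter_upwards [hR.eventually_gt_atTop 0] with n h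
    exact directionMass_le hα h _ _

end Limits

section BallLimits

variable {α : ℝ} {R : ℕ → ℝ}

theorem integral_layerMass_symm (r : ℝ) :
    ∫ ψ in (-Real.pi)..Real.pi, layerMass r ψ = 2 * ∫ ψ in (0 : ℝ)..Real.pi, layerMass r ψ := by
  have hc : Continuous (layerMass r) := continuous_layerMass.comp (Continuous.prodMk_right r)
  have h1 : ∫ ψ in (-Real.pi)..0, layerMass r ψ = ∫ ψ in (0 : ℝ)..Real.pi, layerMass r ψ := by
    have h := intervalIntegral.integral_comp_neg (a := -Real.pi) (b := 0) (f := layerMass r)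
    rw [neg_neg, neg_zero] at h
    rw [← h]
    congr 1
    ext ψ
    simp only [layerMass, busemannExp, Real.cos_neg]
  rw [← intervalIntegral.integral_add_adjacent_intervals (hc.intervalIntegrable _ 0)
    (hc.intervalIntegrable 0 _), h1, two_mul]

/-- For `α = 1 / 2` a node at a fixed distance of the origin is linked to a fixed proportion of the
nodes. -/
theorem tendsto_ballMass_of_eq_half (hR : Tendsto R atTop atTop) {r : ℝ} (hr : 0 < r) :
    Tendsto (fun n => ballMass (1 / 2) (R n) r) atTop (𝓝 (V r)) := by
  have hV : V r = 1 / (2 * Real.pi) * ∫ ψ in (-Real.pi)..Real.pi, layerMass r ψ := by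
    rw [V_eq_integral hr, integral_layerMass_symm]
    field_simp
  rw [hV]
  refine Tendsto.const_mul _ (intervalIntegral.tendsto_integral_filter_of_dominated_convergence
    (fun _ => 1) ?_ ?_ intervalIntegrable_const ?_)
  · filter_upwards [hR.eventually_gt_atTop 0] with n hn
    exact (measurable_directionMass one_half_pos hn r).aestronglyMeasurable
  · filter_upwards [hR.eventually_gt_atTop 0] with n hn
    refine Eventually.of_forall fun ψ _ => ?_
    rw [Real.norm_of_nonneg (directionMass_nonneg _ _ _ _)]
    exact directionMass_le_one one_half_pos hn r ψ
  · refine Eventually.of_forall fun ψ _ => ?_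
    refine tendsto_directionMass (ψ := fun _ => ψ) one_half_pos hR
      (Eventually.of_forall fun _ => hr.le) ?_ (busemannExp_pos r ψ) tendsto_const_nhds
    refine Real.tendsto_exp_atBot.comp (tendsto_const_nhds.add_atBot ?_)
    exact tendsto_neg_atTop_atBot.comp hR

theorem tendsto_log_div {x ρ : ℕ → ℝ} (hx : Tendsto x atTop (𝓝 1))
    (h : Tendsto (fun n => (x n - 1) / ρ n) atTop (𝓝 0)) :
    Tendsto (fun n => Real.log (x n) / ρ n) atTop (𝓝 0) := by
  have h2 : Tendsto (fun n => 2 * |(x n - 1) / ρ n|) atTop (𝓝 0) := by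
    simpa using h.abs.const_mul 2
  refine squeeze_zero_norm' ?_ h2
  filter_upwards [hx.eventually_const_lt (show (1 : ℝ) / 2 < 1 by norm_num)] with n hn
  have hx0 : 0 < x n := by linarith
  rw [Real.norm_eq_abs, abs_div, abs_div, ← mul_div_assoc]
  gcongr
  have h3 := Real.log_le_sub_one_of_pos hx0
  have h4 := Real.one_sub_inv_le_log_of_pos hx0
  have h5 : 1 - (x n)⁻¹ = (x n - 1) / x n := by field_simp
  have h6 : |(x n - 1) / x n| ≤ 2 * |x n - 1| := by
    rw [abs_div, abs_of_pos hx0, div_le_iff₀ hx0]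
    nlinarith [abs_nonneg (x n - 1)]
  rw [h5] at h4
  have h7 := neg_abs_le ((x n - 1) / x n)
  have h8 := le_abs_self (x n - 1)
  rw [abs_le]
  constructor <;> linarith [abs_nonneg (x n - 1)]

theorem tendsto_log_busemannExp_div {ρ : ℕ → ℝ} (hρ : Tendsto ρ atTop (𝓝[>] 0)) (ψ : ℝ) :
    Tendsto (fun n => Real.log (busemannExp (ρ n) ψ) / ρ n) atTop (𝓝 (-Real.cos ψ)) := by
  have h0 : busemannExp 0 ψ = 1 := by simp [busemannExp]
  have h1 : HasDerivAt (fun r => Real.log (busemannExp r ψ)) (-Real.cos ψ) 0 := by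
    have := (hasDerivAt_busemannExp 0 ψ).log (busemannExp_pos 0 ψ).ne'
    simpa [h0] using this
  have h2 := h1.tendsto_slope.comp (hρ.mono_right (nhdsWithin_mono 0 fun x hx => ne_of_gt hx))
  refine h2.congr fun n => ?_
  simp [slope_def_field, h0]

theorem integral_max_neg_cos :
    ∫ ψ in (-Real.pi)..Real.pi, max 0 (-Real.cos ψ) = 2 := by
  have hc : Continuous fun ψ => max 0 (-Real.cos ψ) := by fun_prop
  have hπ := Real.pi_pos
  have h1 : ∫ ψ in (-Real.pi)..(-(Real.pi / 2)), max 0 (-Real.cos ψ) = 1 := by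
    rw [intervalIntegral.integral_congr (g := fun ψ => -Real.cos ψ)]
    · simp
    · intro ψ hψ
      rw [Set.uIcc_of_le (by linarith)] at hψ
      refine max_eq_right (neg_nonneg.2 ?_)
      rw [← Real.cos_neg]
      exact Real.cos_nonpos_of_pi_div_two_le_of_le (by linarith [hψ.2]) (by linarith [hψ.1])
  have h2 : ∫ ψ in (-(Real.pi / 2))..(Real.pi / 2), max 0 (-Real.cos ψ) = 0 := by
    rw [intervalIntegral.integral_congr (g := fun ψ => 0)]
    · simp
    · intro ψ hψ
      rw [Set.uIcc_of_le (by linarith)] at hψ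
      exact max_eq_left (neg_nonpos.2 (Real.cos_nonneg_of_mem_Icc hψ))
  have h3 : ∫ ψ in (Real.pi / 2)..Real.pi, max 0 (-Real.cos ψ) = 1 := by
    rw [intervalIntegral.integral_congr (g := fun ψ => -Real.cos ψ)]
    · simp
    · intro ψ hψ
      rw [Set.uIcc_of_le (by linarith)] at hψ
      refine max_eq_right (neg_nonneg.2 ?_)
      exact Real.cos_nonpos_of_pi_div_two_le_of_le (by linarith [hψ.1]) (by linarith [hψ.2])
  rw [← intervalIntegral.integral_add_adjacent_intervals (hc.intervalIntegrable _ (Real.pi / 2))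
    (hc.intervalIntegrable _ _), ← intervalIntegral.integral_add_adjacent_intervals
    (hc.intervalIntegrable _ (-(Real.pi / 2))) (hc.intervalIntegrable _ _), h1, h2, h3]
  norm_num

theorem tendsto_sinh_div_cosh_sub_one (hα : 0 < α) (hR : Tendsto R atTop atTop) :
    Tendsto (fun n => Real.sinh (α * R n) / (Real.cosh (α * R n) - 1)) atTop (𝓝 1) := by
  have h1 := (tendsto_cosh_sub_one hα hR).const_div_atTop 1
  have h2 : Tendsto (fun n => Real.exp (-(α * R n))) atTop (𝓝 0) :=
    Real.tendsto_exp_neg_atTop_nhds_zero.comp (hR.const_mul_atTop hα)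
  have h3 : Tendsto (fun n => 1 + (1 - Real.exp (-(α * R n))) * (1 / (Real.cosh (α * R n) - 1)))
      atTop (𝓝 1) := by
    simpa using ((h2.const_sub 1).mul h1).const_add 1
  refine h3.congr' ?_
  filter_upwards [hR.eventually_gt_atTop 0] with n hn
  have hD := cosh_sub_one_pos hα hn
  have h4 := Real.cosh_sub_sinh (α * R n)
  rw [← h4]
  field_simp
  ring

/-- Close to the origin, the proportion of the nodes that are not linked to a node is proportional
to the distance of this node to the origin. -/
theorem tendsto_one_sub_ballMass_div (hα : 0 < α) (hR : Tendsto R atTop atTop) {ρ : ℕ → ℝ}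
    (hρ : Tendsto ρ atTop (𝓝[>] 0))
    (hRρ : Tendsto (fun n => Real.exp (-R n) / ρ n) atTop (𝓝 0)) :
    Tendsto (fun n => (1 - ballMass α (R n) (ρ n)) / ρ n) atTop (𝓝 (α / Real.pi)) := by
  have hπ := Real.pi_pos
  have hρ0 : Tendsto ρ atTop (𝓝 0) := hρ.mono_right nhdsWithin_le_nhds
  have hρpos : ∀ᶠ n in atTop, 0 < ρ n := hρ.eventually self_mem_nhdsWithin
  have hRpos := hR.eventually_gt_atTop 0
  have heR : Tendsto (fun n => Real.exp (-R n)) atTop (𝓝 0) :=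
    Real.tendsto_exp_neg_atTop_nhds_zero.comp hR
  have heρ : Tendsto (fun n => Real.exp (ρ n)) atTop (𝓝 1) := by
    simpa [Function.comp_def] using (Real.continuous_exp.tendsto 0).comp hρ0
  have hsmall : Tendsto (fun n => Real.exp (ρ n - R n)) atTop (𝓝 0) := by
    simpa [sub_eq_add_neg, Real.exp_add] using heρ.mul heR
  have hc1 : Tendsto (fun n => 1 - Real.exp (ρ n - R n)) atTop (𝓝 1) := by
    simpa using hsmall.const_sub 1
  have hc2 : Tendsto (fun n => 1 + Real.exp (-(2 * R n))) atTop (𝓝 1) := by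
    have := (heR.mul heR).const_add 1
    simp only [← Real.exp_add, mul_zero, add_zero] at this
    refine this.congr fun n => ?_
    ring_nf
  have hl1 : Tendsto (fun n => Real.log (1 - Real.exp (ρ n - R n)) / ρ n) atTop (𝓝 0) := by
    refine tendsto_log_div hc1 ?_
    have := (heρ.mul hRρ).neg
    rw [mul_zero, neg_zero] at this
    refine this.congr fun n => ?_
    rw [sub_eq_add_neg (ρ n), Real.exp_add]
    ring
  have hl2 : Tendsto (fun n => Real.log (1 + Real.exp (-(2 * R n))) / ρ n) atTop (𝓝 0) := by
    refine tendsto_log_div hc2 ?_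
    have := heR.mul hRρ
    rw [mul_zero] at this
    refine this.congr fun n => ?_
    rw [show -(2 * R n) = -R n + -R n by ring, Real.exp_add]
    ring
  have hε := tendsto_sinh_div_cosh_sub_one hα hR
  have hlogdiv : ∀ ψ n, ∀ c : ℝ, 0 < c → Real.log (busemannExp (ρ n) ψ / c) =
      Real.log (busemannExp (ρ n) ψ) - Real.log c := fun ψ n c hc =>
    Real.log_div (busemannExp_pos _ _).ne' hc.ne'
  have hlim : Tendsto (fun n => ∫ ψ in (-Real.pi)..Real.pi,
      (1 - directionMass α (R n) (ρ n) ψ) / ρ n) atTop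
      (𝓝 (∫ ψ in (-Real.pi)..Real.pi, α * max 0 (-Real.cos ψ))) := by
    refine intervalIntegral.tendsto_integral_filter_of_dominated_convergence
      (fun _ => α * 2 * 2) ?_ ?_ intervalIntegrable_const ?_
    · filter_upwards [hRpos] with n hn
      exact ((measurable_const.sub (measurable_directionMass hα hn _)).div_const
        _).aestronglyMeasurable
    · filter_upwards [hRpos, hρpos, hsmall.eventually_lt_const one_pos,
        hc1.eventually_const_lt one_half_lt_one, hl1.eventually_const_lt (neg_one_lt_zero),
        hε.eventually_lt_const one_lt_two] with n hn hρn h1 h2 h3 h4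
      refine Eventually.of_forall fun ψ _ => ?_
      rw [Real.norm_of_nonneg (div_nonneg (sub_nonneg.2 (directionMass_le_one hα hn _ _)) hρn.le),
        div_le_iff₀ hρn]
      refine (one_sub_directionMass_le hα hn hρn.le ψ h1).trans ?_
      have h5 : max 0 (Real.log (busemannExp (ρ n) ψ / (1 - Real.exp (ρ n - R n)))) ≤ 2 * ρ n := by
        refine max_le (by linarith) ?_
        rw [hlogdiv _ _ _ (by linarith)]
        have h6 : Real.log (busemannExp (ρ n) ψ) ≤ ρ n := by
          rw [Real.log_le_iff_le_exp (busemannExp_pos _ _)]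
          simpa [abs_of_pos hρn] using busemannExp_le_exp_abs (ρ n) ψ
        rw [lt_div_iff₀ hρn] at h3
        linarith
      have h7 : 0 ≤ Real.sinh (α * R n) / (Real.cosh (α * R n) - 1) :=
        div_nonneg (Real.sinh_nonneg_iff.2 (by positivity)) (cosh_sub_one_pos hα hn).le
      calc _ ≤ α * (2 * ρ n) * 2 := by gcongr
        _ = _ := by ring
    · refine Eventually.of_forall fun ψ _ => ?_
      have hK := tendsto_log_busemannExp_div hρ ψ
      have hv : ∀ c : ℕ → ℝ, Tendsto c atTop (𝓝 1) →
          Tendsto (fun n => Real.log (c n) / ρ n) atTop (𝓝 0) →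
          Tendsto (fun n => max 0 (Real.log (busemannExp (ρ n) ψ / c n)) / ρ n) atTop
            (𝓝 (max 0 (-Real.cos ψ))) := by
        intro c hc hcl
        have h1 := hK.sub hcl
        rw [sub_zero] at h1
        refine ((tendsto_const_nhds (x := (0 : ℝ))).max h1).congr' ?_
        filter_upwards [hρpos, hc.eventually_const_lt one_pos] with n hn hcn
        rw [hlogdiv _ _ _ hcn, ← max_div_div_right hn.le, zero_div, sub_div]
      have hv0 : Tendsto (fun n => max 0 (Real.log (busemannExp (ρ n) ψ /
          (1 + Real.exp (-(2 * R n)))))) atTop (𝓝 0) := by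
        have := (hv _ hc2 hl2).mul hρ0
        rw [mul_zero] at this
        refine this.congr' ?_
        filter_upwards [hρpos] with n hn
        exact div_mul_cancel₀ _ hn.ne'
      have hup := ((hv _ hc1 hl1).const_mul α).mul hε
      rw [mul_one] at hup
      have hlow := ((hv _ hc2 hl2).const_mul α).mul
        ((Real.continuous_exp.tendsto 0).comp (by simpa using (hv0.const_mul α).neg))
      rw [Real.exp_zero, mul_one] at hlow
      refine tendsto_of_tendsto_of_tendsto_of_le_of_le' hlow hup ?_ ?_
      · filter_upwards [hRpos, hρpos] with n hn hρn
        have h1 := directionMass_le hα hn (ρ n) ψ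
        rw [min_one_rpow_eq (div_pos (busemannExp_pos _ _) (by positivity)) hα] at h1
        set v := max 0 (Real.log (busemannExp (ρ n) ψ / (1 + Real.exp (-(2 * R n)))))
        rw [Function.comp_apply, ← mul_div_assoc, div_mul_eq_mul_div]
        gcongr
        -- `x e⁻ˣ ≤ 1 - e⁻ˣ`
        have h2 : α * v * Real.exp (-(α * v)) ≤ 1 - Real.exp (-(α * v)) := by
          have h3 := mul_le_mul_of_nonneg_right (Real.add_one_le_exp (α * v))
            (Real.exp_pos (-(α * v))).le
          rw [← Real.exp_add, add_neg_cancel, Real.exp_zero] at h3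
          linarith
        linarith
      · filter_upwards [hRpos, hρpos, hsmall.eventually_lt_const one_pos] with n hn hρn h1
        rw [div_le_iff₀ hρn, mul_right_comm, mul_assoc α, div_mul_cancel₀ _ hρn.ne']
        exact one_sub_directionMass_le hα hn hρn.le ψ h1
  rw [intervalIntegral.integral_const_mul, integral_max_neg_cos] at hlim
  have hlim2 := hlim.const_mul (1 / (2 * Real.pi))
  rw [show 1 / (2 * Real.pi) * (α * 2) = α / Real.pi by field_simp] at hlim2
  refine hlim2.congr' ?_
  filter_upwards [hRpos, hρpos] with n hn hρn
  rw [intervalIntegral.integral_div, intervalIntegral.integral_sub intervalIntegrable_const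
    ((intervalIntegrable_iff_integrableOn_Ioc_of_le (by linarith)).2
      (integrableOn_directionMass hα hn _ (by simp))), intervalIntegral.integral_const, ballMass,
    smul_eq_mul]
  field_simp
  ring

end BallLimits

theorem integrable_min_one_rpow {A β : ℝ} (hA : 0 < A) (hβ : 1 < β) :
    Integrable (fun x : ℝ => min 1 ((|x| / A) ^ (-β))) ∧
    ∫ x : ℝ, min 1 ((|x| / A) ^ (-β)) = 2 * A * β / (β - 1) := by
  have hf1 : Set.EqOn (fun x : ℝ => min 1 ((x / A) ^ (-β))) (fun _ => 1) (Set.Ioc 0 A) := by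
    intro x hx
    exact min_eq_left (Real.one_le_rpow_of_pos_of_le_one_of_nonpos (div_pos hx.1 hA)
      ((div_le_one hA).2 hx.2) (by linarith))
  have hf2 : Set.EqOn (fun x : ℝ => min 1 ((x / A) ^ (-β))) (fun x => A ^ β * x ^ (-β))
      (Set.Ioi A) := by
    intro x hx
    have hx' : A < x := hx
    have h1 : min 1 ((x / A) ^ (-β)) = (x / A) ^ (-β) :=
      min_eq_right (Real.rpow_le_one_of_one_le_of_nonpos ((one_le_div hA).2 hx'.le) (by linarith))
    change min 1 ((x / A) ^ (-β)) = A ^ β * x ^ (-β)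
    rw [h1, Real.div_rpow (hA.trans hx').le hA.le, Real.rpow_neg hA.le β]
    field_simp
  have hi1 : IntegrableOn (fun x : ℝ => min 1 ((x / A) ^ (-β))) (Set.Ioc 0 A) :=
    IntegrableOn.congr_fun (integrableOn_const (by simp)) hf1.symm measurableSet_Ioc
  have hi2 : IntegrableOn (fun x : ℝ => min 1 ((x / A) ^ (-β))) (Set.Ioi A) :=
    IntegrableOn.congr_fun ((integrableOn_Ioi_rpow_of_lt (by linarith) hA).const_mul _) hf2.symm
      measurableSet_Ioi
  have hval : ∫ x in Set.Ioi (0 : ℝ), min 1 ((x / A) ^ (-β)) = A * β / (β - 1) := by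
    rw [← Set.Ioc_union_Ioi_eq_Ioi hA.le, setIntegral_union (Set.Ioc_disjoint_Ioi le_rfl)
      measurableSet_Ioi hi1 hi2, setIntegral_congr_fun measurableSet_Ioc hf1,
      setIntegral_congr_fun measurableSet_Ioi hf2, integral_const_mul,
      integral_Ioi_rpow_of_lt (by linarith) hA]
    have h1 : -β + 1 ≠ 0 := by linarith
    have h2 : β - 1 ≠ 0 := by linarith
    have h3 : A ^ β * A ^ (-β + 1) = A := by
      rw [← Real.rpow_add hA]
      simp
    have h4 : A ^ β * (-A ^ (-β + 1) / (-β + 1)) = A / (β - 1) := by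
      rw [← mul_div_assoc, mul_neg, h3, ← neg_sub 1 β, div_neg, neg_div, ← sub_eq_neg_add]
    rw [h4]
    simp [hA.le]
    field_simp
    ring
  have hint : ∫ x : ℝ, min 1 ((|x| / A) ^ (-β)) = 2 * A * β / (β - 1) := by
    rw [integral_comp_abs (f := fun x => min 1 ((x / A) ^ (-β))), hval]
    ring
  refine ⟨?_, hint⟩
  by_contra h
  have h1 := integral_undef h
  rw [hint] at h1
  have : 0 < 2 * A * β / (β - 1) := div_pos (by positivity) (by linarith)
  linarith

section BallLimits

variable {α : ℝ} {R : ℕ → ℝ}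

theorem busemannExp_eq_sin (r ψ : ℝ) : busemannExp r ψ =
    (1 + Real.cos ψ) / 2 * Real.exp (-r) + (Real.sin (ψ / 2) * Real.exp (r / 2)) ^ 2 := by
  rw [busemannExp_eq, mul_pow, ← Real.exp_nat_mul, Real.sin_sq_eq_half_sub]
  ring_nf

theorem tendsto_busemannExp_scaled {r : ℕ → ℝ} (hr : Tendsto r atTop atTop) (x : ℝ) :
    Tendsto (fun n => busemannExp (r n) (x / Real.exp (r n / 2))) atTop (𝓝 ((|x| / 2) ^ 2)) := by
  have h1 : Tendsto (fun n => x / Real.exp (r n / 2)) atTop (𝓝 0) :=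
    (Real.tendsto_exp_atTop.comp (hr.atTop_div_const two_pos)).const_div_atTop x
  have h2 : Tendsto (fun n => Real.exp (-r n)) atTop (𝓝 0) :=
    Real.tendsto_exp_neg_atTop_nhds_zero.comp hr
  have h3 : Tendsto (fun n => (1 + Real.cos (x / Real.exp (r n / 2))) / 2 * Real.exp (-r n)) atTop
      (𝓝 0) := by
    simpa using ((((Real.continuous_cos.tendsto 0).comp h1).const_add 1).div_const 2).mul h2
  have h4 : Tendsto (fun n => x / 2 * Real.sinc (x / Real.exp (r n / 2) / 2)) atTop
      (𝓝 (x / 2)) := by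
    have := (Real.continuous_sinc.tendsto 0).comp
      (by simpa using h1.div_const 2 :
        Tendsto (fun n => x / Real.exp (r n / 2) / 2) atTop (𝓝 0))
    simpa using this.const_mul (x / 2)
  have h5 := h3.add (h4.pow 2)
  rw [zero_add, ← sq_abs (x / 2), abs_div, abs_of_pos (two_pos (α := ℝ))] at h5
  refine h5.congr fun n => ?_
  rw [busemannExp_eq_sin]
  congr 2
  rcases eq_or_ne x 0 with rfl | hx
  · simp
  · have := Real.exp_pos (r n / 2)
    rw [Real.sinc_of_ne_zero (by positivity)]
    field_simp

theorem sq_div_le_busemannExp {r x : ℝ} (hx : |x / Real.exp (r / 2)| ≤ Real.pi) :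
    (|x| / Real.pi) ^ 2 ≤ busemannExp r (x / Real.exp (r / 2)) := by
  have h1 := Real.cos_le_one_sub_mul_cos_sq hx
  have h2 : 0 ≤ (1 + Real.cos (x / Real.exp (r / 2))) / 2 * Real.exp (-r) := by
    have := Real.neg_one_le_cos (x / Real.exp (r / 2))
    have := Real.exp_pos (-r)
    exact mul_nonneg (by linarith) this.le
  rw [busemannExp_eq]
  have h3 : Real.exp r = Real.exp (r / 2) ^ 2 := by
    rw [← Real.exp_nat_mul]
    ring_nf
  have h4 := Real.exp_pos (r / 2)
  have h5 : 1 / Real.pi ^ 2 * (x / Real.exp (r / 2)) ^ 2 ≤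
      (1 - Real.cos (x / Real.exp (r / 2))) / 2 := by
    have e : 2 / Real.pi ^ 2 * (x / Real.exp (r / 2)) ^ 2 =
      2 * (1 / Real.pi ^ 2 * (x / Real.exp (r / 2)) ^ 2) := by ring
    linarith
  have h6 := mul_le_mul_of_nonneg_right h5 (Real.exp_pos r).le
  have h7 : 1 / Real.pi ^ 2 * (x / Real.exp (r / 2)) ^ 2 * Real.exp r = (|x| / Real.pi) ^ 2 := by
    rw [h3, div_pow |x|, sq_abs]
    field_simp
  linarith

/-- The neighbours of a node at a large distance `r` of the origin are seen at an angle of order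
`exp (-r / 2)`. In the rescaled angle `x`, the mass converges to `min 1 ((|x| / 2) ^ (-2 * α))`,
which is integrable precisely when `α > 1 / 2`. -/
theorem tendsto_exp_mul_ballMass (hα : 1 / 2 < α) (hR : Tendsto R atTop atTop) {r : ℕ → ℝ}
    (hr : Tendsto r atTop atTop)
    (hrR : Tendsto (fun n => Real.exp (r n - R n)) atTop (𝓝 0)) :
    Tendsto (fun n => Real.exp (r n / 2) * ballMass α (R n) (r n)) atTop (𝓝 (C α)) := by
  have hπ := Real.pi_pos
  have hα0 : 0 < α := by linarith
  have hRpos := hR.eventually_gt_atTop 0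
  have hsub : ∀ n, Real.exp (r n / 2) * ballMass α (R n) (r n) = 1 / (2 * Real.pi) *
      ∫ x, (Set.Ioc (-Real.pi * Real.exp (r n / 2)) (Real.pi * Real.exp (r n / 2))).indicator
        (fun x => directionMass α (R n) (r n) (x / Real.exp (r n / 2))) x := by
    intro n
    have hE := Real.exp_pos (r n / 2)
    rw [integral_indicator measurableSet_Ioc, ← intervalIntegral.integral_of_le (by nlinarith),
      intervalIntegral.integral_comp_div (fun x => directionMass α (R n) (r n) x) hE.ne',
      mul_div_cancel_right₀ _ hE.ne', mul_div_cancel_right₀ _ hE.ne', ballMass, smul_eq_mul]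
    ring
  have hpow : ∀ y : ℝ, 0 ≤ y → (y ^ 2) ^ (-α) = y ^ (-(2 * α)) := by
    intro y hy
    rw [← Real.rpow_natCast, ← Real.rpow_mul hy]
    congr 1
    push_cast
    ring
  have hlim : Tendsto (fun n => ∫ x, (Set.Ioc (-Real.pi * Real.exp (r n / 2))
      (Real.pi * Real.exp (r n / 2))).indicator
        (fun x => directionMass α (R n) (r n) (x / Real.exp (r n / 2))) x) atTop
      (𝓝 (∫ x : ℝ, min 1 ((|x| / 2) ^ (-(2 * α))))) := by
    refine tendsto_integral_filter_of_dominated_convergence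
      (fun x => min 1 ((|x| / (2 * Real.pi)) ^ (-(2 * α)))) ?_ ?_
      (integrable_min_one_rpow (by positivity) (by linarith)).1 ?_
    · filter_upwards [hRpos] with n hn
      exact (((measurable_directionMass hα0 hn _).comp (measurable_id.div_const _)).indicator
        measurableSet_Ioc).aestronglyMeasurable
    · filter_upwards [hRpos] with n hn
      -- `x = 0` is excluded because `0` has the junk value `0` as a negative power
      filter_upwards [compl_mem_ae_iff.2 (measure_singleton (0 : ℝ))] with x hx
      have hx0 : 0 < |x| := abs_pos.2 hx
      have hE := Real.exp_pos (r n / 2)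
      by_cases h : x ∈ Set.Ioc (-Real.pi * Real.exp (r n / 2)) (Real.pi * Real.exp (r n / 2))
      · rw [Set.indicator_of_mem h, Real.norm_of_nonneg (directionMass_nonneg _ _ _ _)]
        refine (directionMass_le hα0 hn _ _).trans (min_le_min_left _ ?_)
        rw [← hpow _ (by positivity)]
        refine Real.rpow_le_rpow_of_nonpos (by positivity) ?_ (by linarith)
        have h1 : (|x| / Real.pi) ^ 2 ≤ busemannExp (r n) (x / Real.exp (r n / 2)) := by
          refine sq_div_le_busemannExp ?_
          rw [abs_div, abs_of_pos hE, div_le_iff₀ hE, abs_le]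
          exact ⟨by linarith [h.1], h.2⟩
        have h2 : Real.exp (-(2 * R n)) ≤ 1 := Real.exp_le_one_iff.2 (by linarith)
        rw [le_div_iff₀ (by positivity)]
        have h3 : (|x| / (2 * Real.pi)) ^ 2 = (|x| / Real.pi) ^ 2 / 4 := by ring
        have h4 : 0 ≤ (|x| / Real.pi) ^ 2 := by positivity
        rw [h3]
        nlinarith [Real.exp_pos (-(2 * R n))]
      · rw [Set.indicator_of_notMem h, norm_zero]
        positivity
    · filter_upwards [compl_mem_ae_iff.2 (measure_singleton (0 : ℝ))] with x hx
      have hx0 : 0 < |x| := abs_pos.2 hx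
      have h1 := tendsto_directionMass hα0 hR (hr.eventually_ge_atTop 0) hrR
        (by positivity : 0 < (|x| / 2) ^ 2) (tendsto_busemannExp_scaled hr x)
      rw [hpow _ (by positivity)] at h1
      refine h1.congr' ?_
      filter_upwards [((Real.tendsto_exp_atTop.comp
        (hr.atTop_div_const two_pos)).const_mul_atTop hπ).eventually_gt_atTop |x|] with n hn
      rw [Set.indicator_of_mem]
      rw [Function.comp_apply] at hn
      have h2 := abs_lt.1 hn
      exact ⟨by linarith [h2.1], h2.2.le⟩
  rw [(integrable_min_one_rpow two_pos (by linarith)).2] at hlim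
  simp only [hsub]
  convert hlim.const_mul (1 / (2 * Real.pi)) using 2
  have h1 : α - 1 / 2 ≠ 0 := by linarith
  have h2 : 2 * α - 1 ≠ 0 := by linarith
  rw [C]
  field_simp

end BallLimits

/-! ### The radial coordinates of the nodes of large degree -/

/-- If a decreasing function `f n` of the radius takes a value close to `t` at `ρ n t`, the mean
number of nodes at which it exceeds `t` is about the mean number of nodes closer to the origin
than `ρ n t`. -/
theorem tendsto_mul_radialLaw {α : ℝ} (hα : 0 < α) {R : ℕ → ℝ} (hR : ∀ᶠ n in atTop, 0 < R n)
    {f ρ : ℕ → ℝ → ℝ} {Λ : ℝ → ℝ} {I : Set ℝ} (hI : IsOpen I)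
    (hf : ∀ᶠ n in atTop, AntitoneOn (f n) (Set.Ici 0))
    (hρ : ∀ t ∈ I, ∀ᶠ n in atTop, 0 ≤ ρ n t ∧ ρ n t ≤ R n)
    (hfρ : ∀ t ∈ I, Tendsto (fun n => f n (ρ n t)) atTop (𝓝 t))
    (hΛ : ∀ t ∈ I, Tendsto (fun n : ℕ => n * radialCdf α (R n) (ρ n t)) atTop (𝓝 (Λ t)))
    {t : ℝ} (ht : t ∈ I) (hcont : ContinuousAt Λ t) :
    Tendsto (fun n : ℕ => n * (radialLaw α (R n)).real {r | t < f n r}) atTop (𝓝 (Λ t)) := by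
  have hIt : ∀ᶠ s in 𝓝 t, s ∈ I := hI.mem_nhds ht
  refine tendsto_order.2 ⟨fun x hx => ?_, fun x hx => ?_⟩
  · obtain ⟨u, ⟨huI, hu⟩, htu⟩ := ((hIt.and (hcont.eventually (lt_mem_nhds hx))).filter_mono
      nhdsWithin_le_nhds |>.and self_mem_nhdsWithin : ∀ᶠ s in 𝓝[>] t, _).exists
    filter_upwards [hR, hf, hρ u huI, (hfρ u huI).eventually_const_lt htu,
      (hΛ u huI).eventually_const_lt hu] with n h1 h2 h3 h4 h5
    refine h5.trans_le (mul_le_mul_of_nonneg_left ?_ n.cast_nonneg)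
    exact le_radialLaw_real hα h1 h3.1 h3.2 fun s hs hs' => h4.trans_le (h2 hs.le h3.1 hs'.le)
  · obtain ⟨u, ⟨huI, hu⟩, htu⟩ := ((hIt.and (hcont.eventually (gt_mem_nhds hx))).filter_mono
      nhdsWithin_le_nhds |>.and self_mem_nhdsWithin : ∀ᶠ s in 𝓝[<] t, _).exists
    filter_upwards [hR, hf, hρ u huI, (hfρ u huI).eventually_lt_const htu,
      (hΛ u huI).eventually_lt_const hu] with n h1 h2 h3 h4 h5
    refine (mul_le_mul_of_nonneg_left ?_ n.cast_nonneg).trans_lt h5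
    refine radialLaw_real_le hα h1 h3.1 h3.2 fun s hs hs0 _ => ?_
    by_contra hlt
    have := h2 h3.1 hs0.le (not_le.1 hlt).le
    exact absurd (hs.trans_le this) (not_lt.2 h4.le)

section Radius

variable {ν : ℝ}

theorem tendsto_diskRadius (hν : 0 < ν) : Tendsto (diskRadius ν) atTop atTop := by
  refine Tendsto.const_mul_atTop two_pos (Real.tendsto_log_atTop.comp ?_)
  exact tendsto_natCast_atTop_atTop.atTop_div_const hν

theorem exp_mul_diskRadius (hν : 0 < ν) {n : ℕ} (hn : 0 < n) (c : ℝ) :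
    Real.exp (c * diskRadius ν n) = (n : ℝ) ^ (2 * c) * ν ^ (-(2 * c)) := by
  have hn' : (0 : ℝ) < n := Nat.cast_pos.2 hn
  rw [Real.rpow_neg hν.le, ← div_eq_mul_inv, ← Real.div_rpow hn'.le hν.le,
    Real.rpow_def_of_pos (div_pos hn' hν), diskRadius]
  ring_nf

theorem tendsto_rpow_div_cosh (hν : 0 < ν) {α : ℝ} (hα : 0 < α) :
    Tendsto (fun n : ℕ => (n : ℝ) ^ (2 * α) / (Real.cosh (α * diskRadius ν n) - 1)) atTop
      (𝓝 (2 * ν ^ (2 * α))) := by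
  have h0 : Tendsto (fun n : ℕ => Real.exp (-(α * diskRadius ν n))) atTop (𝓝 0) :=
    Real.tendsto_exp_neg_atTop_nhds_zero.comp ((tendsto_diskRadius hν).const_mul_atTop hα)
  have h1 : Tendsto (fun n : ℕ => 2 * ν ^ (2 * α) / (1 - Real.exp (-(α * diskRadius ν n))) ^ 2)
      atTop (𝓝 (2 * ν ^ (2 * α))) := by
    have := (h0.const_sub 1).pow 2
    rw [sub_zero, one_pow] at this
    simpa [Pi.div_def] using (tendsto_const_nhds (x := 2 * ν ^ (2 * α))).div this one_ne_zero
  refine h1.congr' ?_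
  filter_upwards [eventually_gt_atTop 0, (tendsto_diskRadius hν).eventually_gt_atTop 0] with n hn hR
  have hn' : (0 : ℝ) < n := Nat.cast_pos.2 hn
  have e1 := exp_mul_diskRadius hν hn α
  have hD := cosh_sub_one_pos hα hR
  have hx : 1 < Real.exp (α * diskRadius ν n) := Real.one_lt_exp_iff.2 (by positivity)
  have hν' : ν ^ (2 * α) * ν ^ (-(2 * α)) = 1 := by
    rw [← Real.rpow_add hν, add_neg_cancel, Real.rpow_zero]
  rw [Real.cosh_eq, Real.exp_neg] at hD ⊢
  have e2 : (n : ℝ) ^ (2 * α) = Real.exp (α * diskRadius ν n) * ν ^ (2 * α) := by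
    rw [e1, mul_assoc, mul_comm (ν ^ (-(2 * α))), hν', mul_one]
  rw [e2]
  set x := Real.exp (α * diskRadius ν n)
  have hx0 : x ≠ 0 := by positivity
  have hx1 : x - 1 ≠ 0 := by linarith
  have e3 : (x + x⁻¹) / 2 - 1 = (x - 1) ^ 2 / (2 * x) := by
    field_simp
    ring
  have e4 : 1 - x⁻¹ = (x - 1) / x := by field_simp
  rw [e3, e4]
  field_simp

/-- The asymptotics of `cosh (α * R_n) - 1`. -/
theorem tendsto_mul_radialCdf (hν : 0 < ν) {α : ℝ} (hα : 0 < α) {ρ : ℕ → ℝ} {c : ℝ}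
    (h : Tendsto (fun n : ℕ => (n : ℝ) ^ (1 - 2 * α) * (Real.cosh (α * ρ n) - 1)) atTop (𝓝 c)) :
    Tendsto (fun n : ℕ => n * radialCdf α (diskRadius ν n) (ρ n)) atTop
      (𝓝 (c * (2 * ν ^ (2 * α)))) := by
  refine (h.mul (tendsto_rpow_div_cosh hν hα)).congr' ?_
  filter_upwards [eventually_gt_atTop 0] with n hn
  have hn' : (0 : ℝ) < n := Nat.cast_pos.2 hn
  rw [radialCdf, Real.rpow_sub hn', Real.rpow_one]
  have := (Real.rpow_pos_of_pos hn' (2 * α)).ne'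
  field_simp

end Radius

/-! ### The mean of the degrees -/

section Tails

variable {α ν : ℝ}

theorem tendsto_rpow_neg_natCast {c : ℝ} (hc : c < 0) :
    Tendsto (fun n : ℕ => (n : ℝ) ^ c) atTop (𝓝 0) := by
  have := (tendsto_rpow_neg_atTop (neg_pos.2 hc)).comp (tendsto_natCast_atTop_atTop (R := ℝ))
  rw [neg_neg] at this
  exact this

theorem tendsto_sub_one_div : Tendsto (fun n : ℕ => ((n : ℝ) - 1) / n) atTop (𝓝 1) := by
  have h := (tendsto_natCast_atTop_atTop (R := ℝ)).const_div_atTop 1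
  have h1 : Tendsto (fun n : ℕ => 1 - 1 / (n : ℝ)) atTop (𝓝 1) := by simpa using h.const_sub 1
  refine h1.congr' ?_
  filter_upwards [eventually_gt_atTop 0] with n hn
  have hn' : (n : ℝ) ≠ 0 := by positivity
  field_simp

theorem antitoneOn_mul_ballMass (hα : 0 < α) (hν : 0 < ν) (l : ℝ) : ∀ᶠ n : ℕ in atTop,
    AntitoneOn (fun r => (n - 1) * ballMass α (diskRadius ν n) r / (n : ℝ) ^ l) (Set.Ici 0) := by
  filter_upwards [eventually_gt_atTop 0, (tendsto_diskRadius hν).eventually_gt_atTop 0] with n hn hR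
  intro r hr r' hr' h
  have h1 := antitoneOn_ballMass hα hR hr hr' h
  have h2 : (0 : ℝ) ≤ n - 1 := by
    rw [sub_nonneg]
    exact_mod_cast hn
  change _ ≤ _
  dsimp only
  gcongr

/-- The nodes with a given proportion of neighbours are at a distance of order `1` of the
origin. -/
theorem tendsto_tail_of_eq_half (hν : 0 < ν) {t : ℝ} (ht : t ∈ Set.Ioo (0 : ℝ) 1) :
    Tendsto (fun n : ℕ => n * (radialLaw (1 / 2) (diskRadius ν n)).real
      {r | t < (n - 1) * ballMass (1 / 2) (diskRadius ν n) r / (n : ℝ) ^ (1 : ℝ)}) atTop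
      (𝓝 (2 * ν * (Real.cosh (Vinv t / 2) - 1))) := by
  have hR := tendsto_diskRadius hν
  refine tendsto_mul_radialLaw (ρ := fun _ t => Vinv t) (I := Set.Ioo 0 1) one_half_pos
    (hR.eventually_gt_atTop 0) isOpen_Ioo (Λ := fun t => 2 * ν * (Real.cosh (Vinv t / 2) - 1))
    (antitoneOn_mul_ballMass one_half_pos hν 1) (fun t ht => ?_) (fun t ht => ?_)
    (fun t ht => ?_) ht ?_
  · filter_upwards [hR.eventually_ge_atTop (Vinv t)] with n hn
    exact ⟨(Vinv_pos ht).le, hn⟩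
  · have h1 := tendsto_ballMass_of_eq_half hR (Vinv_pos ht)
    rw [V_Vinv ht] at h1
    have h2 := tendsto_sub_one_div.mul h1
    rw [one_mul] at h2
    refine h2.congr fun n => ?_
    rw [Real.rpow_one]
    ring
  · have h := tendsto_mul_radialCdf hν one_half_pos (ρ := fun _ => Vinv t)
      (c := Real.cosh (1 / 2 * Vinv t) - 1) (by simp)
    convert h using 2
    rw [show (2 : ℝ) * (1 / 2) = 1 by norm_num, Real.rpow_one]
    ring_nf
  · have h1 : ContinuousAt Vinv t :=
      (differentiableOn_Vinv.differentiableAt (isOpen_Ioo.mem_nhds ht)).continuousAt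
    fun_prop

/-- The nodes of degree of order `n ^ (1 / (2 * α))` are at distance
`(2 - 1 / α) * log n + O(1)` of the origin. -/
theorem tendsto_tail_of_half_lt (hα : 1 / 2 < α) (hν : 0 < ν) {t : ℝ} (ht : 0 < t) :
    Tendsto (fun n : ℕ => n * (radialLaw α (diskRadius ν n)).real
      {r | t < (n - 1) * ballMass α (diskRadius ν n) r / (n : ℝ) ^ (1 / (2 * α))}) atTop
      (𝓝 ((C α * ν) ^ (2 * α) * t ^ (-(2 * α)))) := by
  have hR := tendsto_diskRadius hν
  have hα0 : 0 < α := by linarith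
  have hC : 0 < C α := div_pos (by linarith) (mul_pos Real.pi_pos (by linarith))
  have hl : 1 / (2 * α) - 1 < 0 := by
    rw [sub_neg, div_lt_one (by linarith)]
    linarith
  -- the radius at which the mean degree is about `t n ^ (1 / (2 α))`
  set ρ : ℕ → ℝ → ℝ := fun n t => -2 * Real.log (t / C α * (n : ℝ) ^ (1 / (2 * α) - 1)) with hρdef
  have hpos : ∀ t, 0 < t → ∀ n : ℕ, 0 < n → 0 < t / C α * (n : ℝ) ^ (1 / (2 * α) - 1) := by
    intro t ht n hn
    have hn' : (0 : ℝ) < n := Nat.cast_pos.2 hn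
    positivity
  have hexp : ∀ t, 0 < t → ∀ n : ℕ, 0 < n → ∀ c : ℝ,
      Real.exp (c * ρ n t) = (C α / t) ^ (2 * c) * (n : ℝ) ^ (2 * c * (1 - 1 / (2 * α))) := by
    intro t ht n hn c
    have hn' : (0 : ℝ) < n := Nat.cast_pos.2 hn
    have e : t / C α * (n : ℝ) ^ (1 / (2 * α) - 1) =
        (C α / t * (n : ℝ) ^ (1 - 1 / (2 * α)))⁻¹ := by
      rw [mul_inv, inv_div, ← Real.rpow_neg hn'.le, neg_sub]
    have hp : 0 < C α / t * (n : ℝ) ^ (1 - 1 / (2 * α)) := by positivity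
    rw [hρdef]
    dsimp only
    rw [e, Real.log_inv, mul_comm (2 * c) (1 - _), Real.rpow_mul hn'.le,
      ← Real.mul_rpow (by positivity) (by positivity), Real.rpow_def_of_pos hp]
    ring_nf
  have hρtop : ∀ t, 0 < t → Tendsto (fun n => ρ n t) atTop atTop := by
    intro t ht
    have h1 : Tendsto (fun n : ℕ => t / C α * (n : ℝ) ^ (1 / (2 * α) - 1)) atTop (𝓝[>] 0) := by
      refine tendsto_nhdsWithin_iff.2 ⟨?_, ?_⟩
      · simpa using (tendsto_rpow_neg_natCast hl).const_mul (t / C α)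
      · filter_upwards [eventually_gt_atTop 0] with n hn using hpos t ht n hn
    exact (Real.tendsto_log_nhdsGT_zero.comp h1).const_mul_atBot_of_neg (by norm_num)
  have hρR : ∀ t, 0 < t → Tendsto (fun n => Real.exp (ρ n t - diskRadius ν n)) atTop (𝓝 0) := by
    intro t ht
    have h1 := (tendsto_rpow_neg_natCast (c := -(1 / α)) (by
      have : 0 < 1 / α := by positivity
      linarith)).const_mul ((C α / t) ^ (2 : ℝ) * ν ^ (2 : ℝ))
    rw [mul_zero] at h1
    refine h1.congr' ?_
    filter_upwards [eventually_gt_atTop 0] with n hn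
    have hn' : (0 : ℝ) < n := Nat.cast_pos.2 hn
    have e1 := hexp t ht n hn 1
    have e2 := exp_mul_diskRadius hν hn (-1)
    rw [show ρ n t - diskRadius ν n = 1 * ρ n t + -1 * diskRadius ν n by ring, Real.exp_add, e1, e2]
    have e3 : (n : ℝ) ^ (-(1 / α)) =
        (n : ℝ) ^ (2 * 1 * (1 - 1 / (2 * α))) * (n : ℝ) ^ (2 * (-1 : ℝ)) := by
      rw [← Real.rpow_add hn']
      congr 1
      field_simp
      ring
    rw [e3]
    norm_num
    ring
  refine tendsto_mul_radialLaw (ρ := ρ) (I := Set.Ioi 0) hα0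
    (hR.eventually_gt_atTop 0) isOpen_Ioi (Λ := fun t => (C α * ν) ^ (2 * α) * t ^ (-(2 * α)))
    (antitoneOn_mul_ballMass hα0 hν _) (fun t ht => ?_) (fun t ht => ?_)
    (fun t ht => ?_) ht ?_
  · filter_upwards [(hρtop t ht).eventually_ge_atTop 0,
      (hρR t ht).eventually_lt_const one_pos] with n h1 h2
    rw [Real.exp_lt_one_iff] at h2
    exact ⟨h1, by linarith⟩
  · have ht' : 0 < t := ht
    have h1 := tendsto_exp_mul_ballMass hα hR (hρtop t ht) (hρR t ht)
    have h2 := (tendsto_sub_one_div.mul h1).const_mul (t / C α)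
    rw [one_mul, div_mul_cancel₀ _ hC.ne'] at h2
    refine h2.congr' ?_
    filter_upwards [eventually_gt_atTop 0] with n hn
    have hn' : (0 : ℝ) < n := Nat.cast_pos.2 hn
    have e := hexp t ht n hn (1 / 2)
    rw [show ρ n t / 2 = 1 / 2 * ρ n t by ring, e, show (2 : ℝ) * (1 / 2) = 1 by norm_num,
      Real.rpow_one, one_mul, Real.rpow_sub hn', Real.rpow_one]
    have := (Real.rpow_pos_of_pos hn' (1 / (2 * α))).ne'
    field_simp
  · have ht' : 0 < t := ht
    have h0 : Tendsto (fun n : ℕ => (n : ℝ) ^ (1 - 2 * α)) atTop (𝓝 0) :=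
      tendsto_rpow_neg_natCast (by linarith)
    have h1 : Tendsto (fun n => Real.exp (-α * ρ n t)) atTop (𝓝 0) := by
      have := Real.tendsto_exp_neg_atTop_nhds_zero.comp ((hρtop t ht).const_mul_atTop hα0)
      refine this.congr fun n => ?_
      simp [neg_mul]
    have h2 : Tendsto (fun n : ℕ => (C α / t) ^ (2 * α) / 2 + (n : ℝ) ^ (1 - 2 * α) *
        (Real.exp (-α * ρ n t) / 2 - 1)) atTop (𝓝 ((C α / t) ^ (2 * α) / 2)) := by
      simpa using (h0.mul ((h1.div_const 2).sub_const 1)).const_add ((C α / t) ^ (2 * α) / 2)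
    have h3 := tendsto_mul_radialCdf hν hα0 (ρ := fun n => ρ n t)
      (c := (C α / t) ^ (2 * α) / 2) (by
        refine h2.congr' ?_
        filter_upwards [eventually_gt_atTop 0] with n hn
        have hn' : (0 : ℝ) < n := Nat.cast_pos.2 hn
        have e := hexp t ht n hn α
        have e1 : (n : ℝ) ^ (1 - 2 * α) * (n : ℝ) ^ (2 * α * (1 - 1 / (2 * α))) = 1 := by
          have e0 : 1 - 2 * α + 2 * α * (1 - 1 / (2 * α)) = 0 := by
            field_simp
            ring
          rw [← Real.rpow_add hn', e0, Real.rpow_zero]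
        rw [Real.cosh_eq, e, neg_mul]
        linear_combination -(C α / t) ^ (2 * α) / 2 * e1)
    convert h3 using 2
    rw [Real.div_rpow hC.le ht'.le, Real.mul_rpow hC.le hν.le, Real.rpow_neg ht'.le]
    ring
  · exact (Real.continuousAt_rpow_const _ _ (Or.inl (ne_of_gt ht))).const_mul _

/-- The nodes that miss at most a multiple of `n ^ (α + 1 / 2)` nodes are at a distance of order
`n ^ (α - 1 / 2)` of the origin. -/
theorem tendsto_tail_of_lt_half (hα : 0 < α) (hα' : α < 1 / 2) (hν : 0 < ν) {t : ℝ} (ht : t < 0) :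
    Tendsto (fun n : ℕ => n * (radialLaw α (diskRadius ν n)).real
      {r | t < -((n - 1) * (1 - ballMass α (diskRadius ν n) r) / (n : ℝ) ^ (α + 1 / 2))}) atTop
      (𝓝 (Real.pi ^ 2 * ν ^ (2 * α) * t ^ 2)) := by
  have hR := tendsto_diskRadius hν
  have hπ := Real.pi_pos
  have hRpos := hR.eventually_gt_atTop 0
  -- the radius at which the mean number of missing neighbours is about `-t n ^ (α + 1 / 2)`
  set ρ : ℕ → ℝ → ℝ := fun n t => Real.pi * -t / α * (n : ℝ) ^ (α - 1 / 2) with hρdef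
  have hρ0 : ∀ t < 0, Tendsto (fun n => ρ n t) atTop (𝓝[>] 0) := by
    intro t ht
    refine tendsto_nhdsWithin_iff.2 ⟨?_, ?_⟩
    · have := (tendsto_rpow_neg_natCast (c := α - 1 / 2) (by linarith)).const_mul
        (Real.pi * -t / α)
      rwa [mul_zero] at this
    · filter_upwards [eventually_gt_atTop 0] with n hn
      have hn' : (0 : ℝ) < n := Nat.cast_pos.2 hn
      have : 0 < -t := by linarith
      change 0 < ρ n t
      positivity
  refine tendsto_mul_radialLaw (ρ := ρ) (I := Set.Iio 0) hα hRpos isOpen_Iio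
    (Λ := fun t => Real.pi ^ 2 * ν ^ (2 * α) * t ^ 2) ?_ (fun t ht => ?_) (fun t ht => ?_)
    (fun t ht => ?_) ht (by fun_prop)
  · filter_upwards [eventually_gt_atTop 0, hRpos] with n hn hR
    intro r hr r' hr' h
    have h1 := antitoneOn_ballMass hα hR hr hr' h
    have h2 : (0 : ℝ) ≤ n - 1 := by
      rw [sub_nonneg]
      exact_mod_cast hn
    change _ ≤ _
    dsimp only
    gcongr
  · have h := hρ0 t ht
    filter_upwards [h.eventually self_mem_nhdsWithin,
      (h.mono_right nhdsWithin_le_nhds).eventually_lt_const one_pos,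
      hR.eventually_ge_atTop 1] with n h1 h2 h3
    exact ⟨le_of_lt h1, h2.le.trans h3⟩
  · have ht' : t < 0 := ht
    have h1 := tendsto_one_sub_ballMass_div hα hR (hρ0 t ht) (by
      have h1 := (tendsto_rpow_neg_natCast (c := -(3 / 2) - α) (by linarith)).const_mul
        (ν ^ (2 : ℝ) / (Real.pi * -t / α))
      rw [mul_zero] at h1
      refine h1.congr' ?_
      filter_upwards [eventually_gt_atTop 0] with n hn
      have hn' : (0 : ℝ) < n := Nat.cast_pos.2 hn
      have e := exp_mul_diskRadius hν hn (-1)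
      have e1 : (n : ℝ) ^ (-(3 / 2) - α) = (n : ℝ) ^ (2 * (-1 : ℝ)) / (n : ℝ) ^ (α - 1 / 2) := by
        rw [← Real.rpow_sub hn']
        congr 1
        ring
      rw [show -diskRadius ν n = -1 * diskRadius ν n by ring, e, e1,
        show -(2 * -1 : ℝ) = 2 by norm_num]
      rw [hρdef]
      dsimp only
      rw [div_mul_div_comm]
      ring)
    have h2 := ((tendsto_sub_one_div.mul h1).const_mul (Real.pi * -t / α)).neg
    rw [one_mul, show -(Real.pi * -t / α * (α / Real.pi)) = t by field_simp] at h2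
    refine h2.congr' ?_
    filter_upwards [eventually_gt_atTop 0] with n hn
    have hn' : (0 : ℝ) < n := Nat.cast_pos.2 hn
    have e1 : (n : ℝ) ^ (α + 1 / 2) = (n : ℝ) ^ (α - 1 / 2) * n := by
      conv_rhs => rw [← Real.rpow_one (n : ℝ), ← Real.rpow_mul hn'.le, one_mul]
      rw [← Real.rpow_add hn']
      congr 1
      ring
    have hp := (Real.rpow_pos_of_pos hn' (α - 1 / 2)).ne'
    have hρn : ρ n t = Real.pi * -t / α * (n : ℝ) ^ (α - 1 / 2) := rfl
    have ht0 : t ≠ 0 := ht'.ne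
    rw [e1]
    generalize ballMass α (diskRadius ν n) (ρ n t) = p
    rw [hρn]
    field_simp
  · have ht' : t < 0 := ht
    -- `cosh x - 1` is equivalent to `x ^ 2 / 2` at the origin
    have h0 : Tendsto (fun n => ρ n t) atTop (𝓝 0) := (hρ0 t ht).mono_right nhdsWithin_le_nhds
    have h1 : Tendsto (fun n => Real.sinh (α * ρ n t / 2) / ρ n t) atTop (𝓝 (α / 2)) := by
      have hd : HasDerivAt (fun x => Real.sinh (α * x / 2)) (α / 2) 0 := by
        have := (Real.hasDerivAt_sinh (α * 0 / 2)).comp (0 : ℝ)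
          (((hasDerivAt_id (0 : ℝ)).const_mul α).div_const 2)
        simpa [Function.comp_def] using this
      have := hd.tendsto_slope.comp ((hρ0 t ht).mono_right
        (nhdsWithin_mono 0 fun x hx => ne_of_gt hx))
      refine this.congr fun n => ?_
      simp [slope_def_field]
    have h2 := ((h1.pow 2).const_mul (2 * (Real.pi * -t / α) ^ 2))
    have h3 := tendsto_mul_radialCdf hν hα (ρ := fun n => ρ n t)
      (c := 2 * (Real.pi * -t / α) ^ 2 * (α / 2) ^ 2) (by
        refine h2.congr' ?_
        filter_upwards [eventually_gt_atTop 0] with n hn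
        have hn' : (0 : ℝ) < n := Nat.cast_pos.2 hn
        have e1 : (n : ℝ) ^ (1 - 2 * α) * ((n : ℝ) ^ (α - 1 / 2)) ^ 2 = 1 := by
          have e0 : 1 - 2 * α + (α - 1 / 2) * (2 : ℕ) = 0 := by
            push_cast
            ring
          rw [← Real.rpow_natCast, ← Real.rpow_mul hn'.le, ← Real.rpow_add hn', e0, Real.rpow_zero]
        have e2 : Real.cosh (α * ρ n t) - 1 = 2 * Real.sinh (α * ρ n t / 2) ^ 2 := by
          have h := Real.cosh_two_mul (α * ρ n t / 2)
          rw [mul_div_cancel₀ _ two_ne_zero] at h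
          rw [h, Real.cosh_sq]
          ring
        have hp := (Real.rpow_pos_of_pos hn' (α - 1 / 2)).ne'
        have hρn : ρ n t = Real.pi * -t / α * (n : ℝ) ^ (α - 1 / 2) := rfl
        have ht0 : t ≠ 0 := ht'.ne
        have e3 : (Real.pi * -t / α) ^ 2 * (Real.sinh (α * ρ n t / 2) / ρ n t) ^ 2 =
            (Real.sinh (α * ρ n t / 2)) ^ 2 / ((n : ℝ) ^ (α - 1 / 2)) ^ 2 := by
          generalize Real.sinh (α * ρ n t / 2) = s
          rw [hρn]
          field_simp
        rw [mul_assoc, e3, e2, eq_comm]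
        generalize Real.sinh (α * ρ n t / 2) ^ 2 = s
        rw [eq_comm, ← mul_div_assoc, div_eq_iff (pow_ne_zero 2 hp)]
        linear_combination -(2 * s) * e1)
    convert h3 using 2
    field_simp

end Tails

/-! ### Degrees as scores -/

section Counts

variable {a b : EReal} {Λ : ℝ → ℝ} {l : ℝ} {D : Type*} [MeasurableSpace D]
  {Ω : ℕ → Type*} [∀ n, MeasurableSpace (Ω n)] {P : ∀ n, Measure (Ω n)}
  [∀ n, IsProbabilityMeasure (P n)]
  {X : ∀ n, Fin n → Ω n → D} {μ : ℕ → Measure D} {M : ℕ → D → ℝ} {Y : ∀ n, Fin n → Ω n → ℝ}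
  {R : ℕ → Set (D × D)}

theorem tendsto_measureReal_zero_of_subset {A B : ∀ n, Set (Ω n)}
    (h : ∀ᶠ n in atTop, A n ⊆ B n) (hB : Tendsto (fun n => (P n).real (B n)) atTop (𝓝 0)) :
    Tendsto (fun n => (P n).real (A n)) atTop (𝓝 0) := by
  refine squeeze_zero' (Eventually.of_forall fun _ => measureReal_nonneg) ?_ hB
  filter_upwards [h] with n hn
  exact measureReal_mono hn

/-- The numbers of neighbours follow their conditional means. -/
theorem closeToScores_neighbourCount (ha : 0 ≤ a) (hl : 0 < l) (hX : ∀ n i, Measurable (X n i))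
    (hlaw : ∀ᶠ n in atTop, ∀ i, HasLaw (X n i) (μ n) (P n))
    (hind : ∀ᶠ n in atTop, iIndepFun (X n) (P n)) (hR : ∀ n, MeasurableSet (R n))
    (hM : ∀ n, Measurable fun z => (μ n).real {w | (z, w) ∈ R n})
    (htail : ∀ t : ℝ, a < t → (t : EReal) < b → Tendsto (fun n : ℕ => n * (μ n).real
      {z | t < ((n : ℝ) - 1) * (μ n).real {w | (z, w) ∈ R n} / (n : ℝ) ^ l}) atTop (𝓝 (Λ t)))
    (hΛ : ∀ t : ℝ, a < t → (t : EReal) < b → ContinuousAt Λ t) :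
    CloseToScores a b Λ P X μ
      (fun n z => ((n : ℝ) - 1) * (μ n).real {w | (z, w) ∈ R n} / (n : ℝ) ^ l)
      fun n i ω => neighbourCount (R n) (fun j => X n j ω) i / (n : ℝ) ^ l := by
  refine ⟨hX, hlaw, hind, fun n => ((hM n).const_mul _).div_const _, htail, hΛ,
    fun s t has hst _ => ?_, fun s t has hst _ => ?_⟩
  · have hs : 0 < s := EReal.coe_pos.1 (ha.trans_lt has)
    refine tendsto_measureReal_zero_of_subset ?_
      (tendsto_exists_count_ge hl hlaw hind hR hs hst)
    filter_upwards [eventually_gt_atTop 0] with n hn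
    have hn' : (0 : ℝ) < (n : ℝ) ^ l := Real.rpow_pos_of_pos (Nat.cast_pos.2 hn) l
    rintro ω ⟨i, h1, h2⟩
    exact ⟨i, ((lt_div_iff₀ hn').1 h1).le, (div_le_iff₀ hn').1 h2⟩
  · have hs : 0 < s := EReal.coe_pos.1 (ha.trans_lt has)
    refine tendsto_measureReal_zero_of_subset ?_
      (tendsto_exists_count_le hl hlaw hind hR hs hst)
    filter_upwards [eventually_gt_atTop 0] with n hn
    have hn' : (0 : ℝ) < (n : ℝ) ^ l := Real.rpow_pos_of_pos (Nat.cast_pos.2 hn) l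
    rintro ω ⟨i, h1, h2⟩
    exact ⟨i, (div_le_iff₀ hn').1 h1, ((lt_div_iff₀ hn').1 h2).le⟩

/-- A variant of `closeToScores_neighbourCount` in which the largest scores are the smallest numbers
of neighbours. -/
theorem closeToScores_neg_neighbourCount (hb : b ≤ 0) (hl : 0 < l)
    (hX : ∀ n i, Measurable (X n i))
    (hlaw : ∀ᶠ n in atTop, ∀ i, HasLaw (X n i) (μ n) (P n))
    (hind : ∀ᶠ n in atTop, iIndepFun (X n) (P n)) (hR : ∀ n, MeasurableSet (R n))
    (hM : ∀ n, Measurable fun z => (μ n).real {w | (z, w) ∈ R n})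
    (htail : ∀ t : ℝ, a < t → (t : EReal) < b → Tendsto (fun n : ℕ => n * (μ n).real
      {z | t < -(((n : ℝ) - 1) * (μ n).real {w | (z, w) ∈ R n} / (n : ℝ) ^ l)}) atTop (𝓝 (Λ t)))
    (hΛ : ∀ t : ℝ, a < t → (t : EReal) < b → ContinuousAt Λ t) :
    CloseToScores a b Λ P X μ
      (fun n z => -(((n : ℝ) - 1) * (μ n).real {w | (z, w) ∈ R n} / (n : ℝ) ^ l))
      fun n i ω => -((neighbourCount (R n) (fun j => X n j ω) i + 1) / (n : ℝ) ^ l) := by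
  refine ⟨hX, hlaw, hind, fun n => (((hM n).const_mul _).div_const _).neg, htail, hΛ,
    fun s t _ hst htb => ?_, fun s t _ hst htb => ?_⟩
  · have ht : t < 0 := EReal.coe_neg'.1 (htb.trans_le hb)
    refine tendsto_measureReal_zero_of_subset ?_
      (tendsto_exists_count_le hl hlaw hind hR (neg_pos.2 ht) (neg_lt_neg hst))
    filter_upwards [eventually_gt_atTop 0] with n hn
    have hn' : (0 : ℝ) < (n : ℝ) ^ l := Real.rpow_pos_of_pos (Nat.cast_pos.2 hn) l
    rintro ω ⟨i, h1, h2⟩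
    rw [lt_neg, div_lt_iff₀ hn'] at h1
    rw [neg_le, le_div_iff₀ hn'] at h2
    exact ⟨i, by linarith, h2⟩
  · have ht : t < 0 := EReal.coe_neg'.1 (htb.trans_le hb)
    obtain ⟨u, hsu, hut⟩ := exists_between hst
    refine tendsto_measureReal_zero_of_subset ?_
      (tendsto_exists_count_ge hl hlaw hind hR (neg_pos.2 ht) (neg_lt_neg hut))
    have h0 : Tendsto (fun n : ℕ => (n : ℝ) ^ l) atTop atTop :=
      (tendsto_rpow_atTop hl).comp tendsto_natCast_atTop_atTop
    filter_upwards [eventually_gt_atTop 0, (h0.const_mul_atTop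
      (sub_pos.2 hsu)).eventually_ge_atTop 1] with n hn h1n
    have hn' : (0 : ℝ) < (n : ℝ) ^ l := Real.rpow_pos_of_pos (Nat.cast_pos.2 hn) l
    rintro ω ⟨i, h1, h2⟩
    rw [neg_le, le_div_iff₀ hn'] at h1
    rw [lt_neg, div_lt_iff₀ hn'] at h2
    exact ⟨i, by linarith, h2.le⟩

/-- The continuity of `Λ` excludes atoms at `t` in the limit. -/
theorem CloseToScores.tendsto_forall_lt (h : CloseToScores a b Λ P X μ M Y) {t : ℝ} (hat : a < t)
    (htb : (t : EReal) < b) :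
    Tendsto (fun n => (P n).real {ω | ∀ i, Y n i ω < t}) atTop (𝓝 (Real.exp (-Λ t))) := by
  have hcont : ContinuousAt (fun t => Real.exp (-Λ t)) t := (h.continuousAt t hat htb).neg.rexp
  refine tendsto_order.2 ⟨fun x hx => ?_, fun x hx => ?_⟩
  · have h1 : ∀ᶠ u : ℝ in 𝓝 t, a < u :=
      continuous_coe_real_ereal.continuousAt.eventually (lt_mem_nhds hat)
    obtain ⟨u, ⟨hu, hau⟩, hut⟩ := (((hcont.eventually (lt_mem_nhds hx)).and h1).filter_mono
      nhdsWithin_le_nhds |>.and self_mem_nhdsWithin : ∀ᶠ s in 𝓝[<] t, _).exists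
    have hut' : u < t := hut
    filter_upwards [(h.tendsto_forall_le hau ((EReal.coe_lt_coe_iff.2 hut').trans
      htb)).eventually_const_lt hu] with n hn
    exact hn.trans_le (measureReal_mono fun ω hω i => (hω i).trans_lt hut)
  · filter_upwards [(h.tendsto_forall_le hat htb).eventually_lt_const hx] with n hn
    exact (measureReal_mono fun ω hω i => (hω i).le).trans_lt hn

end Counts

section Graph

theorem deg_eq_neighbourCount (ν : ℝ) {n : ℕ} (x : Fin n → Disc) (i : Fin n) :
    (deg ν x i : ℝ) = neighbourCount (closePairs (diskRadius ν n)) x i := by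
  classical
  rw [deg, neighbourCount, ← SimpleGraph.card_neighborFinset_eq_degree,
    SimpleGraph.neighborFinset_eq_filter]
  congr 2
  ext j
  simp only [Finset.mem_filter, Finset.mem_univ, true_and]
  exact ⟨fun h => ⟨h.1.symm, h.2⟩, fun h => ⟨h.1.symm, h.2⟩⟩

theorem neighbourCount_compl {D : Type*} (R : Set (D × D)) {n : ℕ} (x : Fin n → D) (i : Fin n) :
    neighbourCount Rᶜ x i + 1 = n - neighbourCount R x i := by
  classical
  have h1 := Finset.card_filter_add_card_filter_not (s := Finset.univ.erase i)
    fun j => (x i, x j) ∈ R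
  rw [Finset.card_erase_of_mem (Finset.mem_univ i), Finset.card_univ, Fintype.card_fin,
    Finset.filter_erase, Finset.filter_erase] at h1
  have h2 : neighbourCount R x i =
      ((Finset.univ.filter fun j => (x i, x j) ∈ R).erase i).card := by
    rw [neighbourCount]
    congr 2
    ext j
    simp
  have h3 : neighbourCount Rᶜ x i =
      ((Finset.univ.filter fun j => (x i, x j) ∉ R).erase i).card := by
    rw [neighbourCount]
    congr 2
    ext j
    simp
  have hn : 1 ≤ n := Nat.one_le_iff_ne_zero.2 (Fin.pos i).ne'
  rw [h2, h3, ← Nat.cast_add_one, eq_sub_iff_add_eq, ← Nat.cast_add]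
  congr 1
  omega

theorem deg_le (ν : ℝ) {n : ℕ} (x : Fin n → Disc) (i : Fin n) : deg ν x i ≤ n := by
  classical
  rw [deg]
  have := (graph ν x).degree_lt_card_verts i
  rw [Fintype.card_fin] at this
  exact this.le

theorem measurable_deg (ν : ℝ) {n : ℕ} (i : Fin n) :
    Measurable fun x : Fin n → Disc => deg ν x i := by
  classical
  have h : (fun x : Fin n → Disc => deg ν x i) = fun x => ∑ j,
      if j ≠ i ∧ (x i, x j) ∈ closePairs (diskRadius ν n) then 1 else 0 := by
    ext x
    rw [← Finset.card_filter]
    have h := deg_eq_neighbourCount ν x i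
    rw [neighbourCount] at h
    rw [Nat.cast_injective h]
  rw [h]
  refine Finset.measurable_sum _ fun j _ => Measurable.ite ?_ measurable_const measurable_const
  have hij : MeasurableSet {x : Fin n → Disc | (x i, x j) ∈ closePairs (diskRadius ν n)} :=
    ((measurable_pi_apply i).prodMk (measurable_pi_apply j)) (measurableSet_closePairs _)
  exact (MeasurableSet.const _).inter hij

theorem maxDeg_le_iff (ν : ℝ) {n : ℕ} (x : Fin n → Disc) {T : ℝ} (hT : 0 ≤ T) :
    (maxDeg ν x : ℝ) ≤ T ↔ ∀ i, (deg ν x i : ℝ) ≤ T := by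
  classical
  refine ⟨fun h i => le_trans (Nat.cast_le.2 ((graph ν x).degree_le_maxDegree i)) h, fun h => ?_⟩
  rw [← Nat.le_floor_iff hT]
  exact (graph ν x).maxDegree_le_of_forall_degree_le _ fun i => (Nat.le_floor_iff hT).2 (h i)

theorem maxDeg_lt_iff (ν : ℝ) {n : ℕ} (x : Fin n → Disc) {T : ℝ} (hT : 0 < T) :
    (maxDeg ν x : ℝ) < T ↔ ∀ i, (deg ν x i : ℝ) < T := by
  classical
  refine ⟨fun h i => lt_of_le_of_lt (Nat.cast_le.2 ((graph ν x).degree_le_maxDegree i)) h,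
    fun h => ?_⟩
  have h0 : 0 < ⌈T⌉₊ := Nat.ceil_pos.2 hT
  rw [← Nat.lt_ceil]
  refine lt_of_le_of_lt ((graph ν x).maxDegree_le_of_forall_degree_le (⌈T⌉₊ - 1) fun i => ?_)
    (Nat.sub_lt h0 one_pos)
  exact Nat.le_sub_one_of_lt (Nat.lt_ceil.2 (h i))

theorem measurable_maxDeg (ν : ℝ) (n : ℕ) :
    Measurable fun x : Fin n → Disc => (maxDeg ν x : ℝ) := by
  refine measurable_of_Iic fun T => ?_
  rcases lt_or_ge T 0 with hT | hT
  · convert MeasurableSet.empty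
    ext x
    simp only [Set.mem_preimage, Set.mem_Iic, Set.mem_empty_iff_false, iff_false, not_le]
    exact hT.trans_le (Nat.cast_nonneg _)
  · have : (fun x : Fin n → Disc => (maxDeg ν x : ℝ)) ⁻¹' Set.Iic T =
        ⋂ i, {x | (deg ν x i : ℝ) ≤ T} := by
      ext x
      simp only [Set.mem_preimage, Set.mem_Iic, Set.mem_iInter, Set.mem_ofPred_eq]
      exact maxDeg_le_iff ν x hT
    rw [this]
    exact MeasurableSet.iInter fun i =>
      measurableSet_le (measurable_from_nat.comp (measurable_deg ν i)) measurable_const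

end Graph

section NodeLaw

variable {α ν : ℝ} {n : ℕ}

theorem isProbabilityMeasure_nodeLaw (hα : 0 < α) (hR : 0 < diskRadius ν n) :
    IsProbabilityMeasure (nodeLaw α ν n) := by
  have := isProbabilityMeasure_radialLaw hα hR
  have hprob : IsProbabilityMeasure (volume[|Set.Ioc (-Real.pi) Real.pi]) := by
    refine cond_isProbabilityMeasure_of_finite ?_ ?_ <;> simp [Real.volume_Ioc, Real.pi_pos]
  rw [nodeLaw_eq]
  exact Measure.isProbabilityMeasure_map measurable_polar.aemeasurable

theorem measurable_nodeLaw_section (α ν : ℝ) (n : ℕ) {R : Set (Disc × Disc)}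
    (hR : MeasurableSet R) : Measurable fun z => (nodeLaw α ν n).real {w | (z, w) ∈ R} := by
  have : SFinite (nodeLaw α ν n) := by
    unfold nodeLaw
    infer_instance
  exact (measurable_measure_prodMk_left hR).ennreal_toReal

theorem nodeLaw_real_ball_compl (hα : 0 < α) (hR : 0 < diskRadius ν n) (r φ : ℝ) :
    (nodeLaw α ν n).real {w | (polar (r, φ), w) ∈ (closePairs (diskRadius ν n))ᶜ} =
      1 - ballMass α (diskRadius ν n) r := by
  have := isProbabilityMeasure_nodeLaw hα hR
  rw [← nodeLaw_ball hα hR r φ]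
  exact probReal_compl_eq_one_sub (measurable_prodMk_left (measurableSet_closePairs _))

end NodeLaw

/-! ### The intensity measures -/

section Intensity

theorem intensity_tail {a b : EReal} (g : ℝ → ℝ) {t : ℝ} (hat : a < t) :
    intensity (Set.Ioc a b) g {y | (t : EReal) < y} =
      ∫⁻ y in {y : ℝ | t < y ∧ (y : EReal) ≤ b}, ENNReal.ofReal (g y) := by
  have hset : (Subtype.val '' {y : Set.Ioc a b | (t : EReal) < y}) = Set.Ioc (t : EReal) b := by
    ext y
    constructor
    · rintro ⟨z, hz, rfl⟩
      exact ⟨hz, z.2.2⟩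
    · rintro ⟨h1, h2⟩
      exact ⟨⟨y, hat.trans h1, h2⟩, h1, rfl⟩
  have hpre : Real.toEReal ⁻¹' Set.Ioc (t : EReal) b = {y : ℝ | t < y ∧ (y : EReal) ≤ b} := by
    ext y
    simp
  have hm : MeasurableSet {y : ℝ | t < y ∧ (y : EReal) ≤ b} := by
    rw [← hpre]
    exact measurable_coe_real_ereal measurableSet_Ioc
  rw [intensity, (MeasurableEmbedding.subtype_coe measurableSet_Ioc).comap_apply, hset,
    Measure.map_apply measurable_coe_real_ereal measurableSet_Ioc, hpre, withDensity_apply _ hm]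

theorem intensity_tail_of_lt_half (α ν : ℝ) (hν : 0 < ν) {t : ℝ} (ht : t < 0) :
    intensity (Set.Ioc ⊥ 0) (fun y => 2 * Real.pi ^ 2 * ν ^ (2 * α) * |y|)
      {y | (t : EReal) < y} = ENNReal.ofReal (Real.pi ^ 2 * ν ^ (2 * α) * t ^ 2) := by
  have hset : {y : ℝ | t < y ∧ (y : EReal) ≤ 0} = Set.Ioc t 0 := by
    ext y
    simp
  rw [intensity_tail _ (EReal.bot_lt_coe t), hset,
    ← ofReal_integral_eq_lintegral_ofReal
      (Continuous.integrableOn_Ioc (by fun_prop)) (Eventually.of_forall fun y => by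
        change 0 ≤ _
        positivity), ← intervalIntegral.integral_of_le ht.le]
  congr 1
  rw [intervalIntegral.integral_congr (g := fun y => -(2 * Real.pi ^ 2 * ν ^ (2 * α)) * y)]
  · rw [intervalIntegral.integral_const_mul, integral_id]
    ring
  · intro y hy
    rw [Set.uIcc_of_le ht.le] at hy
    dsimp only
    rw [abs_of_nonpos hy.2]
    ring

theorem intensity_tail_of_half_lt {α ν : ℝ} (hα : 1 / 2 < α) (hν : 0 < ν) {t : ℝ} (ht : 0 < t) :
    intensity (Set.Ioc 0 ⊤) (fun y => 2 * α * (C α * ν) ^ (2 * α) * y ^ (-2 * α - 1))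
      {y | (t : EReal) < y} = ENNReal.ofReal ((C α * ν) ^ (2 * α) * t ^ (-(2 * α))) := by
  have hα0 : 0 < α := by linarith
  have hC : 0 < C α := div_pos (by linarith) (mul_pos Real.pi_pos (by linarith))
  have hset : {y : ℝ | t < y ∧ (y : EReal) ≤ ⊤} = Set.Ioi t := by
    ext y
    simp
  rw [intensity_tail _ (EReal.coe_pos.2 ht), hset,
    ← ofReal_integral_eq_lintegral_ofReal
      ((integrableOn_Ioi_rpow_of_lt (by linarith) ht).const_mul _)
      ((ae_restrict_iff' measurableSet_Ioi).2 (Eventually.of_forall fun y hy => by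
        have : 0 < y := ht.trans hy
        change 0 ≤ _
        positivity)), integral_const_mul, integral_Ioi_rpow_of_lt (by linarith) ht]
  congr 1
  rw [show -2 * α - 1 + 1 = -(2 * α) by ring]
  field_simp

theorem intensity_tail_of_eq_half {ν : ℝ} (hν : 0 < ν) {t : ℝ} (ht : t ∈ Set.Ioo (0 : ℝ) 1) :
    intensity (Set.Ioc 0 1) (fun y => ν * |deriv Vinv y| * Real.sinh (Vinv y / 2))
      {y | (t : EReal) < y} = ENNReal.ofReal (2 * ν * (Real.cosh (Vinv t / 2) - 1)) := by
  have hset : {y : ℝ | t < y ∧ (y : EReal) ≤ 1} = Set.Ioc t 1 := by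
    ext y
    rw [Set.mem_ofPred_eq, ← EReal.coe_one, EReal.coe_le_coe_iff]
    rfl
  have hsub : Set.Ioo t 1 ⊆ Set.Ioo 0 1 := Set.Ioo_subset_Ioo_left ht.1.le
  have himage : Vinv '' Set.Ioo t 1 = Set.Ioo 0 (Vinv t) := by
    ext r
    constructor
    · rintro ⟨y, hy, rfl⟩
      exact ⟨Vinv_pos (hsub hy), strictAntiOn_Vinv ht (hsub hy) hy.1⟩
    · rintro ⟨h1, h2⟩
      refine ⟨V r, ⟨?_, (bijOn_V.mapsTo h1).2⟩, Vinv_V h1⟩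
      have := strictAntiOn_V h1 (Vinv_pos ht) h2
      rwa [V_Vinv ht] at this
  rw [intensity_tail _ (EReal.coe_pos.2 ht.1), hset, setLIntegral_congr Ioo_ae_eq_Ioc.symm]
  have hcov := lintegral_image_eq_lintegral_abs_deriv_mul measurableSet_Ioo
    (fun y hy => ((differentiableOn_Vinv.differentiableAt
      (isOpen_Ioo.mem_nhds (hsub hy))).hasDerivAt.hasDerivWithinAt :
        HasDerivWithinAt Vinv (deriv Vinv y) (Set.Ioo t 1) y))
    (strictAntiOn_Vinv.injOn.mono hsub) fun r => ENNReal.ofReal (ν * Real.sinh (r / 2))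
  rw [himage] at hcov
  have hmul : ∀ y ∈ Set.Ioo t 1, ENNReal.ofReal (ν * |deriv Vinv y| * Real.sinh (Vinv y / 2)) =
      ENNReal.ofReal |deriv Vinv y| * ENNReal.ofReal (ν * Real.sinh (Vinv y / 2)) := by
    intro y _
    rw [← ENNReal.ofReal_mul (abs_nonneg _)]
    ring_nf
  rw [setLIntegral_congr_fun measurableSet_Ioo hmul, ← hcov,
    setLIntegral_congr Ioo_ae_eq_Ioc, ← ofReal_integral_eq_lintegral_ofReal
      (Continuous.integrableOn_Ioc (by fun_prop))
      ((ae_restrict_iff' measurableSet_Ioc).2 (Eventually.of_forall fun r hr => by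
        have := Real.sinh_pos_iff.2 (half_pos hr.1)
        change 0 ≤ _
        positivity)), ← intervalIntegral.integral_of_le (Vinv_pos ht).le]
  congr 1
  rw [intervalIntegral.integral_eq_sub_of_hasDerivAt (f := fun r => 2 * ν * Real.cosh (r / 2))
    (fun r _ => ?_) (Continuous.intervalIntegrable (by fun_prop) _ _)]
  · simp
    ring
  · have h := ((Real.hasDerivAt_cosh (r / 2)).comp r
      ((hasDerivAt_id r).div_const 2)).const_mul (2 * ν)
    have e : ν * Real.sinh (r / 2) = 2 * ν * (Real.sinh (r / 2) * (1 / 2)) := by ring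
    rw [e]
    exact h

end Intensity

/-! ### The degrees of the random hyperbolic graph -/

section Degrees

variable {α ν : ℝ} {Ω : ℕ → Type*} [∀ n, MeasurableSpace (Ω n)] {P : ∀ n, Measure (Ω n)}
  [∀ n, IsProbabilityMeasure (P n)] {X : ∀ n, Fin n → Ω n → Disc}

theorem eventually_of_lt_cast {p : ℕ → Prop} (h : ∀ n : ℕ, ν < n → p n) : ∀ᶠ n in atTop, p n :=
  (tendsto_natCast_atTop_atTop.eventually_gt_atTop ν).mono h

/-- Over a node at distance `r` of the origin, the expected number of neighbours depends on `r`
only. -/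
theorem tendsto_tail_nodeLaw (hν : 0 < ν) {R : ℕ → Set (Disc × Disc)}
    (hR : ∀ n, MeasurableSet (R n)) {p : ℕ → ℝ → ℝ}
    (hp : ∀ n, 0 < diskRadius ν n → ∀ r φ,
      (nodeLaw α ν n).real {w | (polar (r, φ), w) ∈ R n} = p n r)
    {f : ℕ → ℝ → ℝ} (hf : ∀ n, Measurable (f n)) {t c : ℝ}
    (h : Tendsto (fun n : ℕ => n * (radialLaw α (diskRadius ν n)).real {r | t < f n (p n r)}) atTop
      (𝓝 c)) :
    Tendsto (fun n : ℕ => n * (nodeLaw α ν n).real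
      {z | t < f n ((nodeLaw α ν n).real {w | (z, w) ∈ R n})}) atTop (𝓝 c) := by
  refine h.congr' ?_
  filter_upwards [(tendsto_diskRadius hν).eventually_gt_atTop 0] with n hn
  rw [nodeLaw_radial (α := α)]
  · exact measurableSet_lt measurable_const
      ((hf n).comp (measurable_nodeLaw_section α ν n (hR n)))
  · intro r φ
    simp only [Set.mem_ofPred_eq]
    rw [hp n hn]

/-- The degrees, normalized by `n ^ l`, follow their means given the position of the node. -/
theorem closeToScores_deg {a b : EReal} (ha : 0 ≤ a) {l : ℝ} {Λ : ℝ → ℝ} (hα : 0 < α) (hν : 0 < ν)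
    (hl : 0 < l) (hX : ∀ n i, Measurable (X n i))
    (hlaw : ∀ n : ℕ, ν < n → ∀ i, HasLaw (X n i) (nodeLaw α ν n) (P n))
    (hindep : ∀ n : ℕ, ν < n → iIndepFun (X n) (P n))
    (htail : ∀ t : ℝ, a < t → (t : EReal) < b → Tendsto (fun n : ℕ => n *
      (radialLaw α (diskRadius ν n)).real
        {r | t < ((n : ℝ) - 1) * ballMass α (diskRadius ν n) r / (n : ℝ) ^ l}) atTop (𝓝 (Λ t)))
    (hΛ : ∀ t : ℝ, a < t → (t : EReal) < b → ContinuousAt Λ t) :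
    CloseToScores a b Λ P X (nodeLaw α ν) (fun n z => ((n : ℝ) - 1) *
        (nodeLaw α ν n).real {w | (z, w) ∈ closePairs (diskRadius ν n)} / (n : ℝ) ^ l)
      fun n i ω => (deg ν (fun j => X n j ω) i : ℝ) / (n : ℝ) ^ l := by
  simp only [deg_eq_neighbourCount]
  refine closeToScores_neighbourCount (R := fun n => closePairs (diskRadius ν n)) ha hl hX
    (eventually_of_lt_cast hlaw) (eventually_of_lt_cast hindep)
    (fun n => measurableSet_closePairs _)
    (fun n => measurable_nodeLaw_section α ν n (measurableSet_closePairs _)) (fun t h1 h2 => ?_) hΛ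
  exact tendsto_tail_nodeLaw hν (fun n => measurableSet_closePairs _)
    (fun n hn r φ => nodeLaw_ball hα hn r φ)
    (f := fun n p => ((n : ℝ) - 1) * p / (n : ℝ) ^ l) (fun n => by fun_prop) (htail t h1 h2)

/-- For `α < 1 / 2` the nodes of largest degree are linked to almost all nodes, and the
non-neighbours are the quantity that concentrates. -/
theorem closeToScores_deg_of_lt_half (hα : 0 < α) (hα' : α < 1 / 2) (hν : 0 < ν)
    (hX : ∀ n i, Measurable (X n i))
    (hlaw : ∀ n : ℕ, ν < n → ∀ i, HasLaw (X n i) (nodeLaw α ν n) (P n))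
    (hindep : ∀ n : ℕ, ν < n → iIndepFun (X n) (P n)) :
    CloseToScores ⊥ 0 (fun t => Real.pi ^ 2 * ν ^ (2 * α) * t ^ 2) P X (nodeLaw α ν)
      (fun n z => -(((n : ℝ) - 1) * (nodeLaw α ν n).real
        {w | (z, w) ∈ (closePairs (diskRadius ν n))ᶜ} / (n : ℝ) ^ (α + 1 / 2)))
      fun n i ω => ((deg ν (fun j => X n j ω) i : ℝ) - n) / (n : ℝ) ^ (α + 1 / 2) := by
  have h : (fun n i ω => ((deg ν (fun j => X n j ω) i : ℝ) - n) / (n : ℝ) ^ (α + 1 / 2)) =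
      fun n i ω => -((neighbourCount (closePairs (diskRadius ν n))ᶜ (fun j => X n j ω) i + 1) /
        (n : ℝ) ^ (α + 1 / 2)) := by
    funext n i ω
    rw [neighbourCount_compl, deg_eq_neighbourCount, ← neg_div, neg_sub]
  rw [h]
  refine closeToScores_neg_neighbourCount (R := fun n => (closePairs (diskRadius ν n))ᶜ) le_rfl
    (by linarith) hX (eventually_of_lt_cast hlaw) (eventually_of_lt_cast hindep)
    (fun n => (measurableSet_closePairs _).compl)
    (fun n => measurable_nodeLaw_section α ν n (measurableSet_closePairs _).compl)
    (fun t _ h2 => ?_) (fun t _ _ => by fun_prop)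
  exact tendsto_tail_nodeLaw hν (fun n => (measurableSet_closePairs _).compl)
    (fun n hn r φ => nodeLaw_real_ball_compl hα hn r φ)
    (f := fun n p => -(((n : ℝ) - 1) * p / (n : ℝ) ^ (α + 1 / 2))) (fun n => by fun_prop)
    (tendsto_tail_of_lt_half hα hα' hν (EReal.coe_neg'.1 h2))

theorem measurable_degrees (hX : ∀ n i, Measurable (X n i)) (n : ℕ) :
    Measurable fun ω i => deg ν (fun j => X n j ω) i :=
  measurable_pi_lambda _ fun i => (measurable_deg ν i).comp (measurable_pi_lambda _ (hX n))

theorem measurable_maxDeg_comp (hX : ∀ n i, Measurable (X n i)) (n : ℕ) :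
    Measurable fun ω => (maxDeg ν (fun j => X n j ω) : ℝ) :=
  (measurable_maxDeg ν n).comp (measurable_pi_lambda _ (hX n))

end Degrees

/-! ### The limit laws -/

section LimitLaws

variable {Ω' : Type*} [MeasurableSpace Ω'] {P' : Measure Ω'} {Z : Ω' → ℝ}

theorem IsWeibull.ae_pos [IsProbabilityMeasure P'] {β : ℝ} (hβ : β ≠ 0) (h : IsWeibull β Z P') :
    ∀ᵐ ω ∂P', 0 < Z ω := by
  have h1 := h.2 0 le_rfl
  rw [Real.zero_rpow hβ, neg_zero, Real.exp_zero, sub_self, measureReal_eq_zero_iff] at h1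
  filter_upwards [compl_mem_ae_iff.2 h1] with ω hω
  exact not_le.1 hω

theorem IsFrechet.ae_pos [IsProbabilityMeasure P'] {β : ℝ} (hβ : 0 < β) (h : IsFrechet β Z P') :
    ∀ᵐ ω ∂P', 0 < Z ω := by
  have h1 : P'.real {ω | Z ω ≤ 0} = 0 := by
    refine le_antisymm ?_ measureReal_nonneg
    have h2 : Tendsto (fun z : ℝ => Real.exp (-z ^ (-β))) (𝓝[>] 0) (𝓝 0) :=
      Real.tendsto_exp_neg_atTop_nhds_zero.comp (tendsto_rpow_neg_nhdsGT_zero (neg_lt_zero.2 hβ))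
    refine ge_of_tendsto h2 ?_
    filter_upwards [self_mem_nhdsWithin] with z hz
    rw [← h.2 z hz]
    exact measureReal_mono fun ω (hω : Z ω ≤ 0) => hω.trans (le_of_lt hz)
  rw [measureReal_eq_zero_iff] at h1
  filter_upwards [compl_mem_ae_iff.2 h1] with ω hω
  exact not_le.1 hω

theorem measureReal_ge_of_hasLaw_expMeasure {r : ℝ} (hr : 0 < r)
    (hZ : HasLaw Z (expMeasure r) P') {c : ℝ} (hc : 0 ≤ c) :
    P'.real {ω | c ≤ Z ω} = Real.exp (-(r * c)) := by
  have := isProbabilityMeasure_expMeasure hr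
  have : NullSingletonClass (expMeasure r) := by
    unfold expMeasure gammaMeasure
    infer_instance
  have h1 : P'.real {ω | c ≤ Z ω} = (expMeasure r).real (Set.Ici c) := by
    rw [← hZ.map_eq, map_measureReal_apply_of_aemeasurable hZ.aemeasurable measurableSet_Ici]
    rfl
  have h2 : (expMeasure r).real (Set.Ici c) = (expMeasure r).real (Set.Iic c)ᶜ := by
    rw [Set.compl_Iic]
    exact measureReal_congr Ioi_ae_eq_Ici.symm
  rw [h1, h2, probReal_compl_eq_one_sub measurableSet_Iic, ← cdf_eq_real, cdf_expMeasure_eq hr,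
    if_pos hc, sub_sub_cancel]

theorem ae_pos_of_hasLaw_expMeasure {r : ℝ} (hr : 0 < r) (hZ : HasLaw Z (expMeasure r) P') :
    ∀ᵐ ω ∂P', 0 < Z ω := by
  have : NullSingletonClass (expMeasure r) := by
    unfold expMeasure gammaMeasure
    infer_instance
  have h0 : ∀ᵐ z ∂(expMeasure r), 0 < z := by
    have := isProbabilityMeasure_expMeasure hr
    have h1 : (expMeasure r).real (Set.Iic 0) = 0 := by
      rw [← cdf_eq_real, cdf_expMeasure_eq hr]
      simp
    rw [measureReal_eq_zero_iff] at h1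
    filter_upwards [compl_mem_ae_iff.2 h1] with z hz
    exact not_le.1 hz
  rw [← hZ.map_eq] at h0
  exact ae_of_ae_map hZ.aemeasurable h0

theorem measurable_arcosh : Measurable Real.arcosh := by
  unfold Real.arcosh
  exact Real.measurable_log.comp (by fun_prop)

theorem aemeasurable_V_arcosh {r : ℝ} (hr : 0 < r) (hZ : HasLaw Z (expMeasure r) P') :
    AEMeasurable (fun ω => V (2 * Real.arcosh (Z ω + 1))) P' := by
  classical
  have hV : Measurable ((Set.Ioi 0).piecewise V fun _ => 0) := by
    refine ContinuousOn.measurable_piecewise (fun r hr => ?_) continuousOn_const measurableSet_Ioi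
    obtain ⟨v, -, hv⟩ := exists_hasDerivAt_V hr
    exact hv.continuousAt.continuousWithinAt
  refine (hV.comp_aemeasurable ((measurable_arcosh.comp_aemeasurable
    (hZ.aemeasurable.add_const 1)).const_mul 2)).congr ?_
  filter_upwards [ae_pos_of_hasLaw_expMeasure hr hZ] with ω hω
  exact Set.piecewise_eq_of_mem _ _ _ (mul_pos two_pos (Real.arcosh_pos (by linarith)))

theorem ae_V_arcosh_mem {r : ℝ} (hr : 0 < r) (hZ : HasLaw Z (expMeasure r) P') :
    ∀ᵐ ω ∂P', V (2 * Real.arcosh (Z ω + 1)) ∈ Set.Ioo (0 : ℝ) 1 := by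
  filter_upwards [ae_pos_of_hasLaw_expMeasure hr hZ] with ω hω
  exact bijOn_V.mapsTo (mul_pos two_pos (Real.arcosh_pos (by linarith)))

theorem measureReal_V_arcosh_le {r : ℝ} (hr : 0 < r) (hZ : HasLaw Z (expMeasure r) P') {t : ℝ}
    (ht : t ∈ Set.Ioo (0 : ℝ) 1) : P'.real {ω | V (2 * Real.arcosh (Z ω + 1)) ≤ t} =
      Real.exp (-(r * (Real.cosh (Vinv t / 2) - 1))) := by
  have h1 := Real.one_le_cosh (Vinv t / 2)
  rw [← measureReal_ge_of_hasLaw_expMeasure hr hZ (by linarith)]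
  refine measureReal_congr ?_
  filter_upwards [ae_pos_of_hasLaw_expMeasure hr hZ] with ω hω
  have h2 : 0 < 2 * Real.arcosh (Z ω + 1) := mul_pos two_pos (Real.arcosh_pos (by linarith))
  have h3 := Vinv_pos ht
  refine propext ?_
  change V (2 * Real.arcosh (Z ω + 1)) ≤ t ↔ Real.cosh (Vinv t / 2) - 1 ≤ Z ω
  conv_lhs => rw [← V_Vinv ht]
  rw [strictAntiOn_V.le_iff_ge h2 h3, ← div_le_iff₀' two_pos, sub_le_iff_le_add,
    ← Real.arcosh_le_arcosh (Real.cosh_pos _) (by linarith), Real.arcosh_cosh (half_pos h3).le]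

end LimitLaws

/-! ### The three regimes -/

section Regimes

variable {α ν : ℝ} {Ω : ℕ → Type*} [∀ n, MeasurableSpace (Ω n)] {P : ∀ n, Measure (Ω n)}
  [∀ n, IsProbabilityMeasure (P n)] {X : ∀ n, Fin n → Ω n → Disc}
  {Ω' : Type*} [MeasurableSpace Ω'] {P' : Measure Ω'} [IsProbabilityMeasure P']

theorem tendstoInDistribution_degrees_of_lt_half (hα : 0 < α) (hα' : α < 1 / 2) (hν : 0 < ν)
    (hX : ∀ n i, Measurable (X n i))
    (hlaw : ∀ n : ℕ, ν < n → ∀ i, HasLaw (X n i) (nodeLaw α ν n) (P n))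
    (hindep : ∀ n : ℕ, ν < n → iIndepFun (X n) (P n)) {η : Ω' → PointMeasure (Set.Ioc ⊥ 0)}
    (hη : IsPoissonProcess η
      (intensity (Set.Ioc ⊥ 0) fun y => 2 * Real.pi ^ 2 * ν ^ (2 * α) * |y|) P') :
    TendstoInDistribution (fun (n : ℕ) ω => pointsIn (Set.Ioc ⊥ 0) fun i =>
      (((n : ℝ) ^ (-(α + 1 / 2)) * ((deg ν (fun j => X n j ω) i : ℝ) - n) : ℝ) : EReal))
      atTop η P P' := by
  -- truncation at `n` makes the points nonpositive for every tuple of natural numbers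
  let y : ∀ n : ℕ, (Fin n → ℕ) → Fin n → ℝ := fun n k i =>
    (n : ℝ) ^ (-(α + 1 / 2)) * (((min (k i) n : ℕ) : ℝ) - n)
  have hy : ∀ n ω i, y n (fun i => deg ν (fun j => X n j ω) i) i =
      (n : ℝ) ^ (-(α + 1 / 2)) * ((deg ν (fun j => X n j ω) i : ℝ) - n) := by
    intro n ω i
    simp only [y]
    rw [min_eq_left (deg_le ν _ i)]
  have hs := closeToScores_deg_of_lt_half hα hα' hν hX hlaw hindep
  have e : (fun (n : ℕ) i ω => ((deg ν (fun j => X n j ω) i : ℝ) - n) / (n : ℝ) ^ (α + 1 / 2)) =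
      fun n i ω => y n (fun i => deg ν (fun j => X n j ω) i) i := by
    funext n i ω
    rw [hy, Real.rpow_neg n.cast_nonneg, div_eq_inv_mul]
  rw [e] at hs
  have h := CloseToScores.tendstoInDistribution (K := fun n ω i => deg ν (fun j => X n j ω) i)
    EReal.bot_lt_zero (measurable_degrees hX) hs (fun n k i => ?_) hη fun t _ ht =>
      intensity_tail_of_lt_half α ν hν (EReal.coe_neg'.1 ht)
  · simpa only [hy] using h
  · rw [← EReal.coe_zero, EReal.coe_le_coe_iff]
    refine mul_nonpos_of_nonneg_of_nonpos (by positivity) (sub_nonpos.2 ?_)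
    exact_mod_cast min_le_right _ _

theorem tendstoInDistribution_maxDeg_of_lt_half (hα : 0 < α) (hα' : α < 1 / 2) (hν : 0 < ν)
    (hX : ∀ n i, Measurable (X n i))
    (hlaw : ∀ n : ℕ, ν < n → ∀ i, HasLaw (X n i) (nodeLaw α ν n) (P n))
    (hindep : ∀ n : ℕ, ν < n → iIndepFun (X n) (P n)) {Z : Ω' → ℝ} (hZ : IsWeibull 2 Z P') :
    TendstoInDistribution (fun (n : ℕ) ω => Real.pi * ν ^ α *
      (((n : ℝ) - maxDeg ν (fun j => X n j ω)) / (n : ℝ) ^ (α + 1 / 2))) atTop Z P P' := by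
  have hc : 0 < Real.pi * ν ^ α := mul_pos Real.pi_pos (Real.rpow_pos_of_pos hν α)
  have hs := closeToScores_deg_of_lt_half hα hα' hν hX hlaw hindep
  refine tendstoInDistribution_of_tendsto_le (a := 0) (b := ⊤)
    (fun n => ((measurable_const.sub (measurable_maxDeg_comp hX n)).div_const _).const_mul _)
    hZ.1.aemeasurable ?_ fun z hz _ => ?_
  · filter_upwards [hZ.ae_pos two_ne_zero] with ω hω
    exact ⟨EReal.coe_pos.2 hω, EReal.coe_lt_top _⟩
  have hz0 : 0 < z := EReal.coe_pos.1 hz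
  set t := -(z / (Real.pi * ν ^ α)) with ht
  have ht0 : t < 0 := neg_neg_of_pos (div_pos hz0 hc)
  have h1 := (hs.tendsto_forall_lt (EReal.bot_lt_coe t) (EReal.coe_neg'.2 ht0)).const_sub 1
  have h2 : Real.pi ^ 2 * ν ^ (2 * α) * t ^ 2 = z ^ (2 : ℝ) := by
    have e : ν ^ (2 * α) = (ν ^ α) ^ 2 := by
      rw [mul_comm, Real.rpow_mul hν.le]
      norm_num
    have hp := (Real.rpow_pos_of_pos hν α).ne'
    rw [ht, e, Real.rpow_two]
    field_simp
  rw [hZ.2 z hz0.le, ← h2]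
  refine h1.congr' ?_
  have h3 : Tendsto (fun n : ℕ => (n : ℝ) ^ (1 / 2 - α)) atTop atTop :=
    (tendsto_rpow_atTop (by linarith)).comp tendsto_natCast_atTop_atTop
  filter_upwards [eventually_gt_atTop 0, h3.eventually_gt_atTop (-t)] with n hn hnt
  have hn' : (0 : ℝ) < n := Nat.cast_pos.2 hn
  have hp : (0 : ℝ) < (n : ℝ) ^ (α + 1 / 2) := Real.rpow_pos_of_pos hn' _
  -- eventually the threshold `n + t n ^ (α + 1 / 2)` for the degrees is positive
  have hT : 0 < n + t * (n : ℝ) ^ (α + 1 / 2) := by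
    have e : (n : ℝ) = (n : ℝ) ^ (1 / 2 - α) * (n : ℝ) ^ (α + 1 / 2) := by
      rw [← Real.rpow_add hn', show 1 / 2 - α + (α + 1 / 2) = 1 by ring, Real.rpow_one]
    have : 0 < ((n : ℝ) ^ (1 / 2 - α) + t) * (n : ℝ) ^ (α + 1 / 2) := mul_pos (by linarith) hp
    rw [add_mul, ← e] at this
    exact this
  have hset : {ω | Real.pi * ν ^ α * (((n : ℝ) - maxDeg ν (fun j => X n j ω)) /
      (n : ℝ) ^ (α + 1 / 2)) ≤ z} =
      {ω | ∀ i, ((deg ν (fun j => X n j ω) i : ℝ) - n) / (n : ℝ) ^ (α + 1 / 2) < t}ᶜ := by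
    ext ω
    have h4 : (∀ i, ((deg ν (fun j => X n j ω) i : ℝ) - n) / (n : ℝ) ^ (α + 1 / 2) < t) ↔
        (maxDeg ν (fun j => X n j ω) : ℝ) < n + t * (n : ℝ) ^ (α + 1 / 2) := by
      rw [maxDeg_lt_iff ν _ hT]
      refine forall_congr' fun i => ?_
      rw [div_lt_iff₀ hp, sub_lt_iff_lt_add']
    rw [Set.mem_compl_iff, Set.mem_ofPred_eq, Set.mem_ofPred_eq, h4, not_lt, mul_comm,
      ← le_div_iff₀ hc, div_le_iff₀ hp, ht]
    constructor <;> intro h <;> linarith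
  rw [hset, probReal_compl_eq_one_sub]
  have hm : MeasurableSet (⋂ i, {ω | ((deg ν (fun j => X n j ω) i : ℝ) - n) /
      (n : ℝ) ^ (α + 1 / 2) < t}) := MeasurableSet.iInter fun i =>
    measurableSet_lt (((measurable_from_nat.comp
      ((measurable_pi_apply i).comp (measurable_degrees hX n))).sub_const _).div_const _)
      measurable_const
  convert hm using 1
  ext ω
  simp

theorem closeToScores_deg_of_eq_half (hν : 0 < ν) (hX : ∀ n i, Measurable (X n i))
    (hlaw : ∀ n : ℕ, ν < n → ∀ i, HasLaw (X n i) (nodeLaw (1 / 2) ν n) (P n))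
    (hindep : ∀ n : ℕ, ν < n → iIndepFun (X n) (P n)) :
    CloseToScores 0 1 (fun t => 2 * ν * (Real.cosh (Vinv t / 2) - 1)) P X (nodeLaw (1 / 2) ν)
      (fun n z => ((n : ℝ) - 1) * (nodeLaw (1 / 2) ν n).real
        {w | (z, w) ∈ closePairs (diskRadius ν n)} / (n : ℝ) ^ (1 : ℝ))
      fun n i ω => (n : ℝ)⁻¹ * (deg ν (fun j => X n j ω) i : ℝ) := by
  have hmem : ∀ t : ℝ, (0 : EReal) < t → (t : EReal) < 1 → t ∈ Set.Ioo (0 : ℝ) 1 :=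
    fun t h0 h1 => ⟨EReal.coe_pos.1 h0, by exact_mod_cast h1⟩
  have h := closeToScores_deg (a := 0) (b := 1) (l := 1)
    (Λ := fun t => 2 * ν * (Real.cosh (Vinv t / 2) - 1)) le_rfl one_half_pos hν one_pos hX hlaw
    hindep (fun t h0 h1 => tendsto_tail_of_eq_half hν (hmem t h0 h1)) fun t h0 h1 => by
      have : ContinuousAt Vinv t := (differentiableOn_Vinv.differentiableAt
        (isOpen_Ioo.mem_nhds (hmem t h0 h1))).continuousAt
      fun_prop
  have e : (fun (n : ℕ) i ω => (deg ν (fun j => X n j ω) i : ℝ) / (n : ℝ) ^ (1 : ℝ)) =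
      fun (n : ℕ) i ω => (n : ℝ)⁻¹ * (deg ν (fun j => X n j ω) i : ℝ) := by
    funext n i ω
    rw [Real.rpow_one, div_eq_inv_mul]
  rwa [e] at h

theorem tendstoInDistribution_degrees_of_eq_half (hν : 0 < ν) (hX : ∀ n i, Measurable (X n i))
    (hlaw : ∀ n : ℕ, ν < n → ∀ i, HasLaw (X n i) (nodeLaw (1 / 2) ν n) (P n))
    (hindep : ∀ n : ℕ, ν < n → iIndepFun (X n) (P n)) {η : Ω' → PointMeasure (Set.Ioc 0 1)}
    (hη : IsPoissonProcess η
      (intensity (Set.Ioc 0 1) fun y => ν * |deriv Vinv y| * Real.sinh (Vinv y / 2)) P') :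
    TendstoInDistribution (fun (n : ℕ) ω => pointsIn (Set.Ioc 0 1) fun i =>
      (((n : ℝ)⁻¹ * (deg ν (fun j => X n j ω) i : ℝ) : ℝ) : EReal)) atTop η P P' := by
  -- truncation at `n` makes the points at most `1` for every tuple of natural numbers
  let y : ∀ n : ℕ, (Fin n → ℕ) → Fin n → ℝ := fun n k i => (n : ℝ)⁻¹ * ((min (k i) n : ℕ) : ℝ)
  have hy : ∀ n ω i, y n (fun i => deg ν (fun j => X n j ω) i) i =
      (n : ℝ)⁻¹ * (deg ν (fun j => X n j ω) i : ℝ) := by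
    intro n ω i
    simp only [y]
    rw [min_eq_left (deg_le ν _ i)]
  have hs := closeToScores_deg_of_eq_half hν hX hlaw hindep
  simp only [← hy] at hs
  have h := CloseToScores.tendstoInDistribution (K := fun n ω i => deg ν (fun j => X n j ω) i)
    zero_lt_one (measurable_degrees hX) hs (fun n k i => ?_) hη fun t h0 h1 =>
      intensity_tail_of_eq_half hν ⟨EReal.coe_pos.1 h0, by exact_mod_cast h1⟩
  · simpa only [hy] using h
  · rw [← EReal.coe_one, EReal.coe_le_coe_iff]
    refine inv_mul_le_one_of_le₀ ?_ n.cast_nonneg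
    exact_mod_cast min_le_right _ _

theorem tendstoInDistribution_maxDeg_of_eq_half (hν : 0 < ν) (hX : ∀ n i, Measurable (X n i))
    (hlaw : ∀ n : ℕ, ν < n → ∀ i, HasLaw (X n i) (nodeLaw (1 / 2) ν n) (P n))
    (hindep : ∀ n : ℕ, ν < n → iIndepFun (X n) (P n)) {Z : Ω' → ℝ}
    (hZ : HasLaw Z (expMeasure (2 * ν)) P') :
    TendstoInDistribution (fun (n : ℕ) ω => (n : ℝ)⁻¹ * (maxDeg ν (fun j => X n j ω) : ℝ))
      atTop (fun ω => V (2 * Real.arcosh (Z ω + 1))) P P' := by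
  have hν2 : 0 < 2 * ν := by linarith
  have hs := closeToScores_deg_of_eq_half hν hX hlaw hindep
  refine tendstoInDistribution_of_tendsto_le (a := 0) (b := 1)
    (fun n => (measurable_maxDeg_comp hX n).const_mul _) (aemeasurable_V_arcosh hν2 hZ) ?_
    fun t h0 h1 => ?_
  · filter_upwards [ae_V_arcosh_mem hν2 hZ] with ω hω
    exact ⟨EReal.coe_pos.2 hω.1, by exact_mod_cast hω.2⟩
  have ht0 : 0 < t := EReal.coe_pos.1 h0
  rw [measureReal_V_arcosh_le hν2 hZ ⟨ht0, by exact_mod_cast h1⟩]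
  refine (hs.tendsto_forall_le h0 h1).congr' ?_
  filter_upwards [eventually_gt_atTop 0] with n hn
  have hn' : (0 : ℝ) < n := Nat.cast_pos.2 hn
  congr 1
  ext ω
  simp only [Set.mem_ofPred_eq]
  rw [inv_mul_le_iff₀ hn', maxDeg_le_iff ν _ (by positivity)]
  exact forall_congr' fun i => inv_mul_le_iff₀ hn'

theorem closeToScores_deg_of_half_lt (hα : 1 / 2 < α) (hν : 0 < ν)
    (hX : ∀ n i, Measurable (X n i))
    (hlaw : ∀ n : ℕ, ν < n → ∀ i, HasLaw (X n i) (nodeLaw α ν n) (P n))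
    (hindep : ∀ n : ℕ, ν < n → iIndepFun (X n) (P n)) :
    CloseToScores 0 ⊤ (fun t => (C α * ν) ^ (2 * α) * t ^ (-(2 * α))) P X (nodeLaw α ν)
      (fun n z => ((n : ℝ) - 1) * (nodeLaw α ν n).real
        {w | (z, w) ∈ closePairs (diskRadius ν n)} / (n : ℝ) ^ (1 / (2 * α)))
      fun n i ω => (n : ℝ) ^ (-(1 / (2 * α))) * (deg ν (fun j => X n j ω) i : ℝ) := by
  have hα0 : 0 < α := by linarith
  have h := closeToScores_deg (a := 0) (b := ⊤) (l := 1 / (2 * α))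
    (Λ := fun t => (C α * ν) ^ (2 * α) * t ^ (-(2 * α))) le_rfl hα0 hν (by positivity) hX hlaw
    hindep (fun t h0 _ => tendsto_tail_of_half_lt hα hν (EReal.coe_pos.1 h0)) fun t h0 _ =>
      (Real.continuousAt_rpow_const _ _ (Or.inl (EReal.coe_pos.1 h0).ne')).const_mul _
  have e : (fun (n : ℕ) i ω => (deg ν (fun j => X n j ω) i : ℝ) / (n : ℝ) ^ (1 / (2 * α))) =
      fun (n : ℕ) i ω => (n : ℝ) ^ (-(1 / (2 * α))) * (deg ν (fun j => X n j ω) i : ℝ) := by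
    funext n i ω
    rw [Real.rpow_neg n.cast_nonneg, div_eq_inv_mul]
  rwa [e] at h

theorem tendstoInDistribution_degrees_of_half_lt (hα : 1 / 2 < α) (hν : 0 < ν)
    (hX : ∀ n i, Measurable (X n i))
    (hlaw : ∀ n : ℕ, ν < n → ∀ i, HasLaw (X n i) (nodeLaw α ν n) (P n))
    (hindep : ∀ n : ℕ, ν < n → iIndepFun (X n) (P n)) {η : Ω' → PointMeasure (Set.Ioc 0 ⊤)}
    (hη : IsPoissonProcess η (intensity (Set.Ioc 0 ⊤) fun y =>
      2 * α * (C α * ν) ^ (2 * α) * y ^ (-2 * α - 1)) P') :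
    TendstoInDistribution (fun (n : ℕ) ω => pointsIn (Set.Ioc 0 ⊤) fun i =>
      (((n : ℝ) ^ (-(1 / (2 * α))) * (deg ν (fun j => X n j ω) i : ℝ) : ℝ) : EReal))
      atTop η P P' := by
  have hs := closeToScores_deg_of_half_lt hα hν hX hlaw hindep
  exact CloseToScores.tendstoInDistribution
    (y := fun (n : ℕ) (k : Fin n → ℕ) i => (n : ℝ) ^ (-(1 / (2 * α))) * ((k i : ℕ) : ℝ))
    (K := fun n ω i => deg ν (fun j => X n j ω) i) EReal.zero_lt_top (measurable_degrees hX) hs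
    (fun _ _ _ => le_top) hη fun _ h0 _ => intensity_tail_of_half_lt hα hν (EReal.coe_pos.1 h0)

theorem tendstoInDistribution_maxDeg_of_half_lt (hα : 1 / 2 < α) (hν : 0 < ν)
    (hX : ∀ n i, Measurable (X n i))
    (hlaw : ∀ n : ℕ, ν < n → ∀ i, HasLaw (X n i) (nodeLaw α ν n) (P n))
    (hindep : ∀ n : ℕ, ν < n → iIndepFun (X n) (P n)) {Z : Ω' → ℝ}
    (hZ : IsFrechet (2 * α) Z P') :
    TendstoInDistribution (fun (n : ℕ) ω => (maxDeg ν (fun j => X n j ω) : ℝ) /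
      (C α * ν * (n : ℝ) ^ (1 / (2 * α)))) atTop Z P P' := by
  have hC : 0 < C α := div_pos (by linarith) (mul_pos Real.pi_pos (by linarith))
  have hc : 0 < C α * ν := mul_pos hC hν
  have hs := closeToScores_deg_of_half_lt hα hν hX hlaw hindep
  refine tendstoInDistribution_of_tendsto_le (a := 0) (b := ⊤)
    (fun n => (measurable_maxDeg_comp hX n).div_const _) hZ.1.aemeasurable ?_ fun z h0 _ => ?_
  · filter_upwards [hZ.ae_pos (by linarith)] with ω hω
    exact ⟨EReal.coe_pos.2 hω, EReal.coe_lt_top _⟩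
  have hz : 0 < z := EReal.coe_pos.1 h0
  have h1 : (C α * ν) ^ (2 * α) * (C α * ν * z) ^ (-(2 * α)) = z ^ (-(2 * α)) := by
    rw [Real.mul_rpow hc.le hz.le, ← mul_assoc, ← Real.rpow_add hc, add_neg_cancel,
      Real.rpow_zero, one_mul]
  rw [hZ.2 z hz, ← h1]
  refine (hs.tendsto_forall_le (EReal.coe_pos.2 (mul_pos hc hz)) (EReal.coe_lt_top _)).congr' ?_
  filter_upwards [eventually_gt_atTop 0] with n hn
  have hn' : (0 : ℝ) < (n : ℝ) ^ (1 / (2 * α)) := Real.rpow_pos_of_pos (Nat.cast_pos.2 hn) _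
  congr 1
  ext ω
  simp only [Set.mem_ofPred_eq]
  rw [div_le_iff₀ (by positivity), maxDeg_le_iff ν _ (by positivity)]
  refine forall_congr' fun i => ?_
  rw [Real.rpow_neg n.cast_nonneg, inv_mul_le_iff₀ hn']
  ring_nf

end Regimes

end RHG

end

theorem theorem3p3 (α ν : ℝ) (hα : 0 < α) (hν : 0 < ν)
    -- for each `n`, the nodes `X n 0, …, X n (n - 1)` are random points of the Poincaré disc
    {Ω : ℕ → Type*} [∀ n, MeasurableSpace (Ω n)]
    (P : ∀ n, Measure (Ω n)) [∀ n, IsProbabilityMeasure (P n)]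
    (X : ∀ n, Fin n → Ω n → RHG.Disc)
    (hX : ∀ n i, Measurable (X n i))
    -- which are independent with law `μ_n` (for `n > ν`, so that `μ_n` makes sense)
    (hlaw : ∀ n : ℕ, ν < n → ∀ i, HasLaw (X n i) (RHG.nodeLaw α ν n) (P n))
    (hindep : ∀ n : ℕ, ν < n → iIndepFun (X n) (P n))
    -- the probability space on which the limits are defined
    {Ω' : Type*} [MeasurableSpace Ω'] (P' : Measure Ω') [IsProbabilityMeasure P'] :
    (α < 1 / 2 →
      (∀ η : Ω' → RHG.PointMeasure (Set.Ioc ⊥ 0),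
        RHG.IsPoissonProcess η
          (RHG.intensity (Set.Ioc ⊥ 0) fun y => 2 * Real.pi ^ 2 * ν ^ (2 * α) * |y|) P' →
        TendstoInDistribution
          (fun (n : ℕ) ω => RHG.pointsIn (Set.Ioc ⊥ 0) fun i =>
            (((n : ℝ) ^ (-(α + 1 / 2)) * ((RHG.deg ν (fun j => X n j ω) i : ℝ) - n) : ℝ) : EReal))
          atTop η P P') ∧
      (∀ Z : Ω' → ℝ, RHG.IsWeibull 2 Z P' →
        TendstoInDistribution
          (fun (n : ℕ) ω => Real.pi * ν ^ α *
            (((n : ℝ) - RHG.maxDeg ν (fun j => X n j ω)) / (n : ℝ) ^ (α + 1 / 2)))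
          atTop Z P P')) ∧
    (α = 1 / 2 →
      -- `g₂` makes sense
      Set.BijOn RHG.V (Set.Ioi 0) (Set.Ioo 0 1) ∧
      DifferentiableOn ℝ RHG.Vinv (Set.Ioo 0 1) ∧
      (∀ η : Ω' → RHG.PointMeasure (Set.Ioc 0 1),
        RHG.IsPoissonProcess η
          (RHG.intensity (Set.Ioc 0 1) fun y =>
            ν * |deriv RHG.Vinv y| * Real.sinh (RHG.Vinv y / 2)) P' →
        TendstoInDistribution
          (fun (n : ℕ) ω => RHG.pointsIn (Set.Ioc 0 1) fun i =>
            (((n : ℝ)⁻¹ * (RHG.deg ν (fun j => X n j ω) i : ℝ) : ℝ) : EReal))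
          atTop η P P') ∧
      (∀ Z : Ω' → ℝ, HasLaw Z (expMeasure (2 * ν)) P' →
        TendstoInDistribution
          (fun (n : ℕ) ω => (n : ℝ)⁻¹ * (RHG.maxDeg ν (fun j => X n j ω) : ℝ))
          atTop (fun ω => RHG.V (2 * Real.arcosh (Z ω + 1))) P P')) ∧
    (1 / 2 < α →
      (∀ η : Ω' → RHG.PointMeasure (Set.Ioc 0 ⊤),
        RHG.IsPoissonProcess η
          (RHG.intensity (Set.Ioc 0 ⊤) fun y =>
            2 * α * (RHG.C α * ν) ^ (2 * α) * y ^ (-2 * α - 1)) P' →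
        TendstoInDistribution
          (fun (n : ℕ) ω => RHG.pointsIn (Set.Ioc 0 ⊤) fun i =>
            (((n : ℝ) ^ (-(1 / (2 * α))) * (RHG.deg ν (fun j => X n j ω) i : ℝ) : ℝ) : EReal))
          atTop η P P') ∧
      (∀ Z : Ω' → ℝ, RHG.IsFrechet (2 * α) Z P' →
        TendstoInDistribution
          (fun (n : ℕ) ω => (RHG.maxDeg ν (fun j => X n j ω) : ℝ) /
            (RHG.C α * ν * (n : ℝ) ^ (1 / (2 * α))))
          atTop Z P P')) := by
  refine ⟨fun h => ⟨fun η hη => ?_, fun Z hZ => ?_⟩, fun h => ?_, fun h =>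
    ⟨fun η hη => ?_, fun Z hZ => ?_⟩⟩
  · exact RHG.tendstoInDistribution_degrees_of_lt_half hα h hν hX hlaw hindep hη
  · exact RHG.tendstoInDistribution_maxDeg_of_lt_half hα h hν hX hlaw hindep hZ
  · subst h
    exact ⟨RHG.bijOn_V, RHG.differentiableOn_Vinv,
      fun η hη => RHG.tendstoInDistribution_degrees_of_eq_half hν hX hlaw hindep hη,
      fun Z hZ => RHG.tendstoInDistribution_maxDeg_of_eq_half hν hX hlaw hindep hZ⟩
  · exact RHG.tendstoInDistribution_degrees_of_half_lt h hν hX hlaw hindep hη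
  · exact RHG.tendstoInDistribution_maxDeg_of_half_lt h hν hX hlaw hindep hZ
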